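/- Let $n\ge 3$, $M=(0,\infty)_x\times\mathbb R^{n-1}_y$, and let $(x,y,\xi,\eta)$ be the coordinates on the scattering cotangent bundle ${}^{sc}T^*M$ corresponding to the covector $\xi\frac{dx}{x^2}+\eta\cdot\frac{dy}{x}$. Put $\rho=(1+|\xi|^2+|\eta|^2)^{-1/2}$, $\tau=(\rho\xi,\rho\eta_2,\dots,\rho\eta_{n-1})$, $d_\Sigma=(|\tau|^2+\rho)^{1/2}$, $\tilde\tau=\tau/d_\Sigma$, $d_\Gamma=(x+d_\Sigma^2+|\tilde\tau|^2)^{1/2}$. Let $\mathscr X$ be the fibrewise radial compactification of ${}^{sc}T^*M$ (including its boundary face over $x=0$), and let $\mathscr X_2$ be obtained from $\mathscr X$ by blowing up $\{\rho=0,\tau=0\}$ parabolically and then blowing up $\{x=0,d_\Sigma=0,\tilde\tau=0\}$ with $x^{1/2},d_\Sigma,\tilde\tau$ of equal weight. Thus $C^\infty(\mathscr X_2)$ consists, on the interior $x>0$, of the smooth functions of $x,\ y,\ \rho,\ \rho\xi,\ \rho\eta,\ d_\Sigma,\ \rho/d_\Sigma^2,\ \tilde\tau,\ d_\Gamma,\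 x/d_\Gamma^2,\ d_\Sigma/d_\Gamma,\ \tilde\tau/d_\Gamma$, and $\rho/d_\Sigma^2,\ x/d_\Gamma^2,\ d_\Sigma/d_\Gamma,\ d_\Gamma$ are the boundary defining functions of $\mathscr X_2$. Let $\mathcal V_2$ be the space of smooth vector fields on $\mathscr X_2$ tangent to $\partial\mathscr X_2$. Let $S^{0,0,0,0}$ be the set of smooth functions $a$ on ${}^{sc}T^*M$ such that, for every finite product $V^\alpha$ of fields in $\mathcal V_2$, $V^\alpha a$ is bounded over every set whose projection to $[0,\infty)\times\mathbb R^{n-1}$ is pre-compact. Let $S^{0,0,0,0}_{full}$ be the set of smooth functions $a(x,y,X,Y,\xi,\eta)$ on ${}^{sc}T^*M\times\mathbb R^n_{X,Y}$ satisfying the same bounds, uniformly in $(X,Y)\in\mathbb R^n$, for products of fields of $\mathcal V_2$ (lifted with no $(X,Y)$ component) and of the fields $\frac1x\partial_X,\frac1x\partial_{Y_j}$. For real $m,l,k,j$ set $S^{m,l,k,j}=\rho^{-m}x^{-l}d_\Sigma^{-k}d_\Gamma^{-j}S^{0,0,0,0}$ and $S^{m,l,k,j}_{full}=\rho^{-m}x^{-l}d_\Sigma^{-k}d_\Gamma^{-j}S^{0,0,0,0}_{full}$.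 The principal symbol of $a\in S^{m,l,k,j}$ is its class in $S^{m,l,k,j}/S^{m-1,l-1,k+1,j+1}$, and the principal symbol of a full symbol $a\in S^{m,l,k,j}_{full}$ is that of its restriction $a(x,y,0,0,\xi,\eta)$ to $(X,Y)=(0,0)$. For a full symbol $a$ and $u\in C_c^\infty(M)$ (extended by zero), let $$\mathrm{Op}(a)u(x,y)=(2\pi)^{-n}\int_{\mathbb R^n_{\xi,\eta}}\left(\int_{\mathbb R^n_{X,Y}}e^{i(\xi X+\eta\cdot Y)}a(x,y,X,Y,\xi,\eta)\,u(x+x^2X,y+xY)\,dX\,dY\right)d\xi\,d\eta .$$ Proposition. Let $a\in S^{m,l,k,j}_{full}$ vanish wherever $|(xX,xY)|\ge 1/2$. Then the integrals defining $\mathrm{Op}(a)u$ converge absolutely at each stage, and there is $\tilde a\in S^{m,l,k,j}_{full}$, with the integrals defining $\mathrm{Op}(\tilde a)u$ converging in the same sense, such that $\mathrm{Op}(\tilde a)$ is the adjoint of $\mathrm{Op}(a)$ with respect to the measure $\frac{dx\,dy}{x^{n+1}}$: for all $u,v\in C_c^\infty(M)$, $$\int_M (\mathrm{Op}(a)u)\,\overline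 v\,\frac{dx\,dy}{x^{n+1}}=\int_M u\,\overline{\mathrm{Op}(\tilde a)v}\,\frac{dx\,dy}{x^{n+1}},$$ both integrals being absolutely convergent. Moreover the principal symbol of $\tilde a$ is the class of $(x,y,\xi,\eta)\mapsto\overline a(x,y,0,0,\xi,\eta)$; in fact $\tilde a(x,y,0,0,\xi,\eta)=\overline a(x,y,0,0,\xi,\eta)$. -/

import Mathlib

open scoped ContDiff ComplexConjugate
open MeasureTheory

noncomputable section

namespace BBSymbol

/-- Coordinates are indexed by `Fin n`. For a base point `z = (x, y)` the entry `z 0` is `x` and the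
other entries are `y_1, …, y_{n-1}`; for a fibre variable `ζ = (ξ, η)` the entry `ζ 0` is `ξ` and
`ζ 1, …` are `η_1, …`; for `Z = (X, Y)` the entry `Z 0` is `X`. -/
abbrev E (n : ℕ) : Type := EuclideanSpace ℝ (Fin n)

/-- The scattering cotangent bundle in coordinates: `(z, ζ) = ((x, y), (ξ, η))` stands for the covector
`ξ dx/x² + η · dy/x` at `(x, y)`. Only the points of `interiorSet n` (those with `x > 0`) are used. -/
abbrev Phase (n : ℕ) : Type := E n × E n

/-- The space carrying full symbols: `((z, ζ), Z)`. -/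
abbrev FullPhase (n : ℕ) : Type := Phase n × E n

section Geometry

variable {n : ℕ} [NeZero n]

/-- The part `x > 0`: the scattering cotangent bundle of `M = (0, ∞) × ℝ^{n-1}`. -/
def interiorSet (n : ℕ) [NeZero n] : Set (Phase n) := {p | 0 < p.1 0}

/-- The part `x > 0` of the space carrying full symbols. -/
def fullInteriorSet (n : ℕ) [NeZero n] : Set (FullPhase n) := {q | 0 < q.1.1 0}

/-- `ρ = ⟨(ξ, η)⟩⁻¹`. -/
def rho (p : Phase n) : ℝ := (Real.sqrt (1 + ‖p.2‖ ^ 2))⁻¹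

/-- `τ = (ρ ξ, ρ η_2, …, ρ η_{n-1})`, stored as a vector indexed by `Fin n` whose entry at the index of
`η_1` is `0`. -/
def tau (p : Phase n) : E n := WithLp.toLp 2 (fun i => if i = 1 then 0 else rho p * p.2 i)

/-- `d_Σ = (|τ|² + ρ)^{1/2}`. -/
def dSigma (p : Phase n) : ℝ := Real.sqrt (‖tau p‖ ^ 2 + rho p)

/-- `τ̃ = τ / d_Σ`. -/
def tauTilde (p : Phase n) : E n := (dSigma p)⁻¹ • tau p

/-- `ρ̃ = ρ / d_Σ²`. -/
def rhoTilde (p : Phase n) : ℝ := rho p / dSigma p ^ 2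

/-- `d_Γ = (x + d_Σ² + |τ̃|²)^{1/2}`. -/
def dGamma (p : Phase n) : ℝ := Real.sqrt (p.1 0 + dSigma p ^ 2 + ‖tauTilde p‖ ^ 2)

/-- `x / d_Γ²`. -/
def xHat (p : Phase n) : ℝ := p.1 0 / dGamma p ^ 2

/-- `d_Σ / d_Γ`. -/
def sHat (p : Phase n) : ℝ := dSigma p / dGamma p

/-- `τ̃ / d_Γ`. -/
def tauHat (p : Phase n) : E n := (dGamma p)⁻¹ • tauTilde p

/-- The coordinate functions of the twice blown-up space `𝒳₂`, collected in one map: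
* `(x, y)`, `ρ`, `(ρ ξ, ρ η)` are the (half-sphere) coordinates of the radially compactified scattering
  cotangent bundle `𝒳`;
* `d_Σ, ρ̃, τ̃` are the coordinates created by the parabolic blow-up of `Σ = {ρ = 0, τ = 0}`;
* `d_Γ, x / d_Γ², d_Σ / d_Γ, τ̃ / d_Γ` are those created by the blow-up of
  `Γ = {x = 0, d_Σ = 0, τ̃ = 0}` in which `x^{1/2}, d_Σ, τ̃` have equal weight.
The closure of the image of `x > 0` is `𝒳₂`, embedded as a closed submanifold with corners. -/
def blowUpMap (p : Phase n) :
    E n × ℝ × E n × ℝ × ℝ × E n × ℝ × ℝ × ℝ × E n :=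
  (p.1, rho p, rho p • p.2, dSigma p, rhoTilde p, tauTilde p, dGamma p, xHat p, sHat p, tauHat p)

/-- `C^∞(𝒳₂)`, as functions on the interior `x > 0`: those that are smooth functions of the coordinates
of `𝒳₂`, up to and including its boundary. -/
def SmoothOnX2 (f : Phase n → ℝ) : Prop :=
  ∃ F : E n × ℝ × E n × ℝ × ℝ × E n × ℝ × ℝ × ℝ × E n → ℝ,
    ContDiff ℝ ∞ F ∧ ∀ p ∈ interiorSet n, f p = F (blowUpMap p)

/-- A vector field applied to a function. -/
def applyField {W G : Type*} [NormedAddCommGroup W] [NormedSpace ℝ W]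
    [NormedAddCommGroup G] [NormedSpace ℝ G] (V : W → W) (f : W → G) : W → G :=
  fun p => fderiv ℝ f p (V p)

/-- The product `V₁ V₂ ⋯ V_N` of vector fields, as a differential operator applied to a function. -/
def applyFields {W G : Type*} [NormedAddCommGroup W] [NormedSpace ℝ W]
    [NormedAddCommGroup G] [NormedSpace ℝ G] (L : List (W → W)) (f : W → G) : W → G :=
  L.foldr applyField f

/-- The boundary defining functions of the four boundary hypersurfaces of `𝒳₂`: the lift of fibre
infinity, the lift of `x = 0`, the first front face and the second front face. -/
def boundaryDefining : Set (Phase n → ℝ) := {rhoTilde, xHat, sHat, dGamma}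

/-- `𝒱₂`: the smooth vector fields on `𝒳₂` that are tangent to `∂𝒳₂`, given on the interior. -/
structure IsTangentField (V : Phase n → Phase n) : Prop where
  /-- `V` is a smooth vector field on the interior -/
  contDiffOn : ContDiffOn ℝ ∞ V (interiorSet n)
  /-- `V` is smooth on `𝒳₂`, up to the boundary -/
  smooth : ∀ f : Phase n → ℝ, SmoothOnX2 f → SmoothOnX2 (applyField V f)
  /-- `V` is tangent to every boundary hypersurface -/
  tangent : ∀ r ∈ boundaryDefining (n := n), ∃ g : Phase n → ℝ, SmoothOnX2 g ∧
    ∀ p ∈ interiorSet n, applyField V r p = g p * r p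

/-- The vector fields that test full symbols: the fields of `𝒱₂`, with no component in `(X, Y)`, and
the fields `x⁻¹ ∂_X`, `x⁻¹ ∂_{Y_j}`. -/
inductive IsFullTestField : (FullPhase n → FullPhase n) → Prop
  | lift (V : Phase n → Phase n) (hV : IsTangentField V) : IsFullTestField (fun q => (V q.1, 0))
  | dZ (i : Fin n) :
      IsFullTestField (fun q => (0, (q.1.1 0)⁻¹ • EuclideanSpace.single i (1 : ℝ)))

/-- `ρ^m x^l d_Σ^k d_Γ^j`. -/
def weight (m l k j : ℝ) (p : Phase n) : ℝ :=
  rho p ^ m * p.1 0 ^ l * dSigma p ^ k * dGamma p ^ j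

/-- The class `S^{0,0,0,0}`: smooth on the interior and `L^∞`-conormal to `∂𝒳₂`, uniformly over every
set with pre-compact projection to the base `[0, ∞) × ℝ^{n-1}`. -/
def IsSymbolZero (a : Phase n → ℂ) : Prop :=
  ContDiffOn ℝ ∞ a (interiorSet n) ∧
    ∀ L : List (Phase n → Phase n), (∀ V ∈ L, IsTangentField V) →
      ∀ R : ℝ, ∃ C : ℝ, ∀ p ∈ interiorSet n, ‖p.1‖ ≤ R → ‖applyFields L a p‖ ≤ C

/-- The class `S^{m,l,k,j} = ρ^{-m} x^{-l} d_Σ^{-k} d_Γ^{-j} S^{0,0,0,0}`. -/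
def IsSymbol (m l k j : ℝ) (a : Phase n → ℂ) : Prop :=
  IsSymbolZero (fun p => (weight m l k j p : ℂ) * a p)

/-- The class `S^{0,0,0,0}_full`. -/
def IsFullSymbolZero (a : FullPhase n → ℂ) : Prop :=
  ContDiffOn ℝ ∞ a (fullInteriorSet n) ∧
    ∀ L : List (FullPhase n → FullPhase n), (∀ V ∈ L, IsFullTestField V) →
      ∀ R : ℝ, ∃ C : ℝ, ∀ q ∈ fullInteriorSet n, ‖q.1.1‖ ≤ R → ‖applyFields L a q‖ ≤ C

/-- The class `S^{m,l,k,j}_full = ρ^{-m} x^{-l} d_Σ^{-k} d_Γ^{-j} S^{0,0,0,0}_full`. -/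
def IsFullSymbol (m l k j : ℝ) (a : FullPhase n → ℂ) : Prop :=
  IsFullSymbolZero (fun q => (weight m l k j q.1 : ℂ) * a q)

/-- The support condition `|(xX, xY)| < 1/2`: the symbol vanishes wherever `|(xX, xY)| ≥ 1/2`. -/
def SupportedNearDiagonal (a : FullPhase n → ℂ) : Prop :=
  ∀ q ∈ fullInteriorSet n, 1 / 2 ≤ ‖q.1.1 0 • q.2‖ → a q = 0

/-- Two symbols of `S^{m,l,k,j}` have the same class in `S^{m,l,k,j} / S^{m-1,l-1,k+1,j+1}`. -/
def SamePrincipalSymbol (m l k j : ℝ) (a b : Phase n → ℂ) : Prop :=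
  IsSymbol m l k j a ∧ IsSymbol m l k j b ∧
    IsSymbol (m - 1) (l - 1) (k + 1) (j + 1) (fun p => a p - b p)

/-- The restriction `a(x, y, 0, 0, ξ, η)` of a full symbol to `(X, Y) = (0, 0)`; its class represents
the principal symbol of `a`. -/
def restrictZero (a : FullPhase n → ℂ) : Phase n → ℂ := fun p => a (p, 0)

end Geometry

section Operators

variable {n : ℕ} [NeZero n]

/-- The point `(x + x² X, y + x Y)`. -/
def scatShift (z Z : E n) : E n :=
  WithLp.toLp 2 (fun i => if i = 0 then z 0 + z 0 ^ 2 * Z 0 else z i + z 0 * Z i)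

/-- Test functions: smooth, compactly supported in the open half-space `M = (0, ∞) × ℝ^{n-1}` (and
extended by zero). -/
structure IsTestFunction (u : E n → ℂ) : Prop where
  contDiff : ContDiff ℝ ∞ u
  hasCompactSupport : HasCompactSupport u
  tsupport_subset : tsupport u ⊆ {z | 0 < z 0}

/-- The integrand `e^{i(ξX + η·Y)} a(x, y, X, Y, ξ, η) u(x + x²X, y + xY)`. -/
def quantIntegrand (a : FullPhase n → ℂ) (u : E n → ℂ) (z ζ Z : E n) : ℂ :=
  Complex.exp (Complex.I * ((∑ i, ζ i * Z i : ℝ) : ℂ)) * a ((z, ζ), Z) * u (scatShift z Z)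

/-- The operator quantized by `a`,
`Au(x, y) = (2π)^{-n} ∫ e^{i(ξX + η·Y)} a(x, y, X, Y, ξ, η) u(x + x²X, y + xY) dX dY dξ dη`,
as the oscillatory integral in which the `(X, Y)`-integration is carried out first. -/
def quantize (a : FullPhase n → ℂ) (u : E n → ℂ) (z : E n) : ℂ :=
  (((2 * Real.pi) ^ n)⁻¹ : ℝ) * ∫ ζ : E n, ∫ Z : E n, quantIntegrand a u z ζ Z

/-- The iterated integral defining `quantize a u` converges absolutely at each stage, at every point of
`M` and for every test function. -/
def QuantizationConverges (a : FullPhase n → ℂ) : Prop :=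
  ∀ u : E n → ℂ, IsTestFunction u → ∀ z : E n, 0 < z 0 →
    (∀ ζ : E n, Integrable (fun Z : E n => quantIntegrand a u z ζ Z)) ∧
      Integrable (fun ζ : E n => ∫ Z : E n, quantIntegrand a u z ζ Z)

/-- The scattering volume `dx dy / x^{n+1}` on `x > 0`. -/
def scatVolume (n : ℕ) [NeZero n] : Measure (E n) :=
  ((volume : Measure (E n)).restrict {z | 0 < z 0}).withDensity
    (fun z => ENNReal.ofReal ((z 0 ^ (n + 1))⁻¹))

/-- `B` is the adjoint of `A` for the inner product `⟨u, v⟩ = ∫ u v̄ dx dy / x^{n+1}`: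
`⟨A u, v⟩ = ⟨u, B v⟩` for all test functions, both integrals being absolutely convergent. -/
def IsAdjoint (A B : (E n → ℂ) → E n → ℂ) : Prop :=
  ∀ u v : E n → ℂ, IsTestFunction u → IsTestFunction v →
    Integrable (fun z => A u z * conj (v z)) (scatVolume n) ∧
    Integrable (fun z => u z * conj (B v z)) (scatVolume n) ∧
    ∫ z, A u z * conj (v z) ∂(scatVolume n) = ∫ z, u z * conj (B v z) ∂(scatVolume n)

end Operators

end BBSymbol

end

/-!
The Schwartz kernel of the operator quantized by `a` is, up to the scattering density, the partial
Fourier transform in `(ξ, η)` of `a`, read at the base points `z = (x, y)` and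
`z' = (x + x² X, y + xY)`. The adjoint has the conjugate kernel with the two base points exchanged. In
the variables `((z, ζ), Z)` this exchange is the map `adjMap`: it moves `z` to `z'`, rescales `ζ` and
`Z` anisotropically by the ratio `s = 1 + xX` of the two values of `x`, and only changes the sign of the
phase `ζ · Z`. The Jacobians and densities combine to `s^{-(n+1)}`, so the full symbol of the adjoint is
`adjSymbol a = s^{-(n+1)} · conj (a ∘ adjMap)`. At `Z = 0` one has `s = 1` and `adjMap` is the identity,
whence the statement about principal symbols. Three things have to be proved.

*Invariance of the symbol class.* The module `𝒱₂` has the explicit frame `x ∂_x`, `∂_{y_j}`,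
`ρ⁻¹ ∂_{η_1}`, `d_Γ d_Σ ρ⁻¹ ∂_{ζ_i}` (`i ≠ 1`); see `isTangentField_frameField` and
`IsTangentField.exists_frame_coeff`. Hence membership in the symbol classes is a matter of iterated
derivatives along this frame and the fields `x⁻¹ ∂_Z` (`isFullSymbolZero_iff_conormal`). Where
`(xX, xY)` is bounded and `s` is bounded below, `ρ`, `d_Σ` and `d_Γ` change under `adjMap` by factors
which are conormal and bounded below: the squares of these factors, or of their inverses, are convex
combinations, with weights smooth on `𝒳₂`, of families of this kind built from `s` and the factors
found before (`Elliptic.convex`). With this the coefficients of the images of the frame fields are conormal (`conormal_adjMap_coeff`), and `adjMap` preserves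
conormality (`Conormal.comp_adjMap`, `FullSymbolFamily.adjSymbol`).

*Convergence.* The support condition makes the `Z`-integrals compactly supported, and integration by
parts along `x⁻¹ ∂_Z` shows that they decay rapidly in `ζ`, locally uniformly in the base
(`FullSymbolFamily.decay`).

*Adjointness.* If `a` is integrable in `ζ`, the relation follows from Fubini's theorem and affine
changes of variables (`IntegrableSymbol.pairing_adjSymbol`). A general `a` is multiplied by a power of
`(1 + ε² |ζ|²)⁻¹`. These factors form a bounded family of symbols of order zero (`conormal_cutoff`), and
so the bounds on which convergence rests are uniform in `ε`, and both pairings pass to the limit `ε → 0`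
by dominated convergence (`FullSymbolFamily.tendsto_pairing`). For this purpose conormality is treated
throughout for families of functions.
-/

noncomputable section

namespace BBSymbol

set_option linter.unusedSectionVars false

variable {n : ℕ} [NeZero n]

/-! ### Coordinates of the blown-up space -/

theorem isOpen_interiorSet : IsOpen (interiorSet n) := by
  unfold interiorSet
  exact isOpen_lt continuous_const (by fun_prop)

theorem one_add_norm_sq_pos (p : Phase n) : 0 < 1 + ‖p.2‖ ^ 2 := by positivity

theorem rho_pos (p : Phase n) : 0 < rho p :=
  inv_pos.2 (Real.sqrt_pos.2 (one_add_norm_sq_pos p))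

theorem rho_sq (p : Phase n) : rho p ^ 2 * (1 + ‖p.2‖ ^ 2) = 1 := by
  rw [rho, inv_pow, Real.sq_sqrt (one_add_norm_sq_pos p).le,
    inv_mul_cancel₀ (one_add_norm_sq_pos p).ne']

theorem rho_le_one (p : Phase n) : rho p ≤ 1 := by
  rw [rho]
  exact inv_le_one_of_one_le₀ (Real.one_le_sqrt.2 (by nlinarith [sq_nonneg ‖p.2‖]))

theorem dSigma_pos (p : Phase n) : 0 < dSigma p :=
  Real.sqrt_pos.2 (add_pos_of_nonneg_of_pos (sq_nonneg _) (rho_pos p))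

theorem dSigma_sq (p : Phase n) : dSigma p ^ 2 = ‖tau p‖ ^ 2 + rho p :=
  Real.sq_sqrt (add_pos_of_nonneg_of_pos (sq_nonneg _) (rho_pos p)).le

theorem dGamma_arg_pos {p : Phase n} (hp : p ∈ interiorSet n) :
    0 < p.1 0 + dSigma p ^ 2 + ‖tauTilde p‖ ^ 2 := by
  have : 0 < p.1 0 := hp
  positivity

theorem dGamma_pos {p : Phase n} (hp : p ∈ interiorSet n) : 0 < dGamma p :=
  Real.sqrt_pos.2 (dGamma_arg_pos hp)

theorem dGamma_sq {p : Phase n} (hp : p ∈ interiorSet n) :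
    dGamma p ^ 2 = p.1 0 + dSigma p ^ 2 + ‖tauTilde p‖ ^ 2 :=
  Real.sq_sqrt (dGamma_arg_pos hp).le

theorem tau_apply (p : Phase n) (i : Fin n) : tau p i = if i = 1 then 0 else rho p * p.2 i := rfl

theorem tauTilde_apply (p : Phase n) (i : Fin n) : tauTilde p i = (dSigma p)⁻¹ * tau p i := rfl

theorem tauHat_apply (p : Phase n) (i : Fin n) : tauHat p i = (dGamma p)⁻¹ * tauTilde p i := rfl

theorem weight_pos {m l k j : ℝ} {p : Phase n} (hp : p ∈ interiorSet n) : 0 < weight m l k j p := by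
  have h1 := Real.rpow_pos_of_pos (rho_pos p) m
  have h2 := Real.rpow_pos_of_pos (show 0 < p.1 0 from hp) l
  have h3 := Real.rpow_pos_of_pos (dSigma_pos p) k
  have h4 := Real.rpow_pos_of_pos (dGamma_pos hp) j
  unfold weight
  positivity

theorem contDiff_rho : ContDiff ℝ ∞ (rho (n := n)) := by
  unfold rho
  refine ContDiff.inv (ContDiff.sqrt (contDiff_const.add (contDiff_snd.norm_sq ℝ))
    fun p => (one_add_norm_sq_pos p).ne') fun p => ?_
  exact (Real.sqrt_pos.2 (one_add_norm_sq_pos p)).ne'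

theorem contDiff_tau : ContDiff ℝ ∞ (tau (n := n)) := by
  rw [contDiff_euclidean]
  intro i
  simp only [tau_apply]
  split_ifs
  · exact contDiff_const
  · exact contDiff_rho.mul (by fun_prop)

theorem contDiff_dSigma : ContDiff ℝ ∞ (dSigma (n := n)) := by
  unfold dSigma
  refine ContDiff.sqrt ((contDiff_tau.norm_sq ℝ).add contDiff_rho) fun p => ?_
  exact (add_pos_of_nonneg_of_pos (sq_nonneg _) (rho_pos p)).ne'

theorem contDiff_tauTilde : ContDiff ℝ ∞ (tauTilde (n := n)) := by
  unfold tauTilde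
  exact (contDiff_dSigma.inv fun p => (dSigma_pos p).ne').smul contDiff_tau

theorem contDiff_rhoTilde : ContDiff ℝ ∞ (rhoTilde (n := n)) := by
  unfold rhoTilde
  exact contDiff_rho.div (contDiff_dSigma.pow 2) fun p => (pow_pos (dSigma_pos p) 2).ne'

theorem contDiffOn_dGamma : ContDiffOn ℝ ∞ (dGamma (n := n)) (interiorSet n) := by
  unfold dGamma
  refine ContDiffOn.sqrt ?_ fun p hp => (dGamma_arg_pos hp).ne'
  refine ContDiff.contDiffOn ?_
  exact (ContDiff.add (by fun_prop) (contDiff_dSigma.pow 2)).add (contDiff_tauTilde.norm_sq ℝ)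

theorem contDiffOn_blowUpMap : ContDiffOn ℝ ∞ (blowUpMap (n := n)) (interiorSet n) := by
  have h := contDiffOn_dGamma (n := n)
  have h' : ContDiffOn ℝ ∞ (fun p : Phase n => (dGamma p)⁻¹) (interiorSet n) :=
    h.inv fun p hp => (dGamma_pos hp).ne'
  unfold blowUpMap
  refine contDiff_fst.contDiffOn.prodMk <| contDiff_rho.contDiffOn.prodMk <|
    ((contDiff_rho.smul contDiff_snd).contDiffOn).prodMk <| contDiff_dSigma.contDiffOn.prodMk <|
    contDiff_rhoTilde.contDiffOn.prodMk <| contDiff_tauTilde.contDiffOn.prodMk <| h.prodMk <|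
    ContDiffOn.prodMk ?_ <| ContDiffOn.prodMk ?_ ?_
  · unfold xHat
    exact ContDiffOn.div (by fun_prop) (h.pow 2) fun p hp => (pow_pos (dGamma_pos hp) 2).ne'
  · unfold sHat
    exact contDiff_dSigma.contDiffOn.div h fun p hp => (dGamma_pos hp).ne'
  · unfold tauHat
    exact h'.smul contDiff_tauTilde.contDiffOn

/-! ### Smooth functions on the blown-up space -/

namespace SmoothOnX2

variable {f g : Phase n → ℝ}

theorem congr (hf : SmoothOnX2 f) (h : ∀ p ∈ interiorSet n, g p = f p) : SmoothOnX2 g := by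
  obtain ⟨F, hF, hF'⟩ := hf
  exact ⟨F, hF, fun p hp => (h p hp).trans (hF' p hp)⟩

theorem const (c : ℝ) : SmoothOnX2 (fun _ : Phase n => c) :=
  ⟨fun _ => c, contDiff_const, fun _ _ => rfl⟩

theorem add (hf : SmoothOnX2 f) (hg : SmoothOnX2 g) : SmoothOnX2 (fun p => f p + g p) := by
  obtain ⟨F, hF, hF'⟩ := hf
  obtain ⟨G, hG, hG'⟩ := hg
  exact ⟨_, hF.add hG, fun p hp => by simp only [hF' p hp, hG' p hp]⟩

theorem mul (hf : SmoothOnX2 f) (hg : SmoothOnX2 g) : SmoothOnX2 (fun p => f p * g p) := by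
  obtain ⟨F, hF, hF'⟩ := hf
  obtain ⟨G, hG, hG'⟩ := hg
  exact ⟨_, hF.mul hG, fun p hp => by simp only [hF' p hp, hG' p hp]⟩

theorem neg (hf : SmoothOnX2 f) : SmoothOnX2 (fun p => -f p) :=
  ((const (-1)).mul hf).congr fun p _ => by ring

theorem sub (hf : SmoothOnX2 f) (hg : SmoothOnX2 g) : SmoothOnX2 (fun p => f p - g p) :=
  (hf.add hg.neg).congr fun p _ => by ring

theorem pow (hf : SmoothOnX2 f) (k : ℕ) : SmoothOnX2 (fun p => f p ^ k) := by
  obtain ⟨F, hF, hF'⟩ := hf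
  exact ⟨_, hF.pow k, fun p hp => by simp only [hF' p hp]⟩

theorem sum {ι : Type*} (s : Finset ι) {f : ι → Phase n → ℝ} (hf : ∀ i ∈ s, SmoothOnX2 (f i)) :
    SmoothOnX2 (fun p => ∑ i ∈ s, f i p) := by
  classical
  induction s using Finset.induction_on with
  | empty => simpa using const 0
  | insert i s his ih =>
    simp only [Finset.sum_insert his]
    exact (hf i (by simp)).add (ih fun j hj => hf j (by simp [hj]))

theorem base (i : Fin n) : SmoothOnX2 (fun p : Phase n => p.1 i) :=
  ⟨fun w => w.1 i, by fun_prop, fun _ _ => rfl⟩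

theorem rho : SmoothOnX2 (rho (n := n)) :=
  ⟨fun w => w.2.1, by fun_prop, fun _ _ => rfl⟩

theorem theta (i : Fin n) : SmoothOnX2 (fun p : Phase n => BBSymbol.rho p * p.2 i) :=
  ⟨fun w => w.2.2.1 i, by fun_prop, fun _ _ => rfl⟩

theorem dSigma : SmoothOnX2 (dSigma (n := n)) :=
  ⟨fun w => w.2.2.2.1, by fun_prop, fun _ _ => rfl⟩

theorem rhoTilde : SmoothOnX2 (rhoTilde (n := n)) :=
  ⟨fun w => w.2.2.2.2.1, by fun_prop, fun _ _ => rfl⟩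

theorem tauTilde (i : Fin n) : SmoothOnX2 (fun p : Phase n => tauTilde p i) :=
  ⟨fun w => w.2.2.2.2.2.1 i, by fun_prop, fun _ _ => rfl⟩

theorem dGamma : SmoothOnX2 (dGamma (n := n)) :=
  ⟨fun w => w.2.2.2.2.2.2.1, by fun_prop, fun _ _ => rfl⟩

theorem xHat : SmoothOnX2 (xHat (n := n)) :=
  ⟨fun w => w.2.2.2.2.2.2.2.1, by fun_prop, fun _ _ => rfl⟩

theorem sHat : SmoothOnX2 (sHat (n := n)) :=
  ⟨fun w => w.2.2.2.2.2.2.2.2.1, by fun_prop, fun _ _ => rfl⟩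

theorem tauHat (i : Fin n) : SmoothOnX2 (fun p : Phase n => tauHat p i) :=
  ⟨fun w => w.2.2.2.2.2.2.2.2.2 i, by fun_prop, fun _ _ => rfl⟩

theorem norm_sq_tauTilde : SmoothOnX2 (fun p : Phase n => ‖BBSymbol.tauTilde p‖ ^ 2) := by
  simp only [EuclideanSpace.real_norm_sq_eq]
  exact sum _ fun i _ => (tauTilde i).pow 2

theorem norm_sq_tauHat : SmoothOnX2 (fun p : Phase n => ‖BBSymbol.tauHat p‖ ^ 2) := by
  simp only [EuclideanSpace.real_norm_sq_eq]
  exact sum _ fun i _ => (tauHat i).pow 2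

theorem contDiffOn (hf : SmoothOnX2 f) : ContDiffOn ℝ ∞ f (interiorSet n) := by
  obtain ⟨F, hF, hF'⟩ := hf
  exact (hF.comp_contDiffOn contDiffOn_blowUpMap).congr hF'

theorem differentiableAt (hf : SmoothOnX2 f) {p : Phase n} (hp : p ∈ interiorSet n) :
    DifferentiableAt ℝ f p :=
  (hf.contDiffOn.contDiffAt (isOpen_interiorSet.mem_nhds hp)).differentiableAt (by simp)

end SmoothOnX2

/-! ### Relations between the coordinates -/

theorem dSigma_eq_sHat_mul {p : Phase n} (hp : p ∈ interiorSet n) :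
    dSigma p = sHat p * dGamma p := by
  rw [sHat, div_mul_cancel₀ _ (dGamma_pos hp).ne']

theorem rho_eq_rhoTilde_mul (p : Phase n) : rho p = rhoTilde p * dSigma p ^ 2 := by
  rw [rhoTilde, div_mul_cancel₀ _ (pow_pos (dSigma_pos p) 2).ne']

theorem base_zero_eq_xHat_mul {p : Phase n} (hp : p ∈ interiorSet n) :
    p.1 0 = xHat p * dGamma p ^ 2 := by
  rw [xHat, div_mul_cancel₀ _ (pow_pos (dGamma_pos hp) 2).ne']

theorem tauTilde_eq_tauHat_mul {p : Phase n} (hp : p ∈ interiorSet n) (i : Fin n) :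
    tauTilde p i = tauHat p i * dGamma p := by
  rw [tauHat_apply, mul_comm, mul_inv_cancel_left₀ (dGamma_pos hp).ne']

theorem tau_eq_tauTilde_mul (p : Phase n) (i : Fin n) :
    tau p i = tauTilde p i * dSigma p := by
  rw [tauTilde_apply, mul_comm, mul_inv_cancel_left₀ (dSigma_pos p).ne']

theorem norm_tau (p : Phase n) : ‖tau p‖ = ‖tauTilde p‖ * dSigma p := by
  rw [tauTilde, norm_smul, norm_inv, Real.norm_of_nonneg (dSigma_pos p).le, mul_comm,
    mul_inv_cancel_left₀ (dSigma_pos p).ne']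

theorem norm_tauTilde {p : Phase n} (hp : p ∈ interiorSet n) :
    ‖tauTilde p‖ = ‖tauHat p‖ * dGamma p := by
  rw [tauHat, norm_smul, norm_inv, Real.norm_of_nonneg (dGamma_pos hp).le, mul_comm,
    mul_inv_cancel_left₀ (dGamma_pos hp).ne']

/-- The coordinates of the first front face satisfy the equation of a parabolic half-sphere. -/
theorem norm_sq_tauTilde_add_rhoTilde (p : Phase n) : ‖tauTilde p‖ ^ 2 + rhoTilde p = 1 := by
  have h := dSigma_sq p
  have h' := dSigma_pos p
  rw [norm_tau, rho_eq_rhoTilde_mul p] at h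
  have : dSigma p ^ 2 ≠ 0 := by positivity
  apply mul_right_cancel₀ this
  linarith

/-- The coordinates of the second front face satisfy the equation of a quasi-homogeneous sphere. -/
theorem xHat_add_sHat_add_tauHat {p : Phase n} (hp : p ∈ interiorSet n) :
    xHat p + sHat p ^ 2 + ‖tauHat p‖ ^ 2 = 1 := by
  have h := dGamma_sq hp
  have h' := dGamma_pos hp
  rw [norm_tauTilde hp] at h
  have hx := base_zero_eq_xHat_mul hp
  have hs : dSigma p ^ 2 = (sHat p * dGamma p) ^ 2 := by rw [← dSigma_eq_sHat_mul hp]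
  have : dGamma p ^ 2 ≠ 0 := by positivity
  apply mul_right_cancel₀ this
  linarith

theorem norm_theta_le_one (p : Phase n) : ‖rho p • p.2‖ ≤ 1 := by
  have h := rho_sq p
  rw [norm_smul, Real.norm_of_nonneg (rho_pos p).le]
  have := rho_pos p
  rw [← abs_of_nonneg (mul_nonneg this.le (norm_nonneg p.2)), ← sq_le_one_iff_abs_le_one]
  nlinarith

theorem norm_tau_le_one (p : Phase n) : ‖tau p‖ ≤ 1 := by
  refine le_trans ?_ (norm_theta_le_one p)
  rw [EuclideanSpace.norm_eq, EuclideanSpace.norm_eq]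
  refine Real.sqrt_le_sqrt (Finset.sum_le_sum fun i _ => ?_)
  rw [tau_apply]
  split_ifs
  · rw [norm_zero, zero_pow two_ne_zero]
    positivity
  · simp

theorem dSigma_sq_le_two (p : Phase n) : dSigma p ^ 2 ≤ 2 := by
  rw [dSigma_sq]
  nlinarith [norm_tau_le_one p, rho_le_one p, norm_nonneg (tau p)]

theorem rhoTilde_nonneg (p : Phase n) : 0 ≤ rhoTilde p :=
  div_nonneg (rho_pos p).le (sq_nonneg _)

theorem norm_tauTilde_le_one (p : Phase n) : ‖tauTilde p‖ ≤ 1 := by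
  have := norm_sq_tauTilde_add_rhoTilde p
  nlinarith [rhoTilde_nonneg p, norm_nonneg (tauTilde p)]

theorem dGamma_sq_le {p : Phase n} (hp : p ∈ interiorSet n) {R : ℝ} (hR : ‖p.1‖ ≤ R) :
    dGamma p ^ 2 ≤ R + 3 := by
  rw [dGamma_sq hp]
  have h1 := dSigma_sq_le_two p
  have h2 := norm_tauTilde_le_one p
  have h3 : p.1 0 ≤ R := (le_abs_self _).trans ((PiLp.norm_apply_le p.1 0).trans hR)
  nlinarith [norm_nonneg (tauTilde p)]

/-- Over a bounded part of the base, the blow-up map takes values in a bounded set: all the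
projective coordinates lie in unit balls. -/
theorem norm_blowUpMap_le {p : Phase n} (hp : p ∈ interiorSet n) {R : ℝ} (hR : ‖p.1‖ ≤ R) :
    ‖blowUpMap p‖ ≤ R + 4 := by
  have hR0 : 0 ≤ R := (norm_nonneg _).trans hR
  have hx : 0 < p.1 0 := hp
  have h1 := xHat_add_sHat_add_tauHat hp
  have h2 : 0 ≤ xHat p := div_nonneg hx.le (sq_nonneg _)
  have h3 : 0 ≤ sHat p := div_nonneg (dSigma_pos p).le (dGamma_pos hp).le
  have h4 := norm_sq_tauTilde_add_rhoTilde p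
  have h5 := rhoTilde_nonneg p
  have h6 := dGamma_sq_le hp hR
  have h7 := dSigma_sq_le_two p
  have h8 := dGamma_pos hp
  have h9 := dSigma_pos p
  simp only [blowUpMap, Prod.norm_mk, max_le_iff, Real.norm_eq_abs]
  refine ⟨by linarith, ?_, (norm_theta_le_one p).trans (by linarith), ?_, ?_,
    (norm_tauTilde_le_one p).trans (by linarith), ?_, ?_, ?_, ?_⟩
  · rw [abs_of_pos (rho_pos p)]; linarith [rho_le_one p]
  · rw [abs_of_pos h9]; nlinarith
  · rw [abs_of_nonneg h5]; nlinarith [norm_nonneg (tauTilde p)]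
  · rw [abs_of_pos h8]; nlinarith
  · rw [abs_of_nonneg h2]; nlinarith [norm_nonneg (tauHat p)]
  · rw [abs_of_nonneg h3]; nlinarith [norm_nonneg (tauHat p)]
  · nlinarith [norm_nonneg (tauHat p)]

/-- Functions smooth on `𝒳₂` are bounded over bounded parts of the base, as `𝒳₂` is proper over the
base. -/
theorem SmoothOnX2.exists_bound {f : Phase n → ℝ} (hf : SmoothOnX2 f) (R : ℝ) :
    ∃ C, ∀ p ∈ interiorSet n, ‖p.1‖ ≤ R → ‖f p‖ ≤ C := by
  obtain ⟨F, hF, hF'⟩ := hf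
  obtain ⟨C, hC⟩ := (isCompact_closedBall (0 : E n × ℝ × E n × ℝ × ℝ × E n × ℝ × ℝ × ℝ × E n)
    (R + 4)).exists_bound_of_continuousOn hF.continuous.continuousOn
  refine ⟨C, fun p hp hR => ?_⟩
  rw [hF' p hp]
  exact hC _ (by simpa using norm_blowUpMap_le hp hR)

/-! ### A frame of tangent vector fields -/

section DirDeriv

variable {W : Type*} [NormedAddCommGroup W] [NormedSpace ℝ W] {f g : W → ℝ} {a b : ℝ} {p v : W}

/-- `f` is differentiable at `p` and its derivative at `p` in the direction `v` is `a`. -/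
def HasDirDeriv (f : W → ℝ) (a : ℝ) (p v : W) : Prop :=
  DifferentiableAt ℝ f p ∧ fderiv ℝ f p v = a

namespace HasDirDeriv

theorem congr_value (hf : HasDirDeriv f a p v) (h : a = b) : HasDirDeriv f b p v := h ▸ hf

theorem congr_of_mem (hf : HasDirDeriv f a p v) {s : Set W} (hs : IsOpen s) (hp : p ∈ s)
    (h : ∀ q ∈ s, g q = f q) : HasDirDeriv g a p v := by
  have h' : g =ᶠ[nhds p] f := Filter.eventually_of_mem (hs.mem_nhds hp) h
  exact ⟨hf.1.congr_of_eventuallyEq h', by rw [h'.fderiv_eq, hf.2]⟩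

theorem const (c : ℝ) : HasDirDeriv (fun _ : W => c) 0 p v :=
  ⟨differentiableAt_const c, by simp⟩

theorem clm (L : W →L[ℝ] ℝ) : HasDirDeriv (fun q => L q) (L v) p v :=
  ⟨L.differentiableAt, by rw [L.fderiv]⟩

theorem add (hf : HasDirDeriv f a p v) (hg : HasDirDeriv g b p v) :
    HasDirDeriv (fun q => f q + g q) (a + b) p v :=
  ⟨hf.1.add hg.1, by rw [fderiv_fun_add hf.1 hg.1, add_apply, hf.2, hg.2]⟩

theorem mul (hf : HasDirDeriv f a p v) (hg : HasDirDeriv g b p v) :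
    HasDirDeriv (fun q => f q * g q) (a * g p + f p * b) p v :=
  ⟨hf.1.mul hg.1, by
    rw [fderiv_fun_mul hf.1 hg.1, add_apply, smul_apply,
      smul_apply, hf.2, hg.2, smul_eq_mul, smul_eq_mul]; ring⟩

theorem sum {ι : Type*} (s : Finset ι) {f : ι → W → ℝ} {a : ι → ℝ}
    (hf : ∀ i ∈ s, HasDirDeriv (f i) (a i) p v) :
    HasDirDeriv (fun q => ∑ i ∈ s, f i q) (∑ i ∈ s, a i) p v := by
  refine ⟨DifferentiableAt.fun_sum fun i hi => (hf i hi).1, ?_⟩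
  rw [fderiv_fun_sum fun i hi => (hf i hi).1, sum_apply]
  exact Finset.sum_congr rfl fun i hi => (hf i hi).2

theorem inv (hf : HasDirDeriv f a p v) (h : f p ≠ 0) :
    HasDirDeriv (fun q => (f q)⁻¹) (-a / f p ^ 2) p v := by
  have := (hasDerivAt_inv h).comp_hasFDerivAt p hf.1.hasFDerivAt
  refine ⟨this.differentiableAt, ?_⟩
  have h2 : fderiv ℝ (fun q => (f q)⁻¹) p = _ := this.fderiv
  rw [h2, smul_apply, hf.2, smul_eq_mul]
  field_simp

theorem sqrt (hf : HasDirDeriv f a p v) (h : 0 < f p) :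
    HasDirDeriv (fun q => Real.sqrt (f q)) (a / (2 * Real.sqrt (f p))) p v := by
  have := hf.1.hasFDerivAt.sqrt h.ne'
  refine ⟨this.differentiableAt, ?_⟩
  rw [this.fderiv, smul_apply, hf.2, smul_eq_mul]
  field_simp

end HasDirDeriv

end DirDeriv

/-- A smooth field is tangent to `∂𝒳₂` as soon as `ρ`, `d_Σ`, `d_Γ` and `x` have smooth logarithmic
derivatives along it and the remaining coordinates have smooth derivatives. -/
theorem isTangentField_of_log_derivatives {V : Phase n → Phase n}
    (hV : ContDiffOn ℝ ∞ V (interiorSet n)) {A M N B : Phase n → ℝ} {Z Θ T : Fin n → Phase n → ℝ}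
    (hA : SmoothOnX2 A) (hM : SmoothOnX2 M) (hN : SmoothOnX2 N) (hB : SmoothOnX2 B)
    (hZ : ∀ i, SmoothOnX2 (Z i)) (hΘ : ∀ i, SmoothOnX2 (Θ i)) (hT : ∀ i, SmoothOnX2 (T i))
    (dA : ∀ p ∈ interiorSet n, HasDirDeriv rho (A p * rho p) p (V p))
    (dM : ∀ p ∈ interiorSet n, HasDirDeriv dSigma (M p * dSigma p) p (V p))
    (dN : ∀ p ∈ interiorSet n, HasDirDeriv dGamma (N p * dGamma p) p (V p))
    (dB : ∀ p ∈ interiorSet n, HasDirDeriv (fun q : Phase n => q.1 0) (B p * p.1 0) p (V p))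
    (dZ : ∀ i, ∀ p ∈ interiorSet n, HasDirDeriv (fun q : Phase n => q.1 i) (Z i p) p (V p))
    (dΘ : ∀ i, ∀ p ∈ interiorSet n,
      HasDirDeriv (fun q : Phase n => rho q * q.2 i) (Θ i p) p (V p))
    (dT : ∀ i, ∀ p ∈ interiorSet n,
      HasDirDeriv (fun q : Phase n => tauHat q i) (T i p) p (V p)) :
    IsTangentField V := by
  have dR : ∀ p ∈ interiorSet n, HasDirDeriv rhoTilde ((A p - 2 * M p) * rhoTilde p) p (V p) := by
    intro p hp
    have h0 := (dSigma_pos p).ne'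
    have := (dA p hp).mul (((dM p hp).mul (dM p hp)).inv (mul_ne_zero h0 h0))
    refine (this.congr_of_mem isOpen_interiorSet hp fun q _ => ?_).congr_value ?_
    · rw [rhoTilde, sq, div_eq_mul_inv]
    · rw [rhoTilde]; field_simp; ring
  have dX : ∀ p ∈ interiorSet n, HasDirDeriv xHat ((B p - 2 * N p) * xHat p) p (V p) := by
    intro p hp
    have h0 := (dGamma_pos hp).ne'
    have := (dB p hp).mul (((dN p hp).mul (dN p hp)).inv (mul_ne_zero h0 h0))
    refine (this.congr_of_mem isOpen_interiorSet hp fun q _ => ?_).congr_value ?_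
    · rw [xHat, sq, div_eq_mul_inv]
    · rw [xHat]; field_simp; ring
  have dS : ∀ p ∈ interiorSet n, HasDirDeriv sHat ((M p - N p) * sHat p) p (V p) := by
    intro p hp
    have h0 := (dGamma_pos hp).ne'
    have := (dM p hp).mul ((dN p hp).inv h0)
    refine (this.congr_of_mem isOpen_interiorSet hp fun q _ => ?_).congr_value ?_
    · rw [sHat, div_eq_mul_inv]
    · rw [sHat]; field_simp; ring
  have dTT : ∀ i, ∀ p ∈ interiorSet n, HasDirDeriv (fun q : Phase n => tauTilde q i)
      (T i p * dGamma p + tauTilde p i * N p) p (V p) := by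
    intro i p hp
    refine (((dT i p hp).mul (dN p hp)).congr_of_mem isOpen_interiorSet hp fun q hq => ?_).congr_value
      ?_
    · exact tauTilde_eq_tauHat_mul hq i
    · rw [tauTilde_eq_tauHat_mul hp]; ring
  refine ⟨hV, fun f hf => ?_, fun r hr => ?_⟩
  · -- the field lifts to a smooth field on the space of coordinates
    have hTT : ∀ i, SmoothOnX2 (fun p => T i p * dGamma p + tauTilde p i * N p) := fun i =>
      ((hT i).mul .dGamma).add ((SmoothOnX2.tauTilde i).mul hN)
    have hA' := hA.mul .rho
    have hM' := hM.mul .dSigma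
    have hN' := hN.mul .dGamma
    have hR' := (hA.sub ((SmoothOnX2.const 2).mul hM)).mul .rhoTilde
    have hX' := (hB.sub ((SmoothOnX2.const 2).mul hN)).mul .xHat
    have hS' := (hM.sub hN).mul .sHat
    obtain ⟨F, hF, hF'⟩ := hf
    obtain ⟨fA, cA, eA⟩ := hA'
    obtain ⟨fM, cM, eM⟩ := hM'
    obtain ⟨fN, cN, eN⟩ := hN'
    obtain ⟨fR, cR, eR⟩ := hR'
    obtain ⟨fX, cX, eX⟩ := hX'
    obtain ⟨fS, cS, eS⟩ := hS'
    choose fZ cZ eZ using hZ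
    choose fΘ cΘ eΘ using hΘ
    choose fT cT eT using hT
    choose fTT cTT eTT using hTT
    refine ⟨fun w => fderiv ℝ F w (WithLp.toLp 2 (fun i => fZ i w), fA w,
      WithLp.toLp 2 (fun i => fΘ i w), fM w, fR w, WithLp.toLp 2 (fun i => fTT i w), fN w, fX w,
      fS w, WithLp.toLp 2 (fun i => fT i w)), ?_, fun p hp => ?_⟩
    · refine (hF.fderiv_right (m := ∞) (by simp)).clm_apply ?_
      have key : ∀ g : Fin n → E n × ℝ × E n × ℝ × ℝ × E n × ℝ × ℝ × ℝ × E n → ℝ,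
          (∀ i, ContDiff ℝ ∞ (g i)) →
            ContDiff ℝ ∞ (fun w => (WithLp.toLp 2 (fun i => g i w) : E n)) := by
        intro g hg
        rw [contDiff_euclidean]
        exact hg
      exact (key _ cZ).prodMk <| cA.prodMk <| (key _ cΘ).prodMk <| cM.prodMk <| cR.prodMk <|
        (key _ cTT).prodMk <| cN.prodMk <| cX.prodMk <| cS.prodMk (key _ cT)
    · have hnear : f =ᶠ[nhds p] F ∘ blowUpMap :=
        Filter.eventually_of_mem (isOpen_interiorSet.mem_nhds hp) hF'
      have vec : ∀ (φ : Phase n → E n) (d : Fin n → ℝ),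
          (∀ i, HasDirDeriv (fun q => φ q i) (d i) p (V p)) →
          ∃ L : Phase n →L[ℝ] E n, HasFDerivAt φ L p ∧ L (V p) = WithLp.toLp 2 d := by
        intro φ d h
        have hd : DifferentiableAt ℝ φ p := by
          rw [differentiableAt_euclidean]
          exact fun i => (h i).1
        refine ⟨fderiv ℝ φ p, hd.hasFDerivAt, ?_⟩
        ext i
        have h2 := (EuclideanSpace.proj i : E n →L[ℝ] ℝ).hasFDerivAt.comp p hd.hasFDerivAt
        have h3 := (h i).2
        rw [show (fun q => φ q i) = (EuclideanSpace.proj i : E n →L[ℝ] ℝ) ∘ φ from rfl,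
          h2.fderiv] at h3
        simpa using h3
      obtain ⟨L1, d1, e1⟩ := vec _ _ fun i => dZ i p hp
      obtain ⟨L2, d2, e2⟩ := vec (fun q => rho q • q.2) _ fun i => dΘ i p hp
      obtain ⟨L3, d3, e3⟩ := vec _ _ fun i => dTT i p hp
      obtain ⟨L4, d4, e4⟩ := vec _ _ fun i => dT i p hp
      have hβ : HasFDerivAt (blowUpMap (n := n)) _ p :=
        d1.prodMk <| (dA p hp).1.hasFDerivAt.prodMk <| d2.prodMk <|
          (dM p hp).1.hasFDerivAt.prodMk <| (dR p hp).1.hasFDerivAt.prodMk <| d3.prodMk <|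
          (dN p hp).1.hasFDerivAt.prodMk <| (dX p hp).1.hasFDerivAt.prodMk <|
          (dS p hp).1.hasFDerivAt.prodMk d4
      rw [applyField, hnear.fderiv_eq,
        ((hF.differentiable (by simp) _).hasFDerivAt.comp p hβ).fderiv,
        ContinuousLinearMap.comp_apply]
      congr 1
      simp only [ContinuousLinearMap.prod_apply, e1, e2, e3, e4, (dA p hp).2, (dM p hp).2,
        (dR p hp).2, (dN p hp).2, (dX p hp).2, (dS p hp).2, ← eA p hp, ← eM p hp, ← eN p hp,
        ← eR p hp, ← eX p hp, ← eS p hp, ← eZ _ p hp, ← eΘ _ p hp, ← eT _ p hp, ← eTT _ p hp]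
  · rcases hr with rfl | rfl | rfl | rfl
    · exact ⟨_, hA.sub ((SmoothOnX2.const 2).mul hM), fun p hp => (dR p hp).2⟩
    · exact ⟨_, hB.sub ((SmoothOnX2.const 2).mul hN), fun p hp => (dX p hp).2⟩
    · exact ⟨_, hM.sub hN, fun p hp => (dS p hp).2⟩
    · exact ⟨_, hN, fun p hp => (dN p hp).2⟩

/-- The factor `m_i` for which `m_i ρ⁻¹ ∂_{ζ_i}` is tangent to `∂𝒳₂`: no factor is needed for
the variable `η_1`, in whose direction the blown-up set `Σ` lies. -/
def fibreFactor (i : Fin n) (p : Phase n) : ℝ := if i = 1 then 1 else dGamma p * dSigma p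

/-- The coefficients of the frame of `𝒱₂` with respect to the coordinate fields: the frame is
`x ∂_x`, `∂_{y_j}`, `ρ⁻¹ ∂_{η_1}`, and `d_Γ d_Σ ρ⁻¹ ∂_{ζ_i}` for `i ≠ 1`. -/
def frameCoeff : Fin n ⊕ Fin n → Phase n → ℝ
  | Sum.inl i => fun p => if i = 0 then p.1 0 else 1
  | Sum.inr i => fun p => fibreFactor i p * (rho p)⁻¹

/-- The coordinate directions of phase space. -/
def frameDir : Fin n ⊕ Fin n → Phase n
  | Sum.inl i => (EuclideanSpace.single i 1, 0)
  | Sum.inr i => (0, EuclideanSpace.single i 1)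

/-- The frame of `𝒱₂`. -/
def frameField (κ : Fin n ⊕ Fin n) (p : Phase n) : Phase n := frameCoeff κ p • frameDir κ

theorem fibreFactor_pos (i : Fin n) {p : Phase n} (hp : p ∈ interiorSet n) :
    0 < fibreFactor i p := by
  unfold fibreFactor
  split_ifs
  · exact one_pos
  · exact mul_pos (dGamma_pos hp) (dSigma_pos p)

theorem frameCoeff_pos (κ : Fin n ⊕ Fin n) {p : Phase n} (hp : p ∈ interiorSet n) :
    0 < frameCoeff κ p := by
  rcases κ with i | i
  · simp only [frameCoeff]
    split_ifs
    · exact hp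
    · exact one_pos
  · exact mul_pos (fibreFactor_pos i hp) (inv_pos.2 (rho_pos p))

theorem SmoothOnX2.fibreFactor (i : Fin n) : SmoothOnX2 (fibreFactor (n := n) i) := by
  unfold BBSymbol.fibreFactor
  split_ifs
  · exact const 1
  · exact SmoothOnX2.dGamma.mul .dSigma

theorem contDiffOn_frameCoeff (κ : Fin n ⊕ Fin n) :
    ContDiffOn ℝ ∞ (frameCoeff (n := n) κ) (interiorSet n) := by
  rcases κ with i | i
  · simp only [frameCoeff]
    split_ifs
    · exact (SmoothOnX2.base 0).contDiffOn
    · exact contDiffOn_const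
  · exact (SmoothOnX2.fibreFactor i).contDiffOn.mul
      (contDiff_rho.inv fun p => (rho_pos p).ne').contDiffOn

/-- `τ_i` with the fibre factor: `m_i τ_i = d_Γ d_Σ τ_i`, as `τ` has no component along `η_1`. -/
theorem fibreFactor_mul_tau (i : Fin n) (p : Phase n) :
    fibreFactor i p * tau p i = dGamma p * dSigma p * tau p i := by
  unfold fibreFactor
  split_ifs with h
  · simp [tau_apply, h]
  · rfl

/-- The fields `x ∂_x` and `∂_{y_j}` kill `ρ`, `d_Σ` and `τ̃`; along `x ∂_x` the logarithmic derivative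
of `d_Γ` is half of `x / d_Γ²`. -/
theorem isTangentField_base (i : Fin n) : IsTangentField (frameField (n := n) (Sum.inl i)) := by
  have hx : ∀ j, ∀ p ∈ interiorSet n, HasDirDeriv (fun q : Phase n => q.1 j)
      (if j = i then (if i = 0 then p.1 0 else 1) else 0) p (frameField (Sum.inl i) p) := by
    intro j p hp
    refine (HasDirDeriv.clm ((EuclideanSpace.proj j : E n →L[ℝ] ℝ) ∘L
      ContinuousLinearMap.fst ℝ (E n) (E n))).congr_value ?_
    by_cases hi : i = 0 <;> simp [frameField, frameDir, frameCoeff, hi]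
  have hfib : ∀ f : Phase n → ℝ, ContDiff ℝ ∞ f → (∀ z z' ζ, f (z, ζ) = f (z', ζ)) →
      ∀ p ∈ interiorSet n, HasDirDeriv f 0 p (frameField (Sum.inl i) p) := by
    intro f hf hff p hp
    have hd := (hf.differentiable (by simp) p)
    refine ⟨hd, ?_⟩
    have e : f = (fun q => f ((0 : E n), q.2)) := funext fun q => hff _ _ _
    have h2 : HasFDerivAt (fun q : Phase n => f ((0 : E n), q.2)) ((fderiv ℝ f (0, p.2)).comp
        ((0 : Phase n →L[ℝ] E n).prod (ContinuousLinearMap.snd ℝ _ _))) p := by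
      have h3 : HasFDerivAt (fun q : Phase n => ((0 : E n), q.2)) ((0 : Phase n →L[ℝ] E n).prod
        (ContinuousLinearMap.snd ℝ _ _)) p := (hasFDerivAt_const _ _).prodMk hasFDerivAt_snd
      exact ((hf.differentiable (by simp) ((0 : E n), p.2)).hasFDerivAt).comp p h3
    rw [e, h2.fderiv]
    simp [frameField, frameDir, Prod.mk_zero_zero]
  have dG : ∀ p ∈ interiorSet n, HasDirDeriv (fun q : Phase n => dGamma q)
      ((if i = 0 then xHat p / 2 else 0) * dGamma p) p (frameField (Sum.inl i) p) := by
    intro p hp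
    have h1 := hfib _ (contDiff_dSigma.pow 2) (fun _ _ _ => rfl) p hp
    have h2 := hfib _ (contDiff_tauTilde.norm_sq ℝ) (fun _ _ _ => rfl) p hp
    have := (((hx 0 p hp).add h1).add h2).sqrt (dGamma_arg_pos hp)
    refine this.congr_value ?_
    change _ / (2 * dGamma p) = _
    have h3 := (dGamma_pos hp).ne'
    rcases eq_or_ne i 0 with rfl | hi
    · simp only [if_true, add_zero, xHat]
      field_simp
    · simp [hi, hi.symm]
  refine isTangentField_of_log_derivatives (A := fun _ => 0) (M := fun _ => 0)
    (N := fun p => if i = 0 then xHat p / 2 else 0) (B := fun p => if i = 0 then 1 else 0)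
    (Z := fun j p => if j = i then (if i = 0 then p.1 0 else 1) else 0) (Θ := fun _ _ => 0)
    (T := fun j p => -(if i = 0 then xHat p / 2 else 0) * tauHat p j)
    ((contDiffOn_frameCoeff _).smul contDiffOn_const) (.const 0) (.const 0) ?_ ?_ ?_
    (fun _ => .const 0) ?_ ?_ ?_ dG ?_ hx ?_ ?_
  · split_ifs
    · exact (SmoothOnX2.xHat.mul (.const 2⁻¹)).congr fun p _ => by ring
    · exact .const 0
  · split_ifs
    · exact .const 1
    · exact .const 0
  · intro j
    split_ifs
    · exact .base 0
    · exact .const 1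
    · exact .const 0
  · intro j
    split_ifs
    · exact ((SmoothOnX2.xHat.mul (.const 2⁻¹)).neg.mul (.tauHat j)).congr fun p _ => by ring
    · exact (SmoothOnX2.const 0).congr fun p _ => by ring
  · intro p hp
    exact (hfib _ contDiff_rho (fun _ _ _ => rfl) p hp).congr_value (by simp)
  · intro p hp
    exact (hfib _ contDiff_dSigma (fun _ _ _ => rfl) p hp).congr_value (by simp)
  · intro p hp
    refine (hx 0 p hp).congr_value ?_
    rcases eq_or_ne i 0 with rfl | hi
    · simp
    · simp [hi, hi.symm]
  · intro j p hp
    exact hfib _ (contDiff_rho.mul (by fun_prop)) (fun _ _ _ => rfl) p hp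
  · intro j p hp
    have h1 := hfib (fun q => tauTilde q j) (contDiff_euclidean.1 contDiff_tauTilde j)
      (fun _ _ _ => rfl) p hp
    have h0 := (dGamma_pos hp).ne'
    refine (((dG p hp).inv h0).mul h1).congr_value ?_
    rw [tauHat_apply]
    field_simp
    ring

/-- With `m = fibreFactor i` and `θ = ρζ`, the logarithmic derivatives along `m ρ⁻¹ ∂_{ζ_i}` of `ρ`,
`d_Σ` and `d_Γ` are `-m θ_i`, `M` and `N` below. In `M` and `N` all quotients by `d_Σ` and `d_Γ` have
been absorbed by the factor `d_Γ d_Σ` of `m`. -/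
theorem isTangentField_fibre (i : Fin n) : IsTangentField (frameField (n := n) (Sum.inr i)) := by
  set V := frameField (n := n) (Sum.inr i) with hVdef
  have hb : ∀ j, ∀ p ∈ interiorSet n, HasDirDeriv (fun q : Phase n => q.1 j) 0 p (V p) := by
    intro j p hp
    refine (HasDirDeriv.clm ((EuclideanSpace.proj j : E n →L[ℝ] ℝ) ∘L
      ContinuousLinearMap.fst ℝ (E n) (E n))).congr_value ?_
    simp [V, frameField, frameDir, frameCoeff]
  have hf : ∀ j, ∀ p ∈ interiorSet n, HasDirDeriv (fun q : Phase n => q.2 j)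
      (if j = i then fibreFactor i p * (rho p)⁻¹ else 0) p (V p) := by
    intro j p hp
    refine (HasDirDeriv.clm ((EuclideanSpace.proj j : E n →L[ℝ] ℝ) ∘L
      ContinuousLinearMap.snd ℝ (E n) (E n))).congr_value ?_
    simp [V, frameField, frameDir, frameCoeff]
  have hρ : ∀ p ∈ interiorSet n, HasDirDeriv rho
      (-(fibreFactor i p * (rho p * p.2 i)) * rho p) p (V p) := by
    intro p hp
    have h1 := HasDirDeriv.sum Finset.univ fun j _ => (hf j p hp).mul (hf j p hp)
    have h2 := (HasDirDeriv.const 1).add h1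
    have h3 : ∀ q : Phase n, 1 + ‖q.2‖ ^ 2 = 1 + ∑ j, q.2 j * q.2 j := fun q => by
      rw [EuclideanSpace.real_norm_sq_eq]; simp only [sq]
    have h4 := ((h2.congr_of_mem isOpen_univ trivial fun q _ => h3 q).sqrt
      (one_add_norm_sq_pos p)).inv (Real.sqrt_pos.2 (one_add_norm_sq_pos p)).ne'
    refine HasDirDeriv.congr_value (f := rho) h4 ?_
    have h5 : Real.sqrt (1 + ‖p.2‖ ^ 2) = (rho p)⁻¹ := by rw [rho, inv_inv]
    have h6 := (rho_pos p).ne'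
    rw [h5]
    simp only [ite_mul, mul_ite, zero_mul, mul_zero, Finset.sum_add_distrib, Finset.sum_ite_eq',
      Finset.mem_univ, if_true]
    field_simp
    ring
  have hθ : ∀ j, ∀ p ∈ interiorSet n, HasDirDeriv (fun q : Phase n => rho q * q.2 j)
      (fibreFactor i p * ((if j = i then 1 else 0) - (rho p * p.2 i) * (rho p * p.2 j))) p (V p) := by
    intro j p hp
    refine ((hρ p hp).mul (hf j p hp)).congr_value ?_
    have h6 := (rho_pos p).ne'
    split_ifs
    · field_simp; ring
    · ring
  have hτ : ∀ j, ∀ p ∈ interiorSet n, HasDirDeriv (fun q : Phase n => tau q j)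
      (fibreFactor i p * ((if j = i ∧ i ≠ 1 then 1 else 0) - (rho p * p.2 i) * tau p j)) p (V p) := by
    intro j p hp
    simp only [tau_apply]
    rcases eq_or_ne j 1 with rfl | hj
    · simp only [if_true]
      refine (HasDirDeriv.const 0).congr_value ?_
      rw [if_neg (by rintro ⟨h1, h2⟩; exact h2 h1.symm)]
      ring
    · simp only [hj, if_false]
      refine (hθ j p hp).congr_value ?_
      by_cases h : j = i
      · subst h; simp [hj]
      · simp [h]
  -- the logarithmic derivatives of `d_Σ` and `d_Γ`
  set M : Phase n → ℝ := fun p => dGamma p * tauTilde p i -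
    fibreFactor i p * (rho p * p.2 i) * (‖tauTilde p‖ ^ 2 + rhoTilde p * 2⁻¹) with hM
  set N : Phase n → ℝ := fun p => M p * sHat p ^ 2 + tauHat p i -
    (fibreFactor i p * (rho p * p.2 i) + M p) * ‖tauHat p‖ ^ 2 with hN
  have hMs : SmoothOnX2 M := (SmoothOnX2.dGamma.mul (.tauTilde i)).sub
    (((SmoothOnX2.fibreFactor i).mul (.theta i)).mul
      (SmoothOnX2.norm_sq_tauTilde.add (SmoothOnX2.rhoTilde.mul (.const _))))
  have hNs : SmoothOnX2 N := ((hMs.mul (SmoothOnX2.sHat.pow 2)).add (.tauHat i)).sub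
    ((((SmoothOnX2.fibreFactor i).mul (.theta i)).add hMs).mul SmoothOnX2.norm_sq_tauHat)
  have hS : ∀ p ∈ interiorSet n, HasDirDeriv dSigma (M p * dSigma p) p (V p) := by
    intro p hp
    have h1 := (HasDirDeriv.sum Finset.univ fun j _ => (hτ j p hp).mul (hτ j p hp)).add (hρ p hp)
    have h3 : ∀ q : Phase n, ‖tau q‖ ^ 2 + rho q = (∑ j, tau q j * tau q j) + rho q := fun q => by
      rw [EuclideanSpace.real_norm_sq_eq]; simp only [sq]
    have h4 := (h1.congr_of_mem isOpen_univ trivial fun q _ => h3 q).sqrt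
      (add_pos_of_nonneg_of_pos (sq_nonneg _) (rho_pos p))
    refine HasDirDeriv.congr_value (f := dSigma) h4 ?_
    change _ / (2 * dSigma p) = _
    have h6 := (dSigma_pos p).ne'
    rw [div_eq_iff (by positivity)]
    have e1 : ∑ j, (fibreFactor i p * ((if j = i ∧ i ≠ 1 then 1 else 0) -
        (rho p * p.2 i) * tau p j) * tau p j + tau p j * (fibreFactor i p *
        ((if j = i ∧ i ≠ 1 then 1 else 0) - (rho p * p.2 i) * tau p j))) =
        2 * (fibreFactor i p * tau p i) - 2 * fibreFactor i p * (rho p * p.2 i) * ‖tau p‖ ^ 2 := by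
      have e2 : ∀ j, (if j = i ∧ i ≠ 1 then (1 : ℝ) else 0) * tau p j =
          if j = i then tau p i else 0 := by
        intro j
        by_cases h : j = i
        · subst h
          by_cases h1 : j = 1
          · simp [h1, tau_apply]
          · simp [h1]
        · simp [h]
      have e3 : ∀ j, (fibreFactor i p * ((if j = i ∧ i ≠ 1 then 1 else 0) -
          (rho p * p.2 i) * tau p j) * tau p j + tau p j * (fibreFactor i p *
          ((if j = i ∧ i ≠ 1 then 1 else 0) - (rho p * p.2 i) * tau p j))) =
          2 * fibreFactor i p * (if j = i then tau p i else 0) -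
          2 * fibreFactor i p * (rho p * p.2 i) * (tau p j ^ 2) := by
        intro j
        rw [← e2]
        ring
      rw [Finset.sum_congr rfl fun j _ => e3 j, Finset.sum_sub_distrib, ← Finset.mul_sum,
        ← Finset.mul_sum, EuclideanSpace.real_norm_sq_eq]
      simp only [Finset.sum_ite_eq', Finset.mem_univ, if_true]
      ring
    rw [e1, fibreFactor_mul_tau, tau_eq_tauTilde_mul, norm_tau]
    nth_rewrite 3 [rho_eq_rhoTilde_mul]
    simp only [hM]
    ring
  have hTT : ∀ j, ∀ p ∈ interiorSet n, HasDirDeriv (fun q : Phase n => tauTilde q j)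
      ((if j = i ∧ i ≠ 1 then dGamma p else 0) -
        (fibreFactor i p * (rho p * p.2 i) + M p) * tauTilde p j) p (V p) := by
    intro j p hp
    have h6 := (dSigma_pos p).ne'
    refine (((hS p hp).inv h6).mul (hτ j p hp)).congr_value ?_
    rw [tau_eq_tauTilde_mul]
    by_cases h : j = i ∧ i ≠ 1
    · simp only [if_pos h]
      have : fibreFactor i p = dGamma p * dSigma p := if_neg h.2
      rw [this]
      field_simp
      ring
    · simp only [if_neg h]
      field_simp
      ring
  have hG : ∀ p ∈ interiorSet n, HasDirDeriv dGamma (N p * dGamma p) p (V p) := by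
    intro p hp
    have h1 := ((hb 0 p hp).add ((hS p hp).mul (hS p hp))).add
      (HasDirDeriv.sum Finset.univ fun j _ => (hTT j p hp).mul (hTT j p hp))
    have h3 : ∀ q : Phase n, q.1 0 + dSigma q ^ 2 + ‖tauTilde q‖ ^ 2 =
        q.1 0 + dSigma q * dSigma q + ∑ j, tauTilde q j * tauTilde q j := fun q => by
      rw [EuclideanSpace.real_norm_sq_eq]; simp only [sq]
    have h4 := (h1.congr_of_mem isOpen_univ trivial fun q _ => h3 q).sqrt (dGamma_arg_pos hp)
    refine HasDirDeriv.congr_value (f := dGamma) h4 ?_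
    change _ / (2 * dGamma p) = _
    have h6 := (dGamma_pos hp).ne'
    rw [div_eq_iff (by positivity)]
    set c := fibreFactor i p * (rho p * p.2 i) + M p with hc
    have e1 : ∑ j, (((if j = i ∧ i ≠ 1 then dGamma p else 0) - c * tauTilde p j) * tauTilde p j +
        tauTilde p j * ((if j = i ∧ i ≠ 1 then dGamma p else 0) - c * tauTilde p j)) =
        2 * (dGamma p * tauTilde p i) - 2 * c * ‖tauTilde p‖ ^ 2 := by
      have e2 : ∀ j, (if j = i ∧ i ≠ 1 then dGamma p else 0) * tauTilde p j =
          if j = i then dGamma p * tauTilde p i else 0 := by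
        intro j
        by_cases h : j = i
        · subst h
          by_cases h1 : j = 1
          · simp [h1, tauTilde_apply, tau_apply]
          · simp [h1]
        · simp [h]
      have e3 : ∀ j, (((if j = i ∧ i ≠ 1 then dGamma p else 0) - c * tauTilde p j) * tauTilde p j +
          tauTilde p j * ((if j = i ∧ i ≠ 1 then dGamma p else 0) - c * tauTilde p j)) =
          2 * (if j = i then dGamma p * tauTilde p i else 0) - 2 * c * (tauTilde p j ^ 2) := by
        intro j
        rw [← e2]
        ring
      rw [Finset.sum_congr rfl fun j _ => e3 j, Finset.sum_sub_distrib, ← Finset.mul_sum,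
        ← Finset.mul_sum, EuclideanSpace.real_norm_sq_eq]
      simp only [Finset.sum_ite_eq', Finset.mem_univ, if_true]
    rw [e1, norm_tauTilde hp, tauTilde_eq_tauHat_mul hp, dSigma_eq_sHat_mul hp]
    simp only [hN, ← hc]
    ring
  refine isTangentField_of_log_derivatives
    (A := fun p => -(fibreFactor i p * (rho p * p.2 i))) (M := M) (N := N) (B := fun _ => 0)
    (Z := fun _ _ => 0)
    (Θ := fun j p => fibreFactor i p *
      ((if j = i then 1 else 0) - (rho p * p.2 i) * (rho p * p.2 j)))
    (T := fun j p => (if j = i ∧ i ≠ 1 then 1 else 0) -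
        (fibreFactor i p * (rho p * p.2 i) + M p + N p) * tauHat p j)
    ((contDiffOn_frameCoeff _).smul contDiffOn_const)
    ((SmoothOnX2.fibreFactor i).mul (.theta i)).neg hMs hNs (.const 0) (fun _ => .const 0) ?_ ?_
    hρ hS hG (fun p hp => (hb 0 p hp).congr_value (by simp)) hb hθ ?_
  · exact fun j => (SmoothOnX2.fibreFactor i).mul
      ((SmoothOnX2.const _).sub ((SmoothOnX2.theta i).mul (.theta j)))
  · exact fun j => (SmoothOnX2.const _).sub
      (((((SmoothOnX2.fibreFactor i).mul (.theta i)).add hMs).add hNs).mul (.tauHat j))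
  · intro j p hp
    have h6 := (dGamma_pos hp).ne'
    refine (((hG p hp).inv h6).mul (hTT j p hp)).congr_value ?_
    rw [tauTilde_eq_tauHat_mul hp]
    split_ifs
    · field_simp; ring
    · field_simp; ring

theorem isTangentField_frameField (κ : Fin n ⊕ Fin n) : IsTangentField (frameField κ) := by
  rcases κ with i | i
  · exact isTangentField_base i
  · exact isTangentField_fibre i

/-- The coordinate functionals dual to `frameDir`. -/
def frameCoord : Fin n ⊕ Fin n → Phase n →L[ℝ] ℝ
  | Sum.inl i => (EuclideanSpace.proj i : E n →L[ℝ] ℝ) ∘L ContinuousLinearMap.fst ℝ (E n) (E n)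
  | Sum.inr i => (EuclideanSpace.proj i : E n →L[ℝ] ℝ) ∘L ContinuousLinearMap.snd ℝ (E n) (E n)

theorem sum_smul_single (v : E n) : ∑ i, v i • EuclideanSpace.single i (1 : ℝ) = v := by
  ext j
  simp [Pi.single_apply]

theorem sum_frameCoord_smul_frameDir (v : Phase n) : ∑ κ, frameCoord κ v • frameDir κ = v := by
  rw [Fintype.sum_sum_type]
  have h1 : ∑ i : Fin n, frameCoord (Sum.inl i) v • frameDir (n := n) (Sum.inl i) = (v.1, 0) := by
    refine Prod.ext ?_ ?_
    · rw [Prod.fst_sum]; exact sum_smul_single v.1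
    · rw [Prod.snd_sum]; simp [frameDir]
  have h2 : ∑ i : Fin n, frameCoord (Sum.inr i) v • frameDir (n := n) (Sum.inr i) = (0, v.2) := by
    refine Prod.ext ?_ ?_
    · rw [Prod.fst_sum]; simp [frameDir]
    · rw [Prod.snd_sum]; exact sum_smul_single v.2
  rw [h1, h2]
  simp

/-- The frame spans `𝒱₂` over `C^∞(𝒳₂)`: the coefficients of a tangent field are recovered from its
action on `x`, `y`, `ρη_1` and `τ̂`, all boundary defining functions having smooth logarithmic
derivatives. -/
theorem IsTangentField.exists_frame_coeff {V : Phase n → Phase n} (hV : IsTangentField V)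
    (κ : Fin n ⊕ Fin n) : ∃ c : Phase n → ℝ, SmoothOnX2 c ∧
      ∀ p ∈ interiorSet n, frameCoord κ (V p) = c p * frameCoeff κ p := by
  have dd : ∀ {f : Phase n → ℝ}, SmoothOnX2 f → ∀ p ∈ interiorSet n,
      HasDirDeriv f (applyField V f p) p (V p) := fun hf p hp => ⟨hf.differentiableAt hp, rfl⟩
  obtain ⟨gR, sR, eR⟩ := hV.tangent rhoTilde (by simp [boundaryDefining])
  obtain ⟨gX, sX, eX⟩ := hV.tangent xHat (by simp [boundaryDefining])
  obtain ⟨gS, sS, eS⟩ := hV.tangent sHat (by simp [boundaryDefining])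
  obtain ⟨gG, sG, eG⟩ := hV.tangent dGamma (by simp [boundaryDefining])
  have dR : ∀ p ∈ interiorSet n, HasDirDeriv rhoTilde (gR p * rhoTilde p) p (V p) :=
    fun p hp => (dd .rhoTilde p hp).congr_value (eR p hp)
  have dX : ∀ p ∈ interiorSet n, HasDirDeriv xHat (gX p * xHat p) p (V p) :=
    fun p hp => (dd .xHat p hp).congr_value (eX p hp)
  have dS : ∀ p ∈ interiorSet n, HasDirDeriv sHat (gS p * sHat p) p (V p) :=
    fun p hp => (dd .sHat p hp).congr_value (eS p hp)
  have dG : ∀ p ∈ interiorSet n, HasDirDeriv dGamma (gG p * dGamma p) p (V p) :=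
    fun p hp => (dd .dGamma p hp).congr_value (eG p hp)
  have dS' : ∀ p ∈ interiorSet n, HasDirDeriv dSigma ((gS p + gG p) * dSigma p) p (V p) := by
    intro p hp
    refine (((dS p hp).mul (dG p hp)).congr_of_mem isOpen_interiorSet hp
      fun q hq => dSigma_eq_sHat_mul hq).congr_value ?_
    rw [dSigma_eq_sHat_mul hp]; ring
  have dρ : ∀ p ∈ interiorSet n,
      HasDirDeriv rho ((gR p + 2 * (gS p + gG p)) * rho p) p (V p) := by
    intro p hp
    refine (((dR p hp).mul ((dS' p hp).mul (dS' p hp))).congr_of_mem isOpen_interiorSet hp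
      fun q hq => ?_).congr_value ?_
    · rw [← sq]; exact rho_eq_rhoTilde_mul q
    · rw [rho_eq_rhoTilde_mul p]; ring
  have hsρ : SmoothOnX2 (fun p => gR p + 2 * (gS p + gG p)) :=
    sR.add ((SmoothOnX2.const 2).mul (sS.add sG))
  have db : ∀ i, ∀ p ∈ interiorSet n, HasDirDeriv (fun q : Phase n => q.1 i) ((V p).1 i) p (V p) :=
    fun i p hp => HasDirDeriv.clm (frameCoord (Sum.inl i))
  have df : ∀ i, ∀ p ∈ interiorSet n, HasDirDeriv (fun q : Phase n => q.2 i) ((V p).2 i) p (V p) :=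
    fun i p hp => HasDirDeriv.clm (frameCoord (Sum.inr i))
  rcases κ with i | i
  · rcases eq_or_ne i 0 with rfl | hi
    · refine ⟨fun p => gX p + 2 * gG p, sX.add ((SmoothOnX2.const 2).mul sG), fun p hp => ?_⟩
      have h1 := ((dX p hp).mul ((dG p hp).mul (dG p hp))).congr_of_mem isOpen_interiorSet hp
        (g := fun q : Phase n => q.1 0) fun q hq => by
          rw [← sq]; exact base_zero_eq_xHat_mul hq
      have h2 : (V p).1 0 = _ := (db 0 p hp).2.symm.trans h1.2
      simp only [frameCoord, frameCoeff, if_true]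
      refine h2.trans ?_
      have h3 := base_zero_eq_xHat_mul hp
      linear_combination (-(gX p + 2 * gG p)) * h3
    · refine ⟨_, hV.smooth _ (.base i), fun p hp => ?_⟩
      simp only [frameCoeff, hi, if_false, mul_one]
      exact (db i p hp).2.symm
  · have hθ : ∀ p ∈ interiorSet n, applyField V (fun p : Phase n => rho p * p.2 i) p =
        (gR p + 2 * (gS p + gG p)) * (rho p * p.2 i) + rho p * (V p).2 i := by
      intro p hp
      refine ((dρ p hp).mul (df i p hp)).2.trans ?_
      ring
    have h0 : ∀ p : Phase n, rho p ≠ 0 := fun p => (rho_pos p).ne'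
    rcases eq_or_ne i 1 with rfl | hi
    · refine ⟨_, (hV.smooth _ (.theta 1)).sub (hsρ.mul (.theta 1)), fun p hp => ?_⟩
      change (V p).2 1 = _
      simp only [frameCoeff, fibreFactor, if_true, one_mul]
      rw [hθ p hp]
      field_simp [h0 p]
      ring
    · refine ⟨_, ((hV.smooth _ (.tauHat i)).add ((sS.add (sG.add sG)).mul (.tauHat i))).sub
        (hsρ.mul (.tauHat i)), fun p hp => ?_⟩
      change (V p).2 i = _
      have h1 := ((dd (.tauHat i) p hp).mul ((dS' p hp).mul (dG p hp))).congr_of_mem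
        isOpen_interiorSet hp (g := fun q : Phase n => rho q * q.2 i) fun q hq => by
          have := tauTilde_eq_tauHat_mul hq i
          have h2 := tau_eq_tauTilde_mul q i
          rw [tau_apply, if_neg hi] at h2
          rw [h2, this]; ring
      have h2 := (hθ p hp).symm.trans h1.2
      have h3 := tau_eq_tauTilde_mul p i
      rw [tau_apply, if_neg hi, tauTilde_eq_tauHat_mul hp] at h3
      simp only [frameCoeff, fibreFactor, if_neg hi]
      rw [← div_eq_mul_inv, ← mul_div_assoc, eq_div_iff (h0 p)]
      linear_combination h2 - (gR p + 2 * (gS p + gG p)) * h3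

/-! ### Conormal families -/

theorem isOpen_fullInteriorSet : IsOpen (fullInteriorSet n) := by
  unfold fullInteriorSet
  exact isOpen_lt continuous_const (by fun_prop)

/-- Indices of the frame of fields testing full symbols: the frame of `𝒱₂` and the `x⁻¹ ∂_{Z_i}`. -/
abbrev FrameIndex (n : ℕ) : Type := (Fin n ⊕ Fin n) ⊕ Fin n

/-- The coefficients of the full frame with respect to the coordinate fields. -/
def fullCoeff : FrameIndex n → Phase n → ℝ
  | Sum.inl κ => frameCoeff κ
  | Sum.inr _ => fun p => (p.1 0)⁻¹

/-- The coordinate directions of the space carrying full symbols. -/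
def fullDir : FrameIndex n → FullPhase n
  | Sum.inl κ => (frameDir κ, 0)
  | Sum.inr i => (0, EuclideanSpace.single i 1)

/-- The coordinate functionals dual to `fullDir`. -/
def fullCoord : FrameIndex n → FullPhase n →L[ℝ] ℝ
  | Sum.inl κ => frameCoord κ ∘L ContinuousLinearMap.fst ℝ (Phase n) (E n)
  | Sum.inr i => (EuclideanSpace.proj i : E n →L[ℝ] ℝ) ∘L ContinuousLinearMap.snd ℝ (Phase n) (E n)

/-- The frame of fields testing full symbols. -/
def fullField (κ : FrameIndex n) (q : FullPhase n) : FullPhase n := fullCoeff κ q.1 • fullDir κ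

theorem sum_fullCoord_smul_fullDir (v : FullPhase n) : ∑ κ, fullCoord κ v • fullDir κ = v := by
  rw [Fintype.sum_sum_type]
  have h1 : ∑ κ, fullCoord (Sum.inl κ) v • fullDir (n := n) (Sum.inl κ) = (v.1, 0) := by
    refine Prod.ext ?_ ?_
    · rw [Prod.fst_sum]; exact sum_frameCoord_smul_frameDir v.1
    · rw [Prod.snd_sum]; simp [fullDir]
  have h2 : ∑ i, fullCoord (Sum.inr i) v • fullDir (n := n) (Sum.inr i) = (0, v.2) := by
    refine Prod.ext ?_ ?_
    · rw [Prod.fst_sum]; simp [fullDir]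
    · rw [Prod.snd_sum]; exact sum_smul_single v.2
  rw [h1, h2]
  simp

theorem fullCoeff_pos (κ : FrameIndex n) {p : Phase n} (hp : p ∈ interiorSet n) :
    0 < fullCoeff κ p := by
  rcases κ with κ | i
  · exact frameCoeff_pos κ hp
  · exact inv_pos.2 hp

theorem contDiffOn_fullField (κ : FrameIndex n) :
    ContDiffOn ℝ ∞ (fullField (n := n) κ) (fullInteriorSet n) := by
  have key : ContDiffOn ℝ ∞ (fun q : FullPhase n => fullCoeff κ q.1) (fullInteriorSet n) := by
    rcases κ with κ | i
    · exact (contDiffOn_frameCoeff κ).comp (contDiff_fst (E := Phase n) (F := E n)).contDiffOn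
        fun q hq => hq
    · have h : ContDiffOn ℝ ∞ (fun q : FullPhase n => q.1.1 0) (fullInteriorSet n) := by fun_prop
      exact h.inv fun q hq => ne_of_gt hq
  exact key.smul contDiffOn_const

section Conormal

variable {ι : Type*} {F G H : Type*} [NormedAddCommGroup F] [NormedSpace ℝ F]
  [NormedAddCommGroup G] [NormedSpace ℝ G] [NormedAddCommGroup H] [NormedSpace ℝ H]
  {U U' : Set (FullPhase n)}

/-- The members of the family `f` are bounded on `U`, over bounded parts of the base and uniformly in
the parameter of the family. -/
def BddOverBase (U : Set (FullPhase n)) (f : ι → FullPhase n → F) : Prop :=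
  ∀ R : ℝ, ∃ C : ℝ, ∀ i, ∀ q ∈ U, ‖q.1.1‖ ≤ R → ‖f i q‖ ≤ C

/-- All products of at most `N` frame fields applied to the members of the family `f` are bounded on
`U`, over bounded parts of the base and uniformly in the parameter of the family. -/
def DerivBdd (U : Set (FullPhase n)) : ℕ → (ι → FullPhase n → F) → Prop
  | 0, f => BddOverBase U f
  | N + 1, f => BddOverBase U f ∧ ∀ κ, DerivBdd U N (fun i => applyField (fullField κ) (f i))

theorem DerivBdd.bdd {N : ℕ} {f : ι → FullPhase n → F} (h : DerivBdd U N f) : BddOverBase U f := by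
  cases N with
  | zero => exact h
  | succ N => exact h.1

theorem DerivBdd.of_succ {N : ℕ} {f : ι → FullPhase n → F} (h : DerivBdd U (N + 1) f) :
    DerivBdd U N f := by
  induction N generalizing f with
  | zero => exact h.1
  | succ N ih => exact ⟨h.1, fun κ => ih (h.2 κ)⟩

theorem DerivBdd.congr (hU : IsOpen U) {N : ℕ} {f g : ι → FullPhase n → F} (h : DerivBdd U N f)
    (hfg : ∀ i, ∀ q ∈ U, g i q = f i q) : DerivBdd U N g := by
  have h0 : BddOverBase U g := fun R => by
    obtain ⟨C, hC⟩ := h.bdd R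
    exact ⟨C, fun i q hq hR => by rw [hfg i q hq]; exact hC i q hq hR⟩
  induction N generalizing f g with
  | zero => exact h0
  | succ N ih =>
    have hd : ∀ κ i, ∀ q ∈ U, applyField (fullField κ) (g i) q = applyField (fullField κ) (f i) q := by
      intro κ i q hq
      have : g i =ᶠ[nhds q] f i := Filter.eventually_of_mem (hU.mem_nhds hq) (hfg i)
      rw [applyField, applyField, this.fderiv_eq]
    refine ⟨h0, fun κ => ih (h.2 κ) (hd κ) fun R => ?_⟩
    obtain ⟨C, hC⟩ := (h.2 κ).bdd R
    exact ⟨C, fun i q hq hR => by rw [hd κ i q hq]; exact hC i q hq hR⟩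

theorem DerivBdd.mono (hUU : U' ⊆ U) {N : ℕ} {f : ι → FullPhase n → F} (h : DerivBdd U N f) :
    DerivBdd U' N f := by
  induction N generalizing f with
  | zero => exact fun R => (h R).imp fun C hC i q hq => hC i q (hUU hq)
  | succ N ih => exact ⟨fun R => (h.1 R).imp fun C hC i q hq => hC i q (hUU hq), fun κ => ih (h.2 κ)⟩

theorem BddOverBase.union {f : ι → FullPhase n → F} (h : BddOverBase U f)
    (h' : BddOverBase U' f) : BddOverBase (U ∪ U') f := fun R => by
  obtain ⟨C, hC⟩ := h R
  obtain ⟨C', hC'⟩ := h' R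
  refine ⟨max C C', fun i q hq hR => ?_⟩
  rcases hq with hq | hq
  · exact (hC i q hq hR).trans (le_max_left _ _)
  · exact (hC' i q hq hR).trans (le_max_right _ _)

theorem DerivBdd.union {N : ℕ} {f : ι → FullPhase n → F} (h : DerivBdd U N f)
    (h' : DerivBdd U' N f) : DerivBdd (U ∪ U') N f := by
  induction N generalizing f with
  | zero => exact BddOverBase.union h h'
  | succ N ih => exact ⟨h.1.union h'.1, fun κ => ih (h.2 κ) (h'.2 κ)⟩

theorem DerivBdd.const (U : Set (FullPhase n)) (N : ℕ) {c : ι → F} (hc : ∃ C, ∀ i, ‖c i‖ ≤ C) :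
    DerivBdd U N (fun i _ => c i) := by
  have h0 : ∀ N, DerivBdd U N (fun (_ : ι) (_ : FullPhase n) => (0 : F)) := by
    intro N
    induction N with
    | zero => exact fun R => ⟨0, fun i q _ _ => by simp⟩
    | succ N ih =>
      refine ⟨fun R => ⟨0, fun i q _ _ => by simp⟩, fun κ => ?_⟩
      convert ih using 3 with i q
      simp [applyField]
  obtain ⟨C, hC⟩ := hc
  cases N with
  | zero => exact fun R => ⟨C, fun i q _ _ => hC i⟩
  | succ N =>
    refine ⟨fun R => ⟨C, fun i q _ _ => hC i⟩, fun κ => ?_⟩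
    convert h0 N using 3 with i q
    simp [applyField]

theorem contDiffOn_applyField (hU : IsOpen U) (hUi : U ⊆ fullInteriorSet n) {f : FullPhase n → F}
    (hf : ContDiffOn ℝ ∞ f U) (κ : FrameIndex n) :
    ContDiffOn ℝ ∞ (applyField (fullField κ) f) U :=
  (hf.fderiv_of_isOpen hU (m := ∞) (by simp)).clm_apply ((contDiffOn_fullField κ).mono hUi)

theorem DerivBdd.add (hU : IsOpen U) {N : ℕ} {f g : ι → FullPhase n → F}
    (hUi : U ⊆ fullInteriorSet n)
    (hf : ∀ i, ContDiffOn ℝ ∞ (f i) U) (hg : ∀ i, ContDiffOn ℝ ∞ (g i) U)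
    (h : DerivBdd U N f) (h' : DerivBdd U N g) :
    DerivBdd U N (fun i q => f i q + g i q) := by
  have h0 : ∀ {f g : ι → FullPhase n → F}, BddOverBase U f → BddOverBase U g →
      BddOverBase U (fun i q => f i q + g i q) := fun h h' R => by
    obtain ⟨C, hC⟩ := h R
    obtain ⟨C', hC'⟩ := h' R
    exact ⟨C + C', fun i q hq hR => norm_add_le_of_le (hC i q hq hR) (hC' i q hq hR)⟩
  induction N generalizing f g with
  | zero => exact h0 h h'
  | succ N ih =>
    refine ⟨h0 h.1 h'.1, fun κ => (ih (fun i => contDiffOn_applyField hU hUi (hf i) κ)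
      (fun i => contDiffOn_applyField hU hUi (hg i) κ) (h.2 κ) (h'.2 κ)).congr hU
      fun i q hq => ?_⟩
    have d1 := ((hf i).contDiffAt (hU.mem_nhds hq)).differentiableAt (by simp)
    have d2 := ((hg i).contDiffAt (hU.mem_nhds hq)).differentiableAt (by simp)
    simp only [applyField]
    rw [fderiv_fun_add d1 d2, add_apply]

theorem DerivBdd.clm (hU : IsOpen U) {N : ℕ} {f : ι → FullPhase n → F} (L : F →L[ℝ] G)
    (hUi : U ⊆ fullInteriorSet n) (hf : ∀ i, ContDiffOn ℝ ∞ (f i) U) (h : DerivBdd U N f) :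
    DerivBdd U N (fun i q => L (f i q)) := by
  have h0 : ∀ {f : ι → FullPhase n → F}, BddOverBase U f →
      BddOverBase U (fun i q => L (f i q)) := fun h R => by
    obtain ⟨C, hC⟩ := h R
    exact ⟨‖L‖ * C, fun i q hq hR => L.le_opNorm_of_le (hC i q hq hR)⟩
  induction N generalizing f with
  | zero => exact h0 h
  | succ N ih =>
    refine ⟨h0 h.1, fun κ => (ih (fun i => contDiffOn_applyField hU hUi (hf i) κ)
      (h.2 κ)).congr hU fun i q hq => ?_⟩
    have d1 := ((hf i).contDiffAt (hU.mem_nhds hq)).differentiableAt (by simp)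
    have := (L.hasFDerivAt.comp q d1.hasFDerivAt).fderiv
    simp only [applyField]
    change fderiv ℝ (L ∘ f i) q _ = _
    rw [this, ContinuousLinearMap.comp_apply]

theorem DerivBdd.bilin (hU : IsOpen U) {N : ℕ} {f : ι → FullPhase n → F} {g : ι → FullPhase n → G}
    (B : F →L[ℝ] G →L[ℝ] H) (hUi : U ⊆ fullInteriorSet n)
    (hf : ∀ i, ContDiffOn ℝ ∞ (f i) U) (hg : ∀ i, ContDiffOn ℝ ∞ (g i) U)
    (h : DerivBdd U N f) (h' : DerivBdd U N g) :
    DerivBdd U N (fun i q => B (f i q) (g i q)) := by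
  have h0 : ∀ {f : ι → FullPhase n → F} {g : ι → FullPhase n → G}, BddOverBase U f →
      BddOverBase U g → BddOverBase U (fun i q => B (f i q) (g i q)) := fun h h' R => by
    obtain ⟨C, hC⟩ := h R
    obtain ⟨C', hC'⟩ := h' R
    refine ⟨‖B‖ * C * C', fun i q hq hR => ?_⟩
    exact B.le_of_opNorm₂_le_of_le le_rfl (hC i q hq hR) (hC' i q hq hR)
  have hB : ∀ {f : FullPhase n → F} {g : FullPhase n → G}, ContDiffOn ℝ ∞ f U →
      ContDiffOn ℝ ∞ g U → ContDiffOn ℝ ∞ (fun q => B (f q) (g q)) U := fun h h' =>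
    (B.contDiff.comp_contDiffOn h).clm_apply h'
  induction N generalizing f g with
  | zero => exact h0 h h'
  | succ N ih =>
    have df := fun κ i => contDiffOn_applyField hU hUi (hf i) κ
    have dg := fun κ i => contDiffOn_applyField hU hUi (hg i) κ
    refine ⟨h0 h.1 h'.1, fun κ => (DerivBdd.add hU hUi (fun i => hB (hf i) (dg κ i))
      (fun i => hB (df κ i) (hg i)) (ih hf (dg κ) h.of_succ (h'.2 κ))
      (ih (df κ) hg (h.2 κ) h'.of_succ)).congr hU fun i q hq => ?_⟩
    have d1 := ((hf i).contDiffAt (hU.mem_nhds hq)).differentiableAt (by simp)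
    have d2 := ((hg i).contDiffAt (hU.mem_nhds hq)).differentiableAt (by simp)
    simp only [applyField]
    rw [B.fderiv_of_bilinear d1 d2]
    simp

/-- Families of smooth functions on the open set `U` of the interior that are `L^∞`-conormal on `U`:
all products of frame fields applied to them are bounded over bounded parts of the base, uniformly in
the parameter of the family. -/
structure Conormal (U : Set (FullPhase n)) (f : ι → FullPhase n → F) : Prop where
  /-- the domain is open -/
  isOpen : IsOpen U
  /-- the domain lies over `x > 0` -/
  subset : U ⊆ fullInteriorSet n
  /-- the members of the family are smooth -/
  smooth : ∀ i, ContDiffOn ℝ ∞ (f i) U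
  /-- all products of frame fields applied to the family are bounded -/
  bdd : ∀ N, DerivBdd U N f

namespace Conormal

variable {f g : ι → FullPhase n → F}

theorem congr (h : Conormal U f) (hfg : ∀ i, ∀ q ∈ U, g i q = f i q) : Conormal U g :=
  ⟨h.isOpen, h.subset, fun i => (h.smooth i).congr (hfg i), fun N => (h.bdd N).congr h.isOpen hfg⟩

theorem mono (h : Conormal U f) (hU' : IsOpen U') (hUU : U' ⊆ U) : Conormal U' f :=
  ⟨hU', hUU.trans h.subset, fun i => (h.smooth i).mono hUU, fun N => (h.bdd N).mono hUU⟩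

theorem union (h : Conormal U f) (h' : Conormal U' f) : Conormal (U ∪ U') f :=
  ⟨h.isOpen.union h'.isOpen, Set.union_subset h.subset h'.subset,
    fun i => (h.smooth i).union_of_isOpen (h'.smooth i) h.isOpen h'.isOpen,
    fun N => (h.bdd N).union (h'.bdd N)⟩

theorem const (hU : IsOpen U) (hUi : U ⊆ fullInteriorSet n) {c : ι → F} (hc : ∃ C, ∀ i, ‖c i‖ ≤ C) :
    Conormal U (fun i _ => c i) :=
  ⟨hU, hUi, fun _ => contDiffOn_const, fun N => .const U N hc⟩

theorem add (h : Conormal U f) (h' : Conormal U g) : Conormal U (fun i q => f i q + g i q) :=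
  ⟨h.isOpen, h.subset, fun i => (h.smooth i).add (h'.smooth i), fun N =>
    (h.bdd N).add h.isOpen h.subset h.smooth h'.smooth (h'.bdd N)⟩

theorem clm (h : Conormal U f) (L : F →L[ℝ] G) : Conormal U (fun i q => L (f i q)) :=
  ⟨h.isOpen, h.subset, fun i => L.contDiff.comp_contDiffOn (h.smooth i), fun N =>
    (h.bdd N).clm h.isOpen L h.subset h.smooth⟩

theorem bilin {g : ι → FullPhase n → G} (h : Conormal U f) (h' : Conormal U g)
    (B : F →L[ℝ] G →L[ℝ] H) : Conormal U (fun i q => B (f i q) (g i q)) :=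
  ⟨h.isOpen, h.subset, fun i => (B.contDiff.comp_contDiffOn (h.smooth i)).clm_apply (h'.smooth i),
    fun N => (h.bdd N).bilin h.isOpen B h.subset h.smooth h'.smooth (h'.bdd N)⟩

theorem smul {c : ι → FullPhase n → ℝ} (hc : Conormal U c) (h : Conormal U f) :
    Conormal U (fun i q => c i q • f i q) :=
  hc.bilin h (ContinuousLinearMap.lsmul ℝ ℝ)

theorem mul {A : Type*} [NormedRing A] [NormedAlgebra ℝ A] {f g : ι → FullPhase n → A}
    (h : Conormal U f) (h' : Conormal U g) : Conormal U (fun i q => f i q * g i q) :=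
  h.bilin h' (ContinuousLinearMap.mul ℝ A)

theorem neg (h : Conormal U f) : Conormal U (fun i q => -f i q) :=
  h.clm (-ContinuousLinearMap.id ℝ F)

theorem sub (h : Conormal U f) (h' : Conormal U g) : Conormal U (fun i q => f i q - g i q) :=
  (h.add h'.neg).congr fun _ _ _ => sub_eq_add_neg _ _

theorem sum {κ : Type*} (s : Finset κ) {f : κ → ι → FullPhase n → F} (hU : IsOpen U)
    (hUi : U ⊆ fullInteriorSet n) (h : ∀ k ∈ s, Conormal U (f k)) :
    Conormal U (fun i q => ∑ k ∈ s, f k i q) := by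
  classical
  induction s using Finset.induction_on with
  | empty => simpa using const (ι := ι) (F := F) hU hUi (c := fun _ => 0) ⟨0, by simp⟩
  | insert k s hks ih =>
    simp only [Finset.sum_insert hks]
    exact (h k (by simp)).add (ih fun j hj => h j (by simp [hj]))

theorem field (h : Conormal U f) (κ : FrameIndex n) :
    Conormal U (fun i => applyField (fullField κ) (f i)) :=
  ⟨h.isOpen, h.subset, fun i => contDiffOn_applyField h.isOpen h.subset (h.smooth i) κ,
    fun N => (h.bdd (N + 1)).2 κ⟩

/-- Conormality from boundedness by induction on the number of fields, when each derivative along a frame field has as many bounded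
derivatives as the family itself. -/
theorem of_step (hU : IsOpen U) (hUi : U ⊆ fullInteriorSet n) (hf : ∀ i, ContDiffOn ℝ ∞ (f i) U)
    (h0 : BddOverBase U f) (step : ∀ N, DerivBdd U N f →
      ∀ κ, DerivBdd U N (fun i => applyField (fullField κ) (f i))) : Conormal U f := by
  refine ⟨hU, hUi, hf, fun N => ?_⟩
  induction N with
  | zero => exact h0
  | succ N ih => exact ⟨h0, step N ih⟩

theorem differentiableAt (h : Conormal U f) (i : ι) {q : FullPhase n} (hq : q ∈ U) :
    DifferentiableAt ℝ (f i) q :=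
  ((h.smooth i).contDiffAt (h.isOpen.mem_nhds hq)).differentiableAt (by simp)

/-- Real powers of conormal families that are locally bounded away from `0` are conormal. -/
theorem rpow {f : ι → FullPhase n → ℝ} (h : Conormal U f)
    (hf : ∀ R : ℝ, ∃ c > 0, ∀ i, ∀ q ∈ U, ‖q.1.1‖ ≤ R → c ≤ f i q) (α : ℝ) :
    Conormal U (fun i q => f i q ^ α) := by
  have hpos : ∀ i, ∀ q ∈ U, 0 < f i q := fun i q hq => by
    obtain ⟨c, hc, hcf⟩ := hf ‖q.1.1‖
    exact hc.trans_le (hcf i q hq le_rfl)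
  have hs : ∀ α : ℝ, ∀ i, ContDiffOn ℝ ∞ (fun q => f i q ^ α) U := fun α i =>
    (h.smooth i).rpow_const_of_ne fun q hq => (hpos i q hq).ne'
  have h0 : ∀ α : ℝ, BddOverBase U (fun i q => f i q ^ α) := by
    intro α R
    obtain ⟨c, hc, hcf⟩ := hf R
    obtain ⟨C, hC⟩ := h.bdd 0 R
    refine ⟨max (c ^ α) (C ^ α), fun i q hq hR => ?_⟩
    have h1 := hcf i q hq hR
    have h2 := (le_abs_self _).trans (hC i q hq hR)
    have h3 := hpos i q hq
    rw [Real.norm_of_nonneg (Real.rpow_nonneg h3.le _)]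
    rcases le_total 0 α with hα | hα
    · exact (Real.rpow_le_rpow h3.le h2 hα).trans (le_max_right _ _)
    · exact (Real.rpow_le_rpow_of_nonpos hc h1 hα).trans (le_max_left _ _)
  refine ⟨h.isOpen, h.subset, hs α, fun N => ?_⟩
  induction N generalizing α with
  | zero => exact h0 α
  | succ N ih =>
    refine ⟨h0 α, fun κ => ?_⟩
    have h1 := (DerivBdd.bilin h.isOpen (ContinuousLinearMap.mul ℝ ℝ) h.subset (hs (α - 1))
      (h.field κ).smooth (ih (α - 1)) ((h.field κ).bdd N)).clm h.isOpen
        (α • ContinuousLinearMap.id ℝ ℝ) h.subset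
        (fun i => (hs (α - 1) i).mul ((h.field κ).smooth i))
    refine h1.congr h.isOpen fun i q hq => ?_
    simp only [applyField]
    rw [((h.differentiableAt i hq).hasFDerivAt.rpow_const (Or.inl (hpos i q hq).ne')).fderiv]
    simp [mul_assoc]

theorem pow {f : ι → FullPhase n → ℝ} (h : Conormal U f) (k : ℕ) :
    Conormal U (fun i q => f i q ^ k) := by
  induction k with
  | zero => simpa using const (ι := ι) (F := ℝ) h.isOpen h.subset (c := fun _ => 1) ⟨1, by simp⟩
  | succ k ih => simpa only [pow_succ] using ih.mul h

end Conormal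

end Conormal

/-! ### Examples of conormal families -/

section Examples

variable {ι : Type*} {F : Type*} [NormedAddCommGroup F] [NormedSpace ℝ F] {U : Set (FullPhase n)}

theorem fderiv_comp_fst {f : Phase n → F} {q : FullPhase n} (hf : DifferentiableAt ℝ f q.1)
    (v : FullPhase n) : fderiv ℝ (fun q : FullPhase n => f q.1) q v = fderiv ℝ f q.1 v.1 := by
  have h : HasFDerivAt (fun q : FullPhase n => f q.1)
    ((fderiv ℝ f q.1).comp (ContinuousLinearMap.fst ℝ (Phase n) (E n))) q :=
    HasFDerivAt.comp q hf.hasFDerivAt hasFDerivAt_fst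
  rw [h.fderiv]
  rfl

theorem applyField_inl_comp_fst {f : Phase n → F} {q : FullPhase n} (hf : DifferentiableAt ℝ f q.1)
    (κ : Fin n ⊕ Fin n) : applyField (fullField (Sum.inl κ)) (fun q : FullPhase n => f q.1) q =
      applyField (frameField κ) f q.1 := by
  rw [applyField, fderiv_comp_fst hf]
  rfl

theorem applyField_inr_comp_fst {f : Phase n → F} {q : FullPhase n} (hf : DifferentiableAt ℝ f q.1)
    (i : Fin n) : applyField (fullField (Sum.inr i)) (fun q : FullPhase n => f q.1) q = 0 := by
  rw [applyField, fderiv_comp_fst hf]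
  simp [fullField, fullDir]

/-- Functions smooth on `𝒳₂` are conormal, as the frame preserves `C^∞(𝒳₂)` and its elements are
bounded. -/
theorem SmoothOnX2.conormal {f : Phase n → ℝ} (hf : SmoothOnX2 f) (ι : Type*) :
    Conormal (fullInteriorSet n) (fun (_ : ι) q => f q.1) := by
  have hs : ∀ {f : Phase n → ℝ}, SmoothOnX2 f → BddOverBase (fullInteriorSet n)
      (fun (_ : ι) (q : FullPhase n) => f q.1) := fun hf R => by
    obtain ⟨C, hC⟩ := hf.exists_bound R
    exact ⟨C, fun _ q hq hR => hC q.1 hq hR⟩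
  refine ⟨isOpen_fullInteriorSet, subset_rfl, fun _ => hf.contDiffOn.comp
    (contDiff_fst (E := Phase n) (F := E n)).contDiffOn fun q hq => hq, fun N => ?_⟩
  induction N generalizing f with
  | zero => exact hs hf
  | succ N ih =>
    refine ⟨hs hf, fun κ => ?_⟩
    rcases κ with κ | i
    · refine (ih ((isTangentField_frameField κ).smooth f hf)).congr isOpen_fullInteriorSet
        fun _ q hq => applyField_inl_comp_fst (hf.differentiableAt hq) κ
    · refine (DerivBdd.const _ N (c := fun _ : ι => (0 : ℝ)) ⟨0, by simp⟩).congr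
        isOpen_fullInteriorSet fun _ q hq => applyField_inr_comp_fst (hf.differentiableAt hq) i

/-- The scaled variable `xZ` on a region where it is bounded. -/
theorem conormal_scaled (ι : Type*) (hU : IsOpen U) (hUi : U ⊆ fullInteriorSet n) {C : ℝ}
    (hC : ∀ q ∈ U, ‖q.1.1 0 • q.2‖ ≤ C) (j : Fin n) :
    Conormal U (fun (_ : ι) q => q.1.1 0 * q.2 j) := by
  refine .of_step hU hUi (fun _ => by fun_prop)
    (fun R => ⟨C, fun _ q hq _ => (PiLp.norm_apply_le (q.1.1 0 • q.2) j).trans (hC q hq)⟩) ?_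
  intro N hN κ
  have hd : ∀ q : FullPhase n, ∀ v : FullPhase n,
      fderiv ℝ (fun q : FullPhase n => q.1.1 0 * q.2 j) q v = v.1.1 0 * q.2 j + q.1.1 0 * v.2 j := by
    intro q v
    have h1 := HasDirDeriv.clm (p := q) (v := v) (fullCoord (Sum.inl (Sum.inl 0)))
    have h2 := HasDirDeriv.clm (p := q) (v := v) (fullCoord (Sum.inr j))
    exact (h1.mul h2).2
  rcases κ with (i | i) | i
  · rcases eq_or_ne i 0 with rfl | hi
    · refine hN.congr hU fun _ q hq => ?_
      rw [applyField, hd]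
      simp [fullField, fullDir, fullCoeff, frameCoeff, frameDir]
    · refine (DerivBdd.const _ N (c := fun _ : ι => (0 : ℝ)) ⟨0, by simp⟩).congr hU fun _ q hq => ?_
      rw [applyField, hd]
      simp [fullField, fullDir, fullCoeff, frameCoeff, frameDir, hi, hi.symm]
  · refine (DerivBdd.const _ N (c := fun _ : ι => (0 : ℝ)) ⟨0, by simp⟩).congr hU fun _ q hq => ?_
    rw [applyField, hd]
    simp [fullField, fullDir, frameDir]
  · refine (DerivBdd.const _ N (c := fun _ : ι => if j = i then (1 : ℝ) else 0)
      ⟨1, fun _ => by split_ifs <;> simp⟩).congr hU fun _ q hq => ?_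
    rw [applyField, hd]
    have : q.1.1 0 ≠ 0 := ne_of_gt (hUi hq)
    by_cases h : j = i
    · simp [fullField, fullDir, fullCoeff, h, this]
    · simp [fullField, fullDir, h]

end Examples

/-! ### Full symbols as conormal functions -/

theorem applyFields_cons {W G : Type*} [NormedAddCommGroup W] [NormedSpace ℝ W]
    [NormedAddCommGroup G] [NormedSpace ℝ G] (V : W → W) (L : List (W → W)) (f : W → G) :
    applyFields (V :: L) f = applyField V (applyFields L f) := rfl

theorem isFullTestField_fullField (κ : FrameIndex n) : IsFullTestField (fullField (n := n) κ) := by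
  rcases κ with κ | i
  · convert IsFullTestField.lift _ (isTangentField_frameField κ) using 2 with q
    simp [fullField, fullDir, fullCoeff, frameField]
  · convert IsFullTestField.dZ i using 2 with q
    simp [fullField, fullDir, fullCoeff]

/-- The frame suffices to test full symbols: the coefficients of a tangent field in the frame are smooth
on `𝒳₂`, hence conormal. -/
theorem isFullSymbolZero_iff_conormal {f : FullPhase n → ℂ} (ι : Type*) [Nonempty ι] :
    IsFullSymbolZero f ↔ Conormal (fullInteriorSet n) (fun (_ : ι) => f) := by
  constructor
  · rintro ⟨hs, hb⟩
    have key : ∀ N, ∀ L : List (FullPhase n → FullPhase n), (∀ V ∈ L, IsFullTestField V) →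
        DerivBdd (fullInteriorSet n) N (fun (_ : ι) => applyFields L f) := by
      have h0 : ∀ L : List (FullPhase n → FullPhase n), (∀ V ∈ L, IsFullTestField V) →
          BddOverBase (fullInteriorSet n) (fun (_ : ι) => applyFields L f) :=
        fun L hL R => (hb L hL R).imp fun C hC _ => hC
      intro N
      induction N with
      | zero => exact h0
      | succ N ih =>
        refine fun L hL => ⟨h0 L hL, fun κ => ih (fullField κ :: L) fun V hV => ?_⟩
        rcases List.mem_cons.1 hV with rfl | hV
        · exact isFullTestField_fullField κ
        · exact hL V hV
    exact ⟨isOpen_fullInteriorSet, subset_rfl, fun _ => hs, fun N => key N [] (by simp)⟩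
  · intro h
    obtain ⟨i⟩ := ‹Nonempty ι›
    refine ⟨h.smooth i, fun L hL => ?_⟩
    have key : Conormal (fullInteriorSet n) (fun (_ : ι) => applyFields L f) := by
      induction L with
      | nil => exact h
      | cons V L ih =>
        have ih := ih fun V hV => hL V (List.mem_cons_of_mem _ hV)
        rcases hL V List.mem_cons_self with ⟨V, hV⟩ | j
        · choose c hc hcV using hV.exists_frame_coeff
          refine (Conormal.sum Finset.univ isOpen_fullInteriorSet subset_rfl fun κ _ =>
            ((hc κ).conormal ι).smul (ih.field (Sum.inl κ))).congr fun i q hq => ?_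
          rw [applyFields_cons]
          have hv : ((V q.1, 0) : FullPhase n) =
              ∑ κ, c κ q.1 • fullField (n := n) (Sum.inl κ) q := by
            refine Prod.ext ?_ ?_
            · rw [Prod.fst_sum]
              simp only [fullField, fullDir, fullCoeff, Prod.smul_fst, smul_smul]
              rw [← sum_frameCoord_smul_frameDir (V q.1)]
              exact Finset.sum_congr rfl fun κ _ => by rw [hcV κ q.1 hq]
            · rw [Prod.snd_sum]
              simp [fullField, fullDir]
          simp only [applyField]
          rw [hv, map_sum]
          simp only [map_smul]
        · have := ih.field (Sum.inr j)
          refine this.congr fun i q hq => ?_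
          rw [applyFields_cons]
          simp [applyField, fullField, fullDir, fullCoeff]
    intro R
    exact (key.bdd 0 R).imp fun C hC => hC i

/-- Families of full symbols of a given order, with uniform bounds. -/
def FullSymbolFamily {ι : Type*} (m l k j : ℝ) (a : ι → FullPhase n → ℂ) : Prop :=
  Conormal (fullInteriorSet n) (fun i q => (weight m l k j q.1 : ℂ) * a i q)

theorem isFullSymbol_iff {m l k j : ℝ} {a : FullPhase n → ℂ} (ι : Type*) [Nonempty ι] :
    IsFullSymbol m l k j a ↔ FullSymbolFamily m l k j (fun (_ : ι) => a) :=
  isFullSymbolZero_iff_conormal ι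

/-! ### Elliptic families -/

section Elliptic

variable {ι : Type*} {U : Set (FullPhase n)}

/-- Conormal families of positive functions that are bounded away from `0` over bounded parts of the
base. -/
structure Elliptic (U : Set (FullPhase n)) (f : ι → FullPhase n → ℝ) : Prop
    extends Conormal U f where
  /-- a positive lower bound over bounded parts of the base -/
  lower : ∀ R : ℝ, ∃ c > 0, ∀ i, ∀ q ∈ U, ‖q.1.1‖ ≤ R → c ≤ f i q

namespace Elliptic

variable {f g : ι → FullPhase n → ℝ}

theorem congr (h : Elliptic U f) (hfg : ∀ i, ∀ q ∈ U, g i q = f i q) : Elliptic U g :=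
  ⟨h.toConormal.congr hfg, fun R => by
    obtain ⟨c, hc, hf⟩ := h.lower R
    exact ⟨c, hc, fun i q hq hR => by rw [hfg i q hq]; exact hf i q hq hR⟩⟩

theorem pos (h : Elliptic U f) (i : ι) {q : FullPhase n} (hq : q ∈ U) : 0 < f i q := by
  obtain ⟨c, hc, hf⟩ := h.lower ‖q.1.1‖
  exact hc.trans_le (hf i q hq le_rfl)

theorem one (ι : Type*) (hU : IsOpen U) (hUi : U ⊆ fullInteriorSet n) :
    Elliptic U (fun (_ : ι) _ => 1) :=
  ⟨.const hU hUi ⟨1, by simp⟩, fun _ => ⟨1, one_pos, fun _ _ _ _ => le_rfl⟩⟩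

theorem mul (h : Elliptic U f) (h' : Elliptic U g) : Elliptic U (fun i q => f i q * g i q) :=
  ⟨h.toConormal.mul h'.toConormal, fun R => by
    obtain ⟨c, hc, hf⟩ := h.lower R
    obtain ⟨c', hc', hg⟩ := h'.lower R
    exact ⟨c * c', mul_pos hc hc', fun i q hq hR =>
      mul_le_mul (hf i q hq hR) (hg i q hq hR) hc'.le (h.pos i hq).le⟩⟩

theorem rpow (h : Elliptic U f) (α : ℝ) : Elliptic U (fun i q => f i q ^ α) :=
  ⟨h.toConormal.rpow h.lower α, fun R => by
    obtain ⟨c, hc, hf⟩ := h.lower R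
    obtain ⟨C, hC⟩ := h.bdd 0 R
    rcases le_total 0 α with hα | hα
    · exact ⟨c ^ α, Real.rpow_pos_of_pos hc α, fun i q hq hR =>
        Real.rpow_le_rpow hc.le (hf i q hq hR) hα⟩
    · refine ⟨(max C 1) ^ α, Real.rpow_pos_of_pos (by positivity) α, fun i q hq hR =>
        Real.rpow_le_rpow_of_nonpos (h.pos i hq) ?_ hα⟩
      exact ((le_abs_self _).trans (hC i q hq hR)).trans (le_max_left _ _)⟩

theorem inv (h : Elliptic U f) : Elliptic U (fun i q => (f i q)⁻¹) :=
  (h.rpow (-1)).congr fun _ _ _ => (Real.rpow_neg_one _).symm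

theorem sq (h : Elliptic U f) : Elliptic U (fun i q => f i q ^ 2) :=
  (h.mul h).congr fun _ _ _ => pow_two _

/-- Convex combinations of elliptic families, with weights smooth on `𝒳₂`. -/
theorem convex {κ : Type*} [Fintype κ] {w : κ → Phase n → ℝ} {g : κ → ι → FullPhase n → ℝ}
    (hU : IsOpen U) (hUi : U ⊆ fullInteriorSet n)
    (hw : ∀ k, SmoothOnX2 (w k)) (hw0 : ∀ k, ∀ p ∈ interiorSet n, 0 ≤ w k p)
    (hw1 : ∀ p ∈ interiorSet n, ∑ k, w k p = 1) (hg : ∀ k, Elliptic U (g k)) :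
    Elliptic U (fun i q => ∑ k, w k q.1 * g k i q) := by
  refine ⟨Conormal.sum _ hU hUi fun k _ => (((hw k).conormal ι).mono hU hUi).mul
    (hg k).toConormal, fun R => ?_⟩
  choose c hc hcg using fun k => (hg k).lower R
  -- a common positive lower bound of the constants `c k`
  have hS : 0 < 1 + ∑ k, (c k)⁻¹ :=
    add_pos_of_pos_of_nonneg one_pos (Finset.sum_nonneg fun k _ => (inv_pos.2 (hc k)).le)
  refine ⟨(1 + ∑ k, (c k)⁻¹)⁻¹, inv_pos.2 hS, fun i q hq hR => ?_⟩
  have hk : ∀ k, (1 + ∑ k, (c k)⁻¹)⁻¹ ≤ g k i q := by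
    intro k
    refine le_trans ?_ (hcg k i q hq hR)
    rw [inv_le_comm₀ hS (hc k)]
    have := Finset.single_le_sum (f := fun k => (c k)⁻¹)
      (fun k _ => (inv_pos.2 (hc k)).le) (Finset.mem_univ k)
    linarith
  calc (1 + ∑ k, (c k)⁻¹)⁻¹ = ∑ k, w k q.1 * (1 + ∑ k, (c k)⁻¹)⁻¹ := by
        rw [← Finset.sum_mul, hw1 q.1 (hUi hq), one_mul]
    _ ≤ _ := Finset.sum_le_sum fun k _ => mul_le_mul_of_nonneg_left (hk k) (hw0 k q.1 (hUi hq))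

end Elliptic

end Elliptic

/-! ### The change of variables of the adjoint -/

/-- The weights of the scattering dilation: `c²` for the first variable, `c` for the others. -/
def dilFactor (c : ℝ) (i : Fin n) : ℝ := if i = 0 then c ^ 2 else c

/-- The anisotropic dilation `(X, Y) ↦ (c² X, c Y)`. -/
def dilate (c : ℝ) (v : E n) : E n := WithLp.toLp 2 (fun i => dilFactor c i * v i)

/-- The ratio `1 + xX` of the values of `x` at `(x + x² X, y + x Y)` and at `(x, y)`. -/
def stretch (q : FullPhase n) : ℝ := 1 + q.1.1 0 * q.2 0

/-- The change of variables exchanging the two base points `(x, y)` and `(x + x² X, y + x Y)` of the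
kernel. The fibre variable is rescaled so that the phase `ξX + η·Y` changes its sign only. -/
def adjMap (q : FullPhase n) : FullPhase n :=
  ((scatShift q.1.1 q.2, dilate (stretch q) q.1.2), -dilate (stretch q)⁻¹ q.2)

/-- A region of bounded `(xX, xY)` on which `adjMap` is well behaved. -/
def adjRegion (n : ℕ) [NeZero n] : Set (FullPhase n) :=
  {q | 0 < q.1.1 0 ∧ 1 / 2 < stretch q ∧ ‖q.1.1 0 • q.2‖ < 3}

theorem dilate_apply (c : ℝ) (v : E n) (i : Fin n) : dilate c v i = dilFactor c i * v i := rfl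

theorem isOpen_adjRegion : IsOpen (adjRegion n) := by
  have h1 : Continuous fun q : FullPhase n => q.1.1 0 := by fun_prop
  have h2 : Continuous (stretch (n := n)) := by unfold stretch; fun_prop
  have h3 : Continuous fun q : FullPhase n => ‖q.1.1 0 • q.2‖ := by fun_prop
  exact (isOpen_lt continuous_const h1).inter
    ((isOpen_lt continuous_const h2).inter (isOpen_lt h3 continuous_const))

theorem adjRegion_subset : adjRegion n ⊆ fullInteriorSet n := fun _ hq => hq.1

theorem adjMap_base_zero (q : FullPhase n) : (adjMap q).1.1 0 = q.1.1 0 * stretch q := by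
  simp only [adjMap, scatShift, stretch, if_true]
  ring

theorem adjMap_base_of_ne (q : FullPhase n) {i : Fin n} (hi : i ≠ 0) :
    (adjMap q).1.1 i = q.1.1 i + q.1.1 0 * q.2 i := by
  simp only [adjMap, scatShift, hi, if_false]

theorem stretch_pos {q : FullPhase n} (hq : q ∈ adjRegion n) : 0 < stretch q :=
  lt_trans (by norm_num) hq.2.1

theorem adjMap_mem {q : FullPhase n} (hq : q ∈ adjRegion n) : adjMap q ∈ fullInteriorSet n := by
  change 0 < (adjMap q).1.1 0
  rw [adjMap_base_zero]
  exact mul_pos hq.1 (stretch_pos hq)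

theorem contDiffOn_stretch (U : Set (FullPhase n)) : ContDiffOn ℝ ∞ (stretch (n := n)) U := by
  unfold stretch
  fun_prop

theorem contDiffOn_adjMap : ContDiffOn ℝ ∞ (adjMap (n := n)) (adjRegion n) := by
  have hs := contDiffOn_stretch (adjRegion n)
  have hs' : ContDiffOn ℝ ∞ (fun q : FullPhase n => (stretch q)⁻¹) (adjRegion n) :=
    hs.inv fun q hq => (stretch_pos hq).ne'
  unfold adjMap
  refine ContDiffOn.prodMk (ContDiffOn.prodMk ?_ ?_) (ContDiffOn.neg ?_)
  · rw [contDiffOn_euclidean]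
    intro i
    by_cases hi : i = 0
    · simp only [scatShift, hi, if_true]; fun_prop
    · simp only [scatShift, hi, if_false]; fun_prop
  · rw [contDiffOn_euclidean]
    intro i
    simp only [dilate_apply, dilFactor]
    split_ifs <;> fun_prop
  · rw [contDiffOn_euclidean]
    intro i
    simp only [dilate_apply, dilFactor]
    split_ifs <;> fun_prop

theorem norm_scatShift_le (z Z : E n) (hz : 0 < z 0) :
    ‖scatShift z Z‖ ≤ ‖z‖ + (‖z‖ + 1) * ‖z 0 • Z‖ := by
  have h : scatShift z Z = z + WithLp.toLp 2 (fun i => (if i = 0 then z 0 else 1) * (z 0 * Z i)) := by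
    ext i
    by_cases hi : i = 0
    · simp [scatShift, hi]; ring
    · simp [scatShift, hi]
  rw [h]
  refine norm_add_le_of_le le_rfl ?_
  have hx : z 0 ≤ ‖z‖ := (le_abs_self _).trans (PiLp.norm_apply_le z 0)
  have hM : 0 ≤ ‖z‖ + 1 := by positivity
  rw [← abs_of_nonneg (mul_nonneg hM (norm_nonneg (z 0 • Z))), ← abs_of_nonneg (norm_nonneg _),
    ← sq_le_sq, mul_pow, EuclideanSpace.real_norm_sq_eq, EuclideanSpace.real_norm_sq_eq,
    Finset.mul_sum]
  refine Finset.sum_le_sum fun i _ => ?_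
  simp only [mul_pow, PiLp.smul_apply, smul_eq_mul]
  refine mul_le_mul_of_nonneg_right ?_ (by positivity)
  split_ifs
  · exact pow_le_pow_left₀ hz.le (by linarith) 2
  · exact pow_le_pow_left₀ zero_le_one (by linarith [norm_nonneg z]) 2

theorem norm_adjMap_base_le {q : FullPhase n} (hq : q ∈ adjRegion n) {R : ℝ} (hR : ‖q.1.1‖ ≤ R) :
    ‖(adjMap q).1.1‖ ≤ R + (R + 1) * 3 := by
  refine (norm_scatShift_le q.1.1 q.2 hq.1).trans (add_le_add hR ?_)
  exact mul_le_mul (by linarith) hq.2.2.le (norm_nonneg _) (by linarith [norm_nonneg q.1.1])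

section Ratios

variable {ι : Type*}

theorem Elliptic.sqrt {U : Set (FullPhase n)} {f : ι → FullPhase n → ℝ} (h : Elliptic U f) :
    Elliptic U (fun i q => Real.sqrt (f i q)) :=
  (h.rpow (1 / 2)).congr fun _ _ _ => Real.sqrt_eq_rpow _

theorem conormal_scaled_adjRegion (ι : Type*) (j : Fin n) :
    Conormal (adjRegion n) (fun (_ : ι) q => q.1.1 0 * q.2 j) :=
  conormal_scaled ι isOpen_adjRegion adjRegion_subset (fun _ hq => hq.2.2.le) j

theorem SmoothOnX2.conormal_adjRegion {f : Phase n → ℝ} (hf : SmoothOnX2 f) (ι : Type*) :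
    Conormal (adjRegion n) (fun (_ : ι) q => f q.1) :=
  (hf.conormal ι).mono isOpen_adjRegion adjRegion_subset

theorem elliptic_stretch (ι : Type*) : Elliptic (adjRegion n) (fun (_ : ι) => stretch) :=
  ⟨(Conormal.const isOpen_adjRegion adjRegion_subset (c := fun _ => (1 : ℝ)) ⟨1, by simp⟩).add
    (conormal_scaled_adjRegion ι 0), fun _ => ⟨1 / 2, by norm_num, fun _ _ hq _ => hq.2.1.le⟩⟩

theorem elliptic_dilFactor {U : Set (FullPhase n)} {f : ι → FullPhase n → ℝ} (h : Elliptic U f)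
    (i : Fin n) : Elliptic U (fun k q => dilFactor (f k q) i) := by
  unfold dilFactor
  split_ifs
  · exact h.sq
  · exact h

/-- `ρ` is multiplied by an elliptic function under the change of variables. -/
theorem elliptic_rho_ratio (ι : Type*) :
    Elliptic (adjRegion n) (fun (_ : ι) q => rho (adjMap q).1 / rho q.1) := by
  have h := (Elliptic.convex (ι := ι) (κ := Option (Fin n))
    (w := fun k p => k.elim (rho p ^ 2) fun i => (rho p * p.2 i) ^ 2)
    (g := fun k _ q => k.elim 1 fun i => dilFactor (stretch q) i ^ 2)
    isOpen_adjRegion adjRegion_subset ?_ ?_ ?_ ?_).sqrt.inv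
  · refine h.congr fun _ q hq => ?_
    have h1 : ∑ k : Option (Fin n), (k.elim (rho q.1 ^ 2) fun i => (rho q.1 * q.1.2 i) ^ 2) *
        (k.elim 1 fun i => dilFactor (stretch q) i ^ 2) =
        rho q.1 ^ 2 * (1 + ‖(adjMap q).1.2‖ ^ 2) := by
      rw [Fintype.sum_option, EuclideanSpace.real_norm_sq_eq, mul_add, Finset.mul_sum]
      simp only [Option.elim, adjMap, dilate_apply]
      refine congrArg₂ _ rfl (Finset.sum_congr rfl fun i _ => by ring)
    simp only [h1]
    rw [Real.sqrt_mul (sq_nonneg _), Real.sqrt_sq (rho_pos _).le, mul_inv, div_eq_inv_mul]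
    rfl
  · rintro (_ | i)
    · exact SmoothOnX2.rho.pow 2
    · exact (SmoothOnX2.theta i).pow 2
  · rintro (_ | i) p _ <;> exact sq_nonneg _
  · intro p _
    rw [Fintype.sum_option]
    simp only [Option.elim, mul_pow]
    rw [← Finset.mul_sum, ← EuclideanSpace.real_norm_sq_eq, ← rho_sq p]
    ring
  · rintro (_ | i)
    · exact .one ι isOpen_adjRegion adjRegion_subset
    · exact (elliptic_dilFactor (elliptic_stretch ι) i).sq

theorem tau_adjMap (q : FullPhase n) (i : Fin n) : tau (adjMap q).1 i =
    tau q.1 i * (rho (adjMap q).1 / rho q.1 * dilFactor (stretch q) i) := by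
  have := (rho_pos q.1).ne'
  rw [tau_apply, tau_apply]
  split_ifs
  · ring
  · simp only [adjMap, dilate_apply] at *
    field_simp

/-- `d_Σ` is multiplied by an elliptic function under the change of variables. -/
theorem elliptic_dSigma_ratio (ι : Type*) :
    Elliptic (adjRegion n) (fun (_ : ι) q => dSigma (adjMap q).1 / dSigma q.1) := by
  have h := (Elliptic.convex (ι := ι) (κ := Option (Fin n))
    (w := fun k p => k.elim (rhoTilde p) fun i => tauTilde p i ^ 2)
    (g := fun k _ q => k.elim (rho (adjMap q).1 / rho q.1) fun i =>
      (rho (adjMap q).1 / rho q.1 * dilFactor (stretch q) i) ^ 2)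
    isOpen_adjRegion adjRegion_subset ?_ ?_ ?_ ?_).sqrt
  · refine h.congr fun _ q hq => ?_
    have h0 := dSigma_pos q.1
    have h2 := (rho_pos q.1).ne'
    have h1 : ∑ k : Option (Fin n), (k.elim (rhoTilde q.1) fun i => tauTilde q.1 i ^ 2) *
        (k.elim (rho (adjMap q).1 / rho q.1) fun i =>
          (rho (adjMap q).1 / rho q.1 * dilFactor (stretch q) i) ^ 2) =
        (‖tau (adjMap q).1‖ ^ 2 + rho (adjMap q).1) / dSigma q.1 ^ 2 := by
      rw [Fintype.sum_option, EuclideanSpace.real_norm_sq_eq, add_div, Finset.sum_div, add_comm]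
      simp only [Option.elim, tau_adjMap]
      refine congrArg₂ _ (Finset.sum_congr rfl fun i _ => ?_) ?_
      · rw [tau_eq_tauTilde_mul]
        field_simp
      · rw [rhoTilde]
        field_simp
    simp only [h1]
    rw [Real.sqrt_div' _ (sq_nonneg _), Real.sqrt_sq h0.le]
    rfl
  · rintro (_ | i)
    · exact .rhoTilde
    · exact (SmoothOnX2.tauTilde i).pow 2
  · rintro (_ | i) p _
    · exact rhoTilde_nonneg p
    · exact sq_nonneg _
  · intro p _
    rw [Fintype.sum_option]
    simp only [Option.elim]
    rw [← EuclideanSpace.real_norm_sq_eq, ← norm_sq_tauTilde_add_rhoTilde p]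
    ring
  · rintro (_ | i)
    · exact elliptic_rho_ratio ι
    · exact ((elliptic_rho_ratio ι).mul (elliptic_dilFactor (elliptic_stretch ι) i)).sq

theorem tauTilde_adjMap (q : FullPhase n) (i : Fin n) : tauTilde (adjMap q).1 i =
    tauTilde q.1 i * (rho (adjMap q).1 / rho q.1 * dilFactor (stretch q) i *
      (dSigma (adjMap q).1 / dSigma q.1)⁻¹) := by
  have h1 := (dSigma_pos q.1).ne'
  have h2 := (dSigma_pos (adjMap q).1).ne'
  rw [tauTilde_apply, tau_adjMap, tauTilde_apply]
  field_simp

/-- `d_Γ` is multiplied by an elliptic function under the change of variables. -/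
theorem elliptic_dGamma_ratio (ι : Type*) :
    Elliptic (adjRegion n) (fun (_ : ι) q => dGamma (adjMap q).1 / dGamma q.1) := by
  have h := (Elliptic.convex (ι := ι) (κ := Option (Option (Fin n)))
    (w := fun k p => k.elim (xHat p) fun k' => k'.elim (sHat p ^ 2) fun i => tauHat p i ^ 2)
    (g := fun k _ q => k.elim (stretch q) fun k' => k'.elim
      ((dSigma (adjMap q).1 / dSigma q.1) ^ 2) fun i =>
      (rho (adjMap q).1 / rho q.1 * dilFactor (stretch q) i *
        (dSigma (adjMap q).1 / dSigma q.1)⁻¹) ^ 2)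
    isOpen_adjRegion adjRegion_subset ?_ ?_ ?_ ?_).sqrt
  · refine h.congr fun _ q hq => ?_
    have h0 := dGamma_pos (p := q.1) (adjRegion_subset hq)
    have h2 := (dSigma_pos q.1).ne'
    have h1 : ∑ k : Option (Option (Fin n)), (k.elim (xHat q.1) fun k' =>
        k'.elim (sHat q.1 ^ 2) fun i => tauHat q.1 i ^ 2) *
        (k.elim (stretch q) fun k' => k'.elim ((dSigma (adjMap q).1 / dSigma q.1) ^ 2) fun i =>
          (rho (adjMap q).1 / rho q.1 * dilFactor (stretch q) i *
          (dSigma (adjMap q).1 / dSigma q.1)⁻¹) ^ 2) =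
        ((adjMap q).1.1 0 + dSigma (adjMap q).1 ^ 2 + ‖tauTilde (adjMap q).1‖ ^ 2) /
          dGamma q.1 ^ 2 := by
      rw [Fintype.sum_option, Fintype.sum_option, EuclideanSpace.real_norm_sq_eq, add_div, add_div,
        Finset.sum_div, ← add_assoc]
      simp only [Option.elim, tauTilde_adjMap, adjMap_base_zero]
      refine congrArg₂ _ (congrArg₂ _ ?_ ?_) (Finset.sum_congr rfl fun i _ => ?_)
      · rw [xHat]; ring
      · rw [sHat]; field_simp
      · rw [tauHat_apply]; ring
    simp only [h1]
    rw [Real.sqrt_div' _ (sq_nonneg _), Real.sqrt_sq h0.le]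
    rfl
  · rintro (_ | _ | i)
    · exact .xHat
    · exact SmoothOnX2.sHat.pow 2
    · exact (SmoothOnX2.tauHat i).pow 2
  · rintro (_ | _ | i) p hp
    · exact div_nonneg (le_of_lt hp) (sq_nonneg _)
    · exact sq_nonneg _
    · exact sq_nonneg _
  · intro p hp
    rw [Fintype.sum_option, Fintype.sum_option]
    simp only [Option.elim]
    rw [← EuclideanSpace.real_norm_sq_eq, ← xHat_add_sHat_add_tauHat hp]
    ring
  · rintro (_ | _ | i)
    · exact elliptic_stretch ι
    · exact (elliptic_dSigma_ratio ι).sq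
    · exact (((elliptic_rho_ratio ι).mul (elliptic_dilFactor (elliptic_stretch ι) i)).mul
        (elliptic_dSigma_ratio ι).inv).sq

/-- The weights of the symbol classes are multiplied by elliptic functions. -/
theorem elliptic_weight_ratio (ι : Type*) (m l k j : ℝ) : Elliptic (adjRegion n)
    (fun (_ : ι) q => weight m l k j (adjMap q).1 / weight m l k j q.1) := by
  refine (((((elliptic_rho_ratio ι).rpow m).mul ((elliptic_stretch ι).rpow l)).mul
    ((elliptic_dSigma_ratio ι).rpow k)).mul ((elliptic_dGamma_ratio ι).rpow j)).congr
      fun _ q hq => ?_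
  have hp : q.1 ∈ interiorSet n := adjRegion_subset hq
  have hp' : (adjMap q).1 ∈ interiorSet n := adjMap_mem hq
  have hx : 0 < q.1.1 0 := hp
  have hs := stretch_pos hq
  rw [Real.div_rpow (rho_pos _).le (rho_pos _).le, Real.div_rpow (dSigma_pos _).le (dSigma_pos _).le,
    Real.div_rpow (dGamma_pos hp').le (dGamma_pos hp).le]
  unfold weight
  rw [adjMap_base_zero, Real.mul_rpow hx.le hs.le]
  have h1 := (Real.rpow_pos_of_pos (rho_pos q.1) m).ne'
  have h2 := (Real.rpow_pos_of_pos hx l).ne'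
  have h3 := (Real.rpow_pos_of_pos (dSigma_pos q.1) k).ne'
  have h4 := (Real.rpow_pos_of_pos (dGamma_pos hp) j).ne'
  field_simp

theorem elliptic_fibreFactor_ratio (ι : Type*) (i : Fin n) : Elliptic (adjRegion n)
    (fun (_ : ι) q => fibreFactor i (adjMap q).1 / fibreFactor i q.1) := by
  unfold fibreFactor
  split_ifs
  · simpa using Elliptic.one ι isOpen_adjRegion adjRegion_subset
  · refine ((elliptic_dGamma_ratio ι).mul (elliptic_dSigma_ratio ι)).congr fun _ q hq => ?_
    exact (div_mul_div_comm _ _ _ _).symm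

end Ratios

/-! ### Invariance of conormality under the change of variables -/

theorem fullCoord_fullDir (κ κ' : FrameIndex n) :
    fullCoord κ' (fullDir κ) = if κ = κ' then 1 else 0 := by
  rcases κ with (i | i) | i <;> rcases κ' with (i' | i') | i' <;>
    simp [fullCoord, fullDir, frameCoord, frameDir, eq_comm]

theorem hasDirDeriv_fullCoord (κ κ' : FrameIndex n) (q : FullPhase n) :
    HasDirDeriv (fun q => fullCoord κ' q) (if κ = κ' then fullCoeff κ' q.1 else 0) q
      (fullField κ q) := by
  refine (HasDirDeriv.clm _).congr_value ?_
  rw [fullField, map_smul, fullCoord_fullDir]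
  split_ifs with h
  · simp [h]
  · simp

theorem Conormal.hasDirDeriv {ι : Type*} {U : Set (FullPhase n)} {f : ι → FullPhase n → ℝ}
    (h : Conormal U f) (i : ι) (κ : FrameIndex n) {q : FullPhase n} (hq : q ∈ U) :
    HasDirDeriv (f i) (applyField (fullField κ) (f i) q) q (fullField κ q) :=
  ⟨h.differentiableAt i hq, rfl⟩

/-- The fibre variable `ζ_i`, relative to the frame coefficient of its direction, is a coordinate of
`𝒳₂`. -/
theorem smoothOnX2_fibre_div_frameCoeff (i : Fin n) :
    SmoothOnX2 (fun p : Phase n => p.2 i / frameCoeff (Sum.inr i) p) := by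
  rcases eq_or_ne i 1 with rfl | hi
  · refine (SmoothOnX2.theta 1).congr fun p _ => ?_
    simp [frameCoeff, fibreFactor, mul_comm]
  · refine (SmoothOnX2.tauHat i).congr fun p hp => ?_
    have h1 := (rho_pos p).ne'
    have h2 := (dSigma_pos p).ne'
    have h3 := (dGamma_pos hp).ne'
    simp only [frameCoeff, fibreFactor, if_neg hi, tauHat_apply, tauTilde_apply, tau_apply]
    field_simp

/-- The frame coefficients of the image under `adjMap` of a frame field are conormal. -/
theorem conormal_adjMap_coeff (ι : Type*) (κ κ' : FrameIndex n) : Conormal (adjRegion n)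
    (fun (_ : ι) q => applyField (fullField κ) (fun q => fullCoord κ' (adjMap q)) q /
      fullCoeff κ' (adjMap q).1) := by
  have hconst : ∀ c : ℝ, Conormal (adjRegion n) (fun (_ : ι) _ => c) := fun c =>
    .const isOpen_adjRegion adjRegion_subset ⟨|c|, fun _ => le_rfl⟩
  have hs := elliptic_stretch (n := n) ι
  have hx : Conormal (adjRegion n) (fun (_ : ι) q =>
      applyField (fullField κ) (fun q => (adjMap q).1.1 0) q / (adjMap q).1.1 0) := by
    refine ((hconst (if κ = Sum.inl (Sum.inl 0) then 1 else 0)).add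
      ((hs.toConormal.field κ).mul hs.inv.toConormal)).congr fun i q hq => ?_
    have h1 := ((hasDirDeriv_fullCoord κ (Sum.inl (Sum.inl 0)) q).mul
      (hs.toConormal.hasDirDeriv i κ hq)).2
    have h2 : (fun q : FullPhase n => (adjMap q).1.1 0) = fun q =>
      fullCoord (Sum.inl (Sum.inl 0)) q * stretch q := funext adjMap_base_zero
    have h3 : q.1.1 0 ≠ 0 := ne_of_gt hq.1
    have h4 := (stretch_pos hq).ne'
    rw [h2, applyField, h1, adjMap_base_zero]
    change (_ * _ + q.1.1 0 * _) / _ = _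
    split_ifs
    · simp only [fullCoeff, frameCoeff, if_true]
      field_simp
    · field_simp
      ring
  rcases κ' with (i | i) | i
  · rcases eq_or_ne i 0 with rfl | hi
    · simpa [fullCoord, frameCoord, fullCoeff, frameCoeff] using hx
    · refine ((((SmoothOnX2.base i).conormal_adjRegion ι).add
        (conormal_scaled_adjRegion ι i)).field κ).congr fun _ q hq => ?_
      have h2 : (fun q : FullPhase n => fullCoord (Sum.inl (Sum.inl i)) (adjMap q)) = fun q =>
        q.1.1 i + q.1.1 0 * q.2 i := funext fun q => adjMap_base_of_ne q hi
      rw [h2]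
      simp [fullCoeff, frameCoeff, hi]
  · have hd := elliptic_dilFactor hs i
    have hr := ((elliptic_fibreFactor_ratio ι i).mul (elliptic_rho_ratio ι).inv).inv.toConormal
    refine ((((hd.toConormal.field κ).mul
      ((smoothOnX2_fibre_div_frameCoeff i).conormal_adjRegion ι)).add
      (hd.toConormal.mul (hconst (if κ = Sum.inl (Sum.inr i) then 1 else 0)))).mul hr).congr
      fun k q hq => ?_
    have h1 := ((hd.toConormal.hasDirDeriv k κ hq).mul
      (hasDirDeriv_fullCoord κ (Sum.inl (Sum.inr i)) q)).2
    have h2 : (fun q : FullPhase n => fullCoord (Sum.inl (Sum.inr i)) (adjMap q)) = fun q =>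
      dilFactor (stretch q) i * fullCoord (Sum.inl (Sum.inr i)) q := rfl
    rw [h2]
    simp only [applyField] at h1 ⊢
    rw [h1]
    have p1 := (rho_pos q.1).ne'
    have p2 := (rho_pos (adjMap q).1).ne'
    have p3 := (fibreFactor_pos i (p := q.1) (adjRegion_subset hq)).ne'
    have p4 := (fibreFactor_pos i (p := (adjMap q).1) (adjMap_mem hq)).ne'
    change (_ * q.1.2 i + _) / _ = _
    simp only [fullCoeff, frameCoeff]
    split_ifs <;> field_simp
    simp
  · -- here `x' Z'` is conormal, and the derivative of `x'` has been dealt with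
    have hT : Conormal (adjRegion n) (fun (_ : ι) q =>
        -(stretch q * dilFactor (stretch q)⁻¹ i * (q.1.1 0 * q.2 i))) :=
      ((hs.mul (elliptic_dilFactor hs.inv i)).toConormal.mul (conormal_scaled_adjRegion ι i)).neg
    refine ((hT.field κ).sub (hx.mul hT)).congr fun k q hq => ?_
    have h3 : ∀ q : FullPhase n, -(stretch q * dilFactor (stretch q)⁻¹ i * (q.1.1 0 * q.2 i)) =
        (adjMap q).1.1 0 * fullCoord (Sum.inr i) (adjMap q) := fun q => by
      rw [adjMap_base_zero]
      change _ = _ * -(dilFactor (stretch q)⁻¹ i * q.2 i)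
      ring
    have d : DifferentiableAt ℝ adjMap q :=
      (contDiffOn_adjMap.contDiffAt (isOpen_adjRegion.mem_nhds hq)).differentiableAt (by simp)
    have e1 : HasDirDeriv (fun q : FullPhase n => (adjMap q).1.1 0) _ q (fullField κ q) :=
      ⟨((fullCoord (n := n) (Sum.inl (Sum.inl 0))).differentiableAt).comp q d, rfl⟩
    have e2 : HasDirDeriv (fun q : FullPhase n => fullCoord (Sum.inr i) (adjMap q)) _ q
      (fullField κ q) := ⟨((fullCoord (n := n) (Sum.inr i)).differentiableAt).comp q d, rfl⟩
    have e3 := (e1.mul e2).2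
    simp only [h3]
    simp only [applyField] at e3 ⊢
    rw [e3]
    have p1 : (adjMap q).1.1 0 ≠ 0 := ne_of_gt (adjMap_mem hq)
    simp only [fullCoeff]
    field_simp
    ring

section Pullback

variable {ι : Type*} {F : Type*} [NormedAddCommGroup F] [NormedSpace ℝ F] {U : Set (FullPhase n)}

theorem DerivBdd.sum {κ : Type*} (s : Finset κ) {N : ℕ} {f : κ → ι → FullPhase n → F}
    (hU : IsOpen U) (hUi : U ⊆ fullInteriorSet n) (hf : ∀ k i, ContDiffOn ℝ ∞ (f k i) U)
    (h : ∀ k, DerivBdd U N (f k)) : DerivBdd U N (fun i q => ∑ k ∈ s, f k i q) := by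
  classical
  induction s using Finset.induction_on with
  | empty => simpa using DerivBdd.const (ι := ι) (F := F) U N (c := fun _ => 0) ⟨0, by simp⟩
  | insert k s hks ih =>
    simp only [Finset.sum_insert hks]
    exact (h k).add hU hUi (hf k) (fun i => ContDiffOn.sum fun k _ => hf k i) ih

/-- Conormal families on the interior pull back to conormal families under the change of variables. -/
theorem Conormal.comp_adjMap {f : ι → FullPhase n → F} (hf : Conormal (fullInteriorSet n) f) :
    Conormal (adjRegion n) (fun i q => f i (adjMap q)) := by
  have hs : ∀ {f : ι → FullPhase n → F}, Conormal (fullInteriorSet n) f → ∀ i,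
      ContDiffOn ℝ ∞ (fun q => f i (adjMap q)) (adjRegion n) := fun hf i =>
    (hf.smooth i).comp contDiffOn_adjMap fun q hq => adjMap_mem hq
  have h0 : ∀ {f : ι → FullPhase n → F}, Conormal (fullInteriorSet n) f →
      BddOverBase (adjRegion n) (fun i q => f i (adjMap q)) := fun hf R => by
    obtain ⟨C, hC⟩ := hf.bdd 0 (R + (R + 1) * 3)
    exact ⟨C, fun i q hq hR => hC i _ (adjMap_mem hq) (norm_adjMap_base_le hq hR)⟩
  refine ⟨isOpen_adjRegion, adjRegion_subset, hs hf, fun N => ?_⟩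
  induction N generalizing f with
  | zero => exact h0 hf
  | succ N ih =>
    refine ⟨h0 hf, fun κ => ?_⟩
    have hc := fun κ' => conormal_adjMap_coeff ι κ κ'
    refine (DerivBdd.sum Finset.univ isOpen_adjRegion adjRegion_subset
      (fun κ' i => ((hc κ').smooth i).smul (hs (hf.field κ') i)) fun κ' =>
      ((hc κ').bdd N).bilin isOpen_adjRegion (ContinuousLinearMap.lsmul ℝ ℝ) adjRegion_subset
        (hc κ').smooth (hs (hf.field κ')) (ih (hf.field κ'))).congr isOpen_adjRegion
      fun i q hq => ?_
    have d : DifferentiableAt ℝ adjMap q :=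
      (contDiffOn_adjMap.contDiffAt (isOpen_adjRegion.mem_nhds hq)).differentiableAt (by simp)
    have d' := hf.differentiableAt i (adjMap_mem hq)
    have e1 : fderiv ℝ (fun q => f i (adjMap q)) q = _ :=
      (d'.hasFDerivAt.comp q d.hasFDerivAt).fderiv
    rw [applyField, e1, ContinuousLinearMap.comp_apply,
      ← sum_fullCoord_smul_fullDir (fderiv ℝ adjMap q (fullField κ q)), map_sum]
    refine Finset.sum_congr rfl fun κ' _ => ?_
    have e2 : applyField (fullField κ) (fun q => fullCoord κ' (adjMap q)) q =
        fullCoord κ' (fderiv ℝ adjMap q (fullField κ q)) := by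
      have : fderiv ℝ (fun q => fullCoord κ' (adjMap q)) q = _ :=
        ((fullCoord κ').hasFDerivAt.comp q d.hasFDerivAt).fderiv
      rw [applyField, this, ContinuousLinearMap.comp_apply]
    have p := (fullCoeff_pos κ' (p := (adjMap q).1) (adjMap_mem hq)).ne'
    change _ = (applyField (fullField κ) (fun q => fullCoord κ' (adjMap q)) q /
      fullCoeff κ' (adjMap q).1) • fderiv ℝ (f i) (adjMap q)
        (fullCoeff κ' (adjMap q).1 • fullDir κ')
    rw [e2, map_smul, map_smul, smul_smul, div_mul_cancel₀ _ p]

end Pullback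

/-! ### The full symbol of the adjoint -/

/-- The full symbol of the adjoint: the kernel of the adjoint is the conjugate of the kernel with the
base points exchanged, and `(1 + xX)^{-(n+1)}` is what remains of the densities and Jacobians. Off
`adjRegion` the value is set to zero; for symbols supported near the diagonal nothing is cut off. -/
def adjSymbol (a : FullPhase n → ℂ) (q : FullPhase n) : ℂ :=
  open Classical in
  if q ∈ adjRegion n then (((stretch q) ^ (n + 1))⁻¹ : ℝ) * conj (a (adjMap q)) else 0

theorem adjSymbol_of_mem (a : FullPhase n → ℂ) {q : FullPhase n} (hq : q ∈ adjRegion n) :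
    adjSymbol a q = (((stretch q) ^ (n + 1))⁻¹ : ℝ) * conj (a (adjMap q)) := if_pos hq

theorem adjSymbol_of_notMem (a : FullPhase n → ℂ) {q : FullPhase n} (hq : q ∉ adjRegion n) :
    adjSymbol a q = 0 := if_neg hq

theorem scaled_adjMap {q : FullPhase n} (hq : 0 < stretch q) (i : Fin n) :
    (adjMap q).1.1 0 * (adjMap q).2 i =
      -(if i = 0 then (stretch q)⁻¹ else 1) * (q.1.1 0 * q.2 i) := by
  rw [adjMap_base_zero]
  change _ * -(dilFactor (stretch q)⁻¹ i * q.2 i) = _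
  unfold dilFactor
  split_ifs <;> field_simp

/-- If `|(xX, xY)| < 1/2` at the image point, then at the point itself `xX = -t/(1+t)` with `|t| < 1/2`,
so that `xX ≥ -1/3` and the factor `1 + xX` is at most `2`. -/
theorem scaled_le_of_adjMap {q : FullPhase n} (hs : 0 < stretch q)
    (h : ‖(adjMap q).1.1 0 • (adjMap q).2‖ < 1 / 2) :
    -1 / 3 ≤ q.1.1 0 * q.2 0 ∧ ‖q.1.1 0 • q.2‖ ≤ 2 := by
  have h0 : |(adjMap q).1.1 0 * (adjMap q).2 0| < 1 / 2 :=
    (PiLp.norm_apply_le ((adjMap q).1.1 0 • (adjMap q).2) 0).trans_lt h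
  rw [scaled_adjMap hs, if_pos rfl, neg_mul, abs_neg, ← div_eq_inv_mul, abs_div,
    abs_of_pos hs, div_lt_iff₀ hs] at h0
  obtain ⟨h1, h2⟩ := abs_lt.1 h0
  have hs' := hs
  simp only [stretch] at h1 h2 hs'
  refine ⟨by linarith, ?_⟩
  have h3 : ‖q.1.1 0 • q.2‖ ≤ 2 * ‖(adjMap q).1.1 0 • (adjMap q).2‖ := by
    rw [← abs_of_nonneg (norm_nonneg (q.1.1 0 • q.2)), ← abs_of_nonneg
      (mul_nonneg zero_le_two (norm_nonneg ((adjMap q).1.1 0 • (adjMap q).2))), ← sq_le_sq,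
      mul_pow, EuclideanSpace.real_norm_sq_eq, EuclideanSpace.real_norm_sq_eq, Finset.mul_sum]
    refine Finset.sum_le_sum fun i _ => ?_
    simp only [PiLp.smul_apply, smul_eq_mul]
    rw [scaled_adjMap hs, mul_pow _ (q.1.1 0 * q.2 i), ← mul_assoc]
    refine le_mul_of_one_le_left (sq_nonneg _) ?_
    split_ifs
    · rw [neg_sq, inv_pow, ← div_eq_mul_inv, le_div_iff₀ (by positivity), one_mul]
      refine pow_le_pow_left₀ hs.le ?_ 2
      unfold stretch
      linarith
    · norm_num
  linarith

/-- Where the cut-off in the definition of `adjSymbol` acts, a symbol supported near the diagonal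
vanishes at the image point. -/
theorem apply_adjMap_eq_zero {a : FullPhase n → ℂ} (ha : SupportedNearDiagonal a) {q : FullPhase n}
    (hx : 0 < q.1.1 0) (hs : 0 < stretch q) (hq : q ∉ adjRegion n) : a (adjMap q) = 0 := by
  refine ha _ ?_ (not_lt.1 fun h => hq ?_)
  · change 0 < (adjMap q).1.1 0
    rw [adjMap_base_zero]
    exact mul_pos hx hs
  · obtain ⟨h1, h2⟩ := scaled_le_of_adjMap hs h
    refine ⟨hx, ?_, by linarith⟩
    unfold stretch
    linarith

/-- The support of the symbol of the adjoint. -/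
theorem adjSymbol_eq_zero {a : FullPhase n → ℂ} (ha : SupportedNearDiagonal a) {q : FullPhase n}
    (hq : q.1.1 0 * q.2 0 < -1 / 3 ∨ 2 < ‖q.1.1 0 • q.2‖) : adjSymbol a q = 0 := by
  by_cases hr : q ∈ adjRegion n
  · rw [adjSymbol_of_mem a hr, ha _ (adjMap_mem hr), map_zero, mul_zero]
    refine not_lt.1 fun h => ?_
    obtain ⟨h1, h2⟩ := scaled_le_of_adjMap (stretch_pos hr) h
    rcases hq with hq | hq <;> linarith
  · exact adjSymbol_of_notMem a hr

/-- The class of full symbols of a given order is invariant under passage to the adjoint symbol. The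
symbol is conormal on `adjRegion` and vanishes on an open set which covers the rest. -/
theorem FullSymbolFamily.adjSymbol {ι : Type*} {m l k j : ℝ} {a : ι → FullPhase n → ℂ}
    (ha : FullSymbolFamily m l k j a) (hsupp : ∀ i, SupportedNearDiagonal (a i)) :
    FullSymbolFamily m l k j (fun i => adjSymbol (a i)) := by
  set U' : Set (FullPhase n) := fullInteriorSet n ∩
    {q | q.1.1 0 * q.2 0 < -1 / 3 ∨ 2 < ‖q.1.1 0 • q.2‖} with hU'
  have hopen : IsOpen U' := by
    have h1 : Continuous fun q : FullPhase n => q.1.1 0 * q.2 0 := by fun_prop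
    have h3 : Continuous fun q : FullPhase n => ‖q.1.1 0 • q.2‖ := by fun_prop
    exact isOpen_fullInteriorSet.inter
      ((isOpen_lt h1 continuous_const).union (isOpen_lt continuous_const h3))
  have hcover : fullInteriorSet n = adjRegion n ∪ U' := by
    refine Set.Subset.antisymm (fun q hq => ?_)
      (Set.union_subset adjRegion_subset Set.inter_subset_left)
    by_cases h : q.1.1 0 * q.2 0 < -1 / 3 ∨ 2 < ‖q.1.1 0 • q.2‖
    · exact Or.inr ⟨hq, h⟩
    · push Not at h
      refine Or.inl ⟨hq, ?_, by linarith [h.2]⟩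
      unfold stretch
      linarith [h.1]
  unfold FullSymbolFamily
  rw [hcover]
  refine Conormal.union ?_ ?_
  · have h1 := ha.comp_adjMap.clm (Complex.conjCLE : ℂ →L[ℝ] ℂ)
    have h2 := ((elliptic_stretch (n := n) ι).rpow (n + 1)).inv.mul
      (elliptic_weight_ratio ι m l k j).inv
    refine (h2.toConormal.smul h1).congr fun i q hq => ?_
    change _ * BBSymbol.adjSymbol (a i) q = _
    rw [adjSymbol_of_mem _ hq]
    have w1 : (weight m l k j q.1 : ℂ) ≠ 0 := by
      exact_mod_cast (weight_pos (p := q.1) (adjRegion_subset hq)).ne'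
    have w2 : (weight m l k j (adjMap q).1 : ℂ) ≠ 0 := by
      exact_mod_cast (weight_pos (p := (adjMap q).1) (adjMap_mem hq)).ne'
    have hs : (stretch q : ℂ) ≠ 0 := by exact_mod_cast (stretch_pos hq).ne'
    have hr : stretch q ^ ((n : ℝ) + 1) = stretch q ^ (n + 1) := by
      rw [← Real.rpow_natCast]; push_cast; rfl
    rw [hr]
    simp only [Complex.real_smul, ContinuousLinearEquiv.coe_coe, Complex.conjCLE_apply, map_mul,
      Complex.conj_ofReal]
    push_cast
    field_simp
  · refine (Conormal.const hopen Set.inter_subset_left (c := fun _ => (0 : ℂ)) ⟨0, by simp⟩).congr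
      fun i q hq => ?_
    change _ * BBSymbol.adjSymbol (a i) q = _
    rw [adjSymbol_eq_zero (hsupp i) hq.2, mul_zero]

/-! ### A family of cut-offs in the fibre variable -/

/-- The regularizing factor `(1 + ε² |ζ|²)^{-1}`. -/
def cutoff (ε : ℝ) (p : Phase n) : ℝ := (1 + ε ^ 2 * ‖p.2‖ ^ 2)⁻¹

theorem cutoff_pos (ε : ℝ) (p : Phase n) : 0 < cutoff ε p := inv_pos.2 (by positivity)

theorem cutoff_le_one (ε : ℝ) (p : Phase n) : cutoff ε p ≤ 1 := by
  refine inv_le_one_of_one_le₀ ?_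
  have : 0 ≤ ε ^ 2 * ‖p.2‖ ^ 2 := by positivity
  linarith

theorem contDiff_cutoff (ε : ℝ) : ContDiff ℝ ∞ (cutoff (n := n) ε) := by
  unfold cutoff
  refine ContDiff.inv (contDiff_const.add (contDiff_const.mul (contDiff_snd.norm_sq ℝ)))
    fun p => ?_
  positivity

/-- The derivative of the cut-off `w` along the frame is `-2 m_i θ_i (1 - (1 - ε²) w) w`, a polynomial
in `w` and in functions smooth on `𝒳₂`. -/
theorem applyField_frameField_cutoff (ε : ℝ) (i : Fin n) (p : Phase n) :
    applyField (frameField (Sum.inr i)) (cutoff ε) p = fibreFactor i p * (-2 * (rho p * p.2 i) *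
      (1 - (1 - ε ^ 2) * cutoff ε p) * cutoff ε p) := by
  have hf : ∀ j, HasDirDeriv (fun q : Phase n => q.2 j)
      (if j = i then fibreFactor i p * (rho p)⁻¹ else 0) p (frameField (Sum.inr i) p) := by
    intro j
    refine (HasDirDeriv.clm (frameCoord (Sum.inr j))).congr_value ?_
    simp [frameField, frameDir, frameCoeff, frameCoord]
  have h1 := HasDirDeriv.sum Finset.univ fun j _ => (hf j).mul (hf j)
  have h2 := (HasDirDeriv.const 1).add ((HasDirDeriv.const (ε ^ 2)).mul h1)
  have h3 : ∀ q : Phase n, 1 + ε ^ 2 * ‖q.2‖ ^ 2 = 1 + ε ^ 2 * ∑ j, q.2 j * q.2 j := fun q => by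
    rw [EuclideanSpace.real_norm_sq_eq]; simp only [sq]
  have hne : 1 + ε ^ 2 * ‖p.2‖ ^ 2 ≠ 0 := by positivity
  have h4 := ((h2.congr_of_mem isOpen_univ trivial fun q _ => h3 q).inv hne).2
  have h5 := (rho_pos p).ne'
  have h6 := rho_sq p
  rw [applyField]
  refine h4.trans ?_
  simp only [ite_mul, mul_ite, zero_mul, mul_zero, Finset.sum_add_distrib, Finset.sum_ite_eq',
    Finset.mem_univ, if_true]
  have h7 : cutoff ε p * (1 + ε ^ 2 * ‖p.2‖ ^ 2) = 1 := inv_mul_cancel₀ hne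
  have h8 : (rho p)⁻¹ = rho p * (1 + ‖p.2‖ ^ 2) := by
    field_simp
    linarith
  rw [div_eq_mul_inv, ← inv_pow]
  change _ * cutoff ε p ^ 2 = _
  rw [h8]
  linear_combination (-2 * fibreFactor i p * rho p * p.2 i * cutoff ε p) * h7

/-- The regularizing factors form a bounded family of symbols of order zero, since their derivatives
along the frame are polynomials in the factors themselves with uniformly bounded coefficients. -/
theorem conormal_cutoff : Conormal (fullInteriorSet n)
    (fun (ε : Set.Icc (0 : ℝ) 1) q => cutoff (n := n) ε q.1) := by
  have hsm : ∀ ε : ℝ, ContDiff ℝ ∞ (fun q : FullPhase n => cutoff (n := n) ε q.1) := fun ε =>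
    (contDiff_cutoff ε).comp contDiff_fst
  refine .of_step isOpen_fullInteriorSet subset_rfl (fun ε => (hsm ε).contDiffOn)
    (fun R => ⟨1, fun ε q _ _ => ?_⟩) fun N hN κ => ?_
  · rw [Real.norm_of_nonneg (cutoff_pos _ _).le]
    exact cutoff_le_one _ _
  have hd : ∀ (ε : ℝ) (q : FullPhase n), DifferentiableAt ℝ (cutoff ε) q.1 := fun ε q =>
    (contDiff_cutoff ε).differentiable (by simp) _
  rcases κ with (i | i) | i
  · refine (DerivBdd.const _ N (c := fun _ : Set.Icc (0 : ℝ) 1 => (0 : ℝ)) ⟨0, by simp⟩).congr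
      isOpen_fullInteriorSet fun ε q _ => ?_
    rw [applyField_inl_comp_fst (hd _ _)]
    have e : cutoff (n := n) (ε : ℝ) = fun q => cutoff (n := n) ε ((0 : E n), q.2) := rfl
    have h3 : HasFDerivAt (fun q : Phase n => ((0 : E n), q.2)) ((0 : Phase n →L[ℝ] E n).prod
      (ContinuousLinearMap.snd ℝ _ _)) q.1 := (hasFDerivAt_const _ _).prodMk hasFDerivAt_snd
    have h2 : HasFDerivAt (fun q : Phase n => cutoff (n := n) (ε : ℝ) ((0 : E n), q.2)) _ q.1 :=
      HasFDerivAt.comp (g := cutoff (ε : ℝ)) q.1 (((contDiff_cutoff (ε : ℝ)).differentiable (by simp)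
        ((0 : E n), q.1.2)).hasFDerivAt) h3
    rw [e, applyField, h2.fderiv]
    simp [frameField, frameDir, Prod.mk_zero_zero]
  · have hc : Conormal (fullInteriorSet n)
        (fun (ε : Set.Icc (0 : ℝ) 1) (_ : FullPhase n) => 1 - (ε : ℝ) ^ 2) := by
      refine .const isOpen_fullInteriorSet subset_rfl ⟨1, fun ε => ?_⟩
      have h1 : (ε : ℝ) ^ 2 ≤ 1 := pow_le_one₀ ε.2.1 ε.2.2
      rw [Real.norm_of_nonneg (by linarith)]
      linarith [sq_nonneg (ε : ℝ)]
    have h1 : Conormal (fullInteriorSet n)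
        (fun (_ : Set.Icc (0 : ℝ) 1) (_ : FullPhase n) => (1 : ℝ)) :=
      .const isOpen_fullInteriorSet subset_rfl ⟨1, by simp⟩
    have hc1 : Conormal (fullInteriorSet n) (fun (_ : Set.Icc (0 : ℝ) 1) (q : FullPhase n) =>
        fibreFactor i q.1 * (-2 * (rho q.1 * q.1.2 i))) :=
      ((SmoothOnX2.fibreFactor i).mul ((SmoothOnX2.const (-2)).mul (.theta i))).conormal _
    -- products of families with `N` bounded derivatives
    have hmul : ∀ {f g : Set.Icc (0 : ℝ) 1 → FullPhase n → ℝ},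
        (∀ ε, ContDiffOn ℝ ∞ (f ε) (fullInteriorSet n)) →
        (∀ ε, ContDiffOn ℝ ∞ (g ε) (fullInteriorSet n)) → DerivBdd (fullInteriorSet n) N f →
        DerivBdd (fullInteriorSet n) N g →
        DerivBdd (fullInteriorSet n) N (fun ε q => f ε q * g ε q) := fun hf hg h h' =>
      DerivBdd.bilin isOpen_fullInteriorSet (ContinuousLinearMap.mul ℝ ℝ) subset_rfl hf hg h h'
    have s0 : ∀ ε : Set.Icc (0 : ℝ) 1, ContDiffOn ℝ ∞
      (fun q : FullPhase n => cutoff (n := n) ε q.1) (fullInteriorSet n) :=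
      fun ε => (hsm ε).contDiffOn
    have t1 := hmul hc.smooth s0 (hc.bdd N) hN
    have s1 := fun ε => (hc.smooth ε).mul (s0 ε)
    have t2 := (t1.clm isOpen_fullInteriorSet (-ContinuousLinearMap.id ℝ ℝ) subset_rfl s1)
    have s2 := fun ε => ((-ContinuousLinearMap.id ℝ ℝ).contDiff (n := ∞)).comp_contDiffOn (s1 ε)
    have t3 := (h1.bdd N).add isOpen_fullInteriorSet subset_rfl h1.smooth s2 t2
    have s3 := fun ε => (h1.smooth ε).add (s2 ε)
    have t4 := hmul (fun ε => (hc1.smooth ε).mul (s3 ε)) s0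
      (hmul hc1.smooth s3 (hc1.bdd N) t3) hN
    refine t4.congr isOpen_fullInteriorSet fun ε q _ => ?_
    rw [applyField_inl_comp_fst (hd _ _), applyField_frameField_cutoff]
    simp only [Function.comp_apply, neg_apply, ContinuousLinearMap.id_apply]
    ring
  · exact (DerivBdd.const _ N (c := fun _ : Set.Icc (0 : ℝ) 1 => (0 : ℝ)) ⟨0, by simp⟩).congr
      isOpen_fullInteriorSet fun ε q _ => applyField_inr_comp_fst (hd _ _) i

/-! ### Decay of the oscillatory integrals -/

/-- The region `|(xX, xY)| < 3`. -/
def nearRegion (n : ℕ) [NeZero n] : Set (FullPhase n) := {q | 0 < q.1.1 0 ∧ ‖q.1.1 0 • q.2‖ < 3}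

theorem isOpen_nearRegion : IsOpen (nearRegion n) := by
  have h1 : Continuous fun q : FullPhase n => q.1.1 0 := by fun_prop
  have h3 : Continuous fun q : FullPhase n => ‖q.1.1 0 • q.2‖ := by fun_prop
  exact (isOpen_lt continuous_const h1).inter (isOpen_lt h3 continuous_const)

theorem nearRegion_subset : nearRegion n ⊆ fullInteriorSet n := fun _ hq => hq.1

theorem contDiff_scatShift : ContDiff ℝ ∞ (fun q : FullPhase n => scatShift q.1.1 q.2) := by
  rw [contDiff_euclidean]
  intro i
  by_cases hi : i = 0
  · simp only [scatShift, hi, if_true]; fun_prop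
  · simp only [scatShift, hi, if_false]; fun_prop

theorem conormal_scatShift_apply (ι : Type*) (i : Fin n) :
    Conormal (nearRegion n) (fun (_ : ι) q => scatShift q.1.1 q.2 i) := by
  have hb := fun j => ((SmoothOnX2.base (n := n) j).conormal ι).mono isOpen_nearRegion
    nearRegion_subset
  have hT := conormal_scaled ι (isOpen_nearRegion (n := n)) nearRegion_subset
    (fun _ hq => hq.2.le)
  by_cases hi : i = 0
  · refine ((hb 0).add ((hb 0).mul (hT 0))).congr fun _ q _ => ?_
    simp only [scatShift, hi, if_true]
    ring
  · refine ((hb i).add (hT i)).congr fun _ q _ => ?_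
    simp only [scatShift, hi, if_false]

/-- Test functions evaluated at `(x + x² X, y + xY)` are conormal where `(xX, xY)` is bounded. -/
theorem conormal_comp_scatShift (ι : Type*) {u : E n → ℂ} (hu : ContDiff ℝ ∞ u)
    (hc : HasCompactSupport u) :
    Conormal (nearRegion n) (fun (_ : ι) q => u (scatShift q.1.1 q.2)) := by
  have h0 : ∀ {u : E n → ℂ}, ContDiff ℝ ∞ u → HasCompactSupport u →
      BddOverBase (nearRegion n) (fun (_ : ι) q => u (scatShift q.1.1 q.2)) := fun hu hc R => by
    obtain ⟨C, hC⟩ := hu.continuous.bounded_above_of_compact_support hc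
    exact ⟨C, fun _ q _ _ => hC _⟩
  have hs : ∀ {u : E n → ℂ}, ContDiff ℝ ∞ u →
      ContDiffOn ℝ ∞ (fun q : FullPhase n => u (scatShift q.1.1 q.2)) (nearRegion n) := fun hu =>
    (hu.comp contDiff_scatShift).contDiffOn
  refine ⟨isOpen_nearRegion, nearRegion_subset, fun _ => hs hu, fun N => ?_⟩
  induction N generalizing u with
  | zero => exact h0 hu hc
  | succ N ih =>
    refine ⟨h0 hu hc, fun κ => ?_⟩
    have hΦ := fun i => (conormal_scatShift_apply (n := n) ι i).field κ
    have du : ∀ i, ContDiff ℝ ∞ (fun z => fderiv ℝ u z (EuclideanSpace.single i 1)) := fun i =>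
      (hu.fderiv_right (m := ∞) (by simp)).clm_apply contDiff_const
    have dc : ∀ i, HasCompactSupport (fun z => fderiv ℝ u z (EuclideanSpace.single i 1)) := fun i =>
      hc.fderiv_apply ℝ _
    refine (DerivBdd.sum Finset.univ isOpen_nearRegion nearRegion_subset
      (fun i k => ((hΦ i).smooth k).smul (hs (du i))) fun i =>
      ((hΦ i).bdd N).bilin isOpen_nearRegion (ContinuousLinearMap.lsmul ℝ ℝ) nearRegion_subset
        (hΦ i).smooth (fun _ => hs (du i)) (ih (du i) (dc i))).congr isOpen_nearRegion
      fun i q hq => ?_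
    have d : DifferentiableAt ℝ (fun q : FullPhase n => scatShift q.1.1 q.2) q :=
      contDiff_scatShift.differentiable (by simp) q
    have d' : DifferentiableAt ℝ u (scatShift q.1.1 q.2) := hu.differentiable (by simp) _
    have e1 : fderiv ℝ (fun q : FullPhase n => u (scatShift q.1.1 q.2)) q = _ :=
      (HasFDerivAt.comp (g := u) q d'.hasFDerivAt d.hasFDerivAt).fderiv
    rw [applyField, e1, ContinuousLinearMap.comp_apply, ← sum_smul_single
      (fderiv ℝ (fun q : FullPhase n => scatShift q.1.1 q.2) q (fullField κ q)), map_sum]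
    refine Finset.sum_congr rfl fun j _ => ?_
    have e2 : applyField (fullField κ) (fun q : FullPhase n => scatShift q.1.1 q.2 j) q =
        (fderiv ℝ (fun q : FullPhase n => scatShift q.1.1 q.2) q (fullField κ q)) j := by
      have : fderiv ℝ (fun q : FullPhase n => scatShift q.1.1 q.2 j) q = _ :=
        ((EuclideanSpace.proj j : E n →L[ℝ] ℝ).hasFDerivAt.comp q d.hasFDerivAt).fderiv
      rw [applyField, this, ContinuousLinearMap.comp_apply]
      rfl
    rw [map_smul, ← e2]
    rfl

/-- The oscillating factor `e^{i ζ·Z}`. -/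
def osc (ζ Z : E n) : ℂ := Complex.exp (Complex.I * ((∑ i, ζ i * Z i : ℝ) : ℂ))

theorem norm_osc (ζ Z : E n) : ‖osc ζ Z‖ = 1 := by
  rw [osc, mul_comm, Complex.norm_exp_ofReal_mul_I]

theorem continuous_osc : Continuous fun p : E n × E n => osc p.1 p.2 := by
  unfold osc
  fun_prop

theorem hasFDerivAt_osc (ζ Z : E n) (i : Fin n) : DifferentiableAt ℝ (osc ζ) Z ∧
    fderiv ℝ (osc ζ) Z (EuclideanSpace.single i 1) = Complex.I * ζ i * osc ζ Z := by
  have h1 : HasFDerivAt (fun Z : E n => ∑ i, ζ i * Z i)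
      (∑ i, ζ i • (EuclideanSpace.proj i : E n →L[ℝ] ℝ)) Z :=
    HasFDerivAt.fun_sum fun i _ => ((EuclideanSpace.proj i : E n →L[ℝ] ℝ).hasFDerivAt).const_mul _
  have h2 := (((Complex.ofRealCLM.hasFDerivAt (x := ∑ i, ζ i * Z i)).comp Z h1).const_mul
    Complex.I).cexp
  have h3 : HasFDerivAt (osc ζ) _ Z := h2
  refine ⟨h3.differentiableAt, ?_⟩
  rw [h3.fderiv]
  simp [osc]
  ring

/-- Integration by parts in one of the variables `Z_i`. -/
theorem integral_osc_fderiv {g : E n → ℂ} (hg : ContDiff ℝ ∞ g) (hc : HasCompactSupport g)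
    (ζ : E n) (i : Fin n) : ∫ Z, osc ζ Z * fderiv ℝ g Z (EuclideanSpace.single i 1) =
      -(Complex.I * ζ i) * ∫ Z, osc ζ Z * g Z := by
  have co : Continuous (osc ζ) := continuous_osc.comp (Continuous.prodMk_right ζ)
  have hd : Continuous fun Z => fderiv ℝ g Z (EuclideanSpace.single i 1) :=
    (hg.continuous_fderiv (by simp)).clm_apply continuous_const
  have hdc : HasCompactSupport fun Z => fderiv ℝ g Z (EuclideanSpace.single i 1) :=
    hc.fderiv_apply ℝ _
  rw [integral_mul_fderiv_eq_neg_fderiv_mul_of_integrable, ← integral_const_mul, ← integral_neg]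
  · congr 1 with Z
    rw [(hasFDerivAt_osc ζ Z i).2]
    ring
  · have : (fun Z => fderiv ℝ (osc ζ) Z (EuclideanSpace.single i 1) * g Z) =
        fun Z => Complex.I * ζ i * osc ζ Z * g Z := funext fun Z => by
      rw [(hasFDerivAt_osc ζ Z i).2]
    rw [this]
    exact ((continuous_const.mul co).mul hg.continuous).integrable_of_hasCompactSupport
      hc.mul_left
  · exact (co.mul hd).integrable_of_hasCompactSupport hdc.mul_left
  · exact (co.mul hg.continuous).integrable_of_hasCompactSupport hc.mul_left
  · exact fun Z _ => (hasFDerivAt_osc ζ Z i).1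
  · exact fun Z _ => hg.differentiable (by simp) Z

/-- Functions that vanish where `|(xX, xY)| > 2`. -/
def NearSupported (a : FullPhase n → ℂ) : Prop :=
  ∀ q ∈ fullInteriorSet n, 2 < ‖q.1.1 0 • q.2‖ → a q = 0

theorem NearSupported.eq_zero {a : FullPhase n → ℂ} (ha : NearSupported a) {z ζ Z : E n}
    (hz : 0 < z 0) (hZ : Z ∉ Metric.closedBall (0 : E n) (2 / z 0)) : a ((z, ζ), Z) = 0 := by
  refine ha _ hz ?_
  rw [mem_closedBall_zero_iff, not_le, div_lt_iff₀ hz] at hZ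
  simp only [norm_smul, Real.norm_of_nonneg hz.le]
  linarith

theorem NearSupported.hasCompactSupport {a : FullPhase n → ℂ} (ha : NearSupported a) {z : E n}
    (ζ : E n) (hz : 0 < z 0) : HasCompactSupport fun Z => a ((z, ζ), Z) :=
  HasCompactSupport.intro (isCompact_closedBall 0 (2 / z 0)) fun _ hZ => ha.eq_zero hz hZ

theorem contDiff_slice {G : FullPhase n → ℂ} (hG : ContDiffOn ℝ ∞ G (fullInteriorSet n)) {z : E n}
    (ζ : E n) (hz : 0 < z 0) : ContDiff ℝ ∞ fun Z => G ((z, ζ), Z) := by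
  rw [← contDiffOn_univ]
  exact hG.comp (contDiff_const.prodMk contDiff_id).contDiffOn fun Z _ => hz

theorem fderiv_slice {G : FullPhase n → ℂ} (hG : ContDiffOn ℝ ∞ G (fullInteriorSet n)) {z : E n}
    (ζ Z : E n) (hz : 0 < z 0) (i : Fin n) :
    fderiv ℝ (fun Z => G ((z, ζ), Z)) Z (EuclideanSpace.single i 1) =
      (z 0 : ℂ) * applyField (fullField (Sum.inr i)) G ((z, ζ), Z) := by
  have d : DifferentiableAt ℝ G ((z, ζ), Z) := (hG.contDiffAt (isOpen_fullInteriorSet.mem_nhds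
    (show ((z, ζ), Z) ∈ fullInteriorSet n from hz))).differentiableAt (by simp)
  have e := (d.hasFDerivAt.comp Z ((hasFDerivAt_const (z, ζ) Z).prodMk (hasFDerivAt_id Z))).fderiv
  have e' : fderiv ℝ (fun Z => G ((z, ζ), Z)) Z = _ := e
  rw [e', ContinuousLinearMap.comp_apply, applyField, fullField, map_smul]
  simp only [fullCoeff, fullDir, Complex.real_smul, ← mul_assoc]
  have hz' : (z 0 : ℂ) ≠ 0 := by exact_mod_cast hz.ne'
  push_cast
  rw [mul_inv_cancel₀ hz', one_mul]
  rfl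

theorem NearSupported.applyField {G : FullPhase n → ℂ} (hG : NearSupported G) (κ : FrameIndex n) :
    NearSupported (applyField (fullField κ) G) := by
  intro q hq h
  have hopen : IsOpen (fullInteriorSet n ∩ {q | 2 < ‖q.1.1 0 • q.2‖}) :=
    isOpen_fullInteriorSet.inter (isOpen_lt continuous_const (by fun_prop))
  have h0 : G =ᶠ[nhds q] fun _ => 0 :=
    Filter.eventually_of_mem (hopen.mem_nhds ⟨hq, h⟩) fun q hq => hG q hq.1 hq.2
  rw [BBSymbol.applyField, h0.fderiv_eq]
  simp

/-- Repeated integration by parts: the integral decays as fast as derivatives are bounded. -/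
theorem pow_mul_norm_integral_osc_le {G : FullPhase n → ℂ}
    (hG : ContDiffOn ℝ ∞ G (fullInteriorSet n)) (hs : NearSupported G) {z : E n} (ζ : E n)
    (hz : 0 < z 0) (i : Fin n) (K : ℕ) {B : ℝ}
    (hB : ∀ Z, ‖z 0 • Z‖ < 3 → ‖(applyField (fullField (Sum.inr i)))^[K] G ((z, ζ), Z)‖ ≤ B) :
    |ζ i| ^ K * ‖∫ Z, osc ζ Z * G ((z, ζ), Z)‖ ≤
      z 0 ^ K * (B * volume.real (Metric.closedBall (0 : E n) (2 / z 0))) := by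
  induction K generalizing G with
  | zero =>
    simp only [pow_zero, one_mul]
    rw [← setIntegral_eq_integral_of_forall_compl_eq_zero
      (s := Metric.closedBall (0 : E n) (2 / z 0))]
    · refine norm_setIntegral_le_of_norm_le_const measure_closedBall_lt_top fun Z hZ => ?_
      rw [norm_mul, norm_osc, one_mul]
      refine hB Z ?_
      rw [mem_closedBall_zero_iff, le_div_iff₀ hz] at hZ
      rw [norm_smul, Real.norm_of_nonneg hz.le]
      linarith
    · intro Z hZ
      rw [hs.eq_zero hz hZ, mul_zero]
  | succ K ih =>
    have ih := ih (contDiffOn_applyField isOpen_fullInteriorSet subset_rfl hG (Sum.inr i))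
      (hs.applyField (Sum.inr i)) hB
    have h1 := integral_osc_fderiv (contDiff_slice hG ζ hz) (hs.hasCompactSupport ζ hz) ζ i
    simp only [fderiv_slice hG ζ _ hz] at h1
    simp only [mul_left_comm (osc ζ _) (z 0 : ℂ)] at h1
    rw [integral_const_mul] at h1
    have h2 := congrArg norm h1
    rw [norm_mul, norm_mul, norm_neg, norm_mul, Complex.norm_I, one_mul, Complex.norm_real,
      Complex.norm_real, Real.norm_of_nonneg hz.le, Real.norm_eq_abs] at h2
    rw [pow_succ, mul_assoc, ← h2, pow_succ, mul_left_comm, mul_comm (z 0 ^ K), mul_assoc]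
    exact mul_le_mul_of_nonneg_left ih hz.le

theorem rpow_le_add {lo t hi : ℝ} (h0 : 0 < lo) (h1 : lo ≤ t) (h2 : t ≤ hi) (α : ℝ) :
    t ^ α ≤ lo ^ α + hi ^ α := by
  have ht := h0.trans_le h1
  rcases le_total 0 α with hα | hα
  · linarith [Real.rpow_le_rpow ht.le h2 hα, Real.rpow_nonneg h0.le α]
  · linarith [Real.rpow_le_rpow_of_nonpos h0 h1 hα, Real.rpow_nonneg (ht.le.trans h2) α]

/-- `1 + |ζ|²`. -/
def japSq (ζ : E n) : ℝ := 1 + ‖ζ‖ ^ 2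

theorem one_le_japSq (ζ : E n) : 1 ≤ japSq ζ := by
  unfold japSq; nlinarith [sq_nonneg ‖ζ‖]

theorem japSq_pos (ζ : E n) : 0 < japSq ζ := one_pos.trans_le (one_le_japSq ζ)

theorem rho_rpow_le (p : Phase n) (α : ℝ) : rho p ^ α ≤ japSq p.2 ^ ⌈|α|⌉₊ := by
  have h0 := rho_pos p
  have h1 : (rho p)⁻¹ ≤ japSq p.2 := by
    rw [rho, inv_inv]
    exact Real.sqrt_le_iff.2 ⟨(japSq_pos _).le, by
      nlinarith [one_le_japSq p.2, show japSq p.2 = 1 + ‖p.2‖ ^ 2 from rfl]⟩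
  calc rho p ^ α ≤ rho p ^ (-|α|) :=
        Real.rpow_le_rpow_of_exponent_ge h0 (rho_le_one p) (neg_abs_le α)
    _ = (rho p)⁻¹ ^ |α| := by rw [Real.rpow_neg h0.le, Real.inv_rpow h0.le]
    _ ≤ japSq p.2 ^ |α| := Real.rpow_le_rpow (inv_pos.2 h0).le h1 (abs_nonneg α)
    _ ≤ japSq p.2 ^ (⌈|α|⌉₊ : ℝ) :=
        Real.rpow_le_rpow_of_exponent_le (one_le_japSq _) (Nat.le_ceil _)
    _ = _ := Real.rpow_natCast _ _

/-- Over compact subsets of the interior of the base, the weights are of polynomial size. -/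
theorem weight_le (m l k j : ℝ) : ∃ M : ℕ, ∀ r R : ℝ, 0 < r → ∃ C : ℝ, 0 ≤ C ∧ ∀ p : Phase n,
    r ≤ p.1 0 → ‖p.1‖ ≤ R → weight m l k j p ≤ C * japSq p.2 ^ M := by
  refine ⟨⌈|m|⌉₊ + ⌈|k|⌉₊, fun r R hr => ?_⟩
  refine ⟨(r ^ l + |R| ^ l) * (1 + 2 ^ k) * (Real.sqrt r ^ j + (|R| + 3) ^ j), by positivity, ?_⟩
  intro p hp hR
  have hx : 0 < p.1 0 := hr.trans_le hp
  have hp' : p ∈ interiorSet n := hx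
  have hR' : ‖p.1‖ ≤ |R| := hR.trans (le_abs_self R)
  have h1 := rho_rpow_le p m
  have h2 : p.1 0 ^ l ≤ r ^ l + |R| ^ l :=
    rpow_le_add hr hp (((le_abs_self _).trans (PiLp.norm_apply_le p.1 0)).trans hR') l
  have hone : 1 ≤ japSq p.2 ^ ⌈|k|⌉₊ := one_le_pow₀ (one_le_japSq _)
  have h3 : dSigma p ^ k ≤ (1 + 2 ^ k) * japSq p.2 ^ ⌈|k|⌉₊ := by
    have e1 : rho p ≤ dSigma p := by
      refine le_of_sq_le_sq ?_ (dSigma_pos p).le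
      rw [dSigma_sq]
      nlinarith [rho_pos p, rho_le_one p, sq_nonneg ‖tau p‖]
    have e2 : dSigma p ≤ 2 := by nlinarith [dSigma_sq_le_two p, dSigma_pos p]
    have e3 := rpow_le_add (rho_pos p) e1 e2 k
    have e4 := rho_rpow_le p k
    have e5 : (0 : ℝ) ≤ 2 ^ k := by positivity
    nlinarith
  have h4 : dGamma p ^ j ≤ Real.sqrt r ^ j + (|R| + 3) ^ j := by
    have e0 := dGamma_sq hp'
    have e1 : Real.sqrt r ≤ dGamma p := by
      refine Real.sqrt_le_iff.2 ⟨(dGamma_pos hp').le, ?_⟩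
      rw [e0]
      nlinarith [sq_nonneg (dSigma p), sq_nonneg ‖tauTilde p‖]
    have e2 : dGamma p ≤ |R| + 3 := by
      have := dGamma_sq_le hp' hR'
      nlinarith [dGamma_pos hp', abs_nonneg R]
    exact rpow_le_add (Real.sqrt_pos.2 hr) e1 e2 j
  have p1 := Real.rpow_nonneg (rho_pos p).le m
  have p2 := Real.rpow_nonneg hx.le l
  have p3 := Real.rpow_nonneg (dSigma_pos p).le k
  have p4 := Real.rpow_nonneg (dGamma_pos hp').le j
  have p5 := (japSq_pos p.2).le
  calc weight m l k j p = rho p ^ m * p.1 0 ^ l * dSigma p ^ k * dGamma p ^ j := rfl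
    _ ≤ japSq p.2 ^ ⌈|m|⌉₊ * (r ^ l + |R| ^ l) * ((1 + 2 ^ k) * japSq p.2 ^ ⌈|k|⌉₊) *
        (Real.sqrt r ^ j + (|R| + 3) ^ j) := by gcongr
    _ = _ := by rw [pow_add]; ring

theorem weight_neg {m l k j : ℝ} {p : Phase n} (hp : p ∈ interiorSet n) :
    weight (-m) (-l) (-k) (-j) p = (weight m l k j p)⁻¹ := by
  unfold weight
  rw [Real.rpow_neg (rho_pos p).le, Real.rpow_neg (le_of_lt hp), Real.rpow_neg (dSigma_pos p).le,
    Real.rpow_neg (dGamma_pos hp).le, mul_inv, mul_inv, mul_inv]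

/-- Powers of `1 + |ζ|²` are controlled by powers of the largest coordinate. -/
theorem japSq_pow_le (ζ : E n) (K : ℕ) : ∃ i, japSq ζ ^ K ≤ (2 * n) ^ K * (1 + |ζ i| ^ (2 * K)) := by
  obtain ⟨i, -, hi⟩ := Finset.exists_max_image Finset.univ (fun i => ζ i ^ 2)
    ⟨(0 : Fin n), Finset.mem_univ _⟩
  refine ⟨i, ?_⟩
  have h1 : ‖ζ‖ ^ 2 ≤ n * ζ i ^ 2 := by
    rw [EuclideanSpace.real_norm_sq_eq]
    refine (Finset.sum_le_sum fun j _ => hi j (Finset.mem_univ j)).trans_eq ?_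
    simp
  have hn : (1 : ℝ) ≤ n := by exact_mod_cast NeZero.one_le
  have h2 : japSq ζ ≤ n * (1 + ζ i ^ 2) := by unfold japSq; linarith
  have h3 : (1 + ζ i ^ 2) ^ K ≤ 2 ^ K * (1 + (ζ i ^ 2) ^ K) := by
    have hz := sq_nonneg (ζ i)
    rcases le_total (ζ i ^ 2) 1 with h | h
    · calc (1 + ζ i ^ 2) ^ K ≤ 2 ^ K := pow_le_pow_left₀ (by positivity) (by linarith) K
        _ ≤ 2 ^ K * (1 + (ζ i ^ 2) ^ K) :=
          le_mul_of_one_le_right (by positivity) (by linarith [pow_nonneg hz K])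
    · calc (1 + ζ i ^ 2) ^ K ≤ (2 * ζ i ^ 2) ^ K := pow_le_pow_left₀ (by positivity) (by linarith) K
        _ = 2 ^ K * (ζ i ^ 2) ^ K := mul_pow _ _ _
        _ ≤ 2 ^ K * (1 + (ζ i ^ 2) ^ K) := by gcongr; linarith
  calc japSq ζ ^ K ≤ (n * (1 + ζ i ^ 2)) ^ K := pow_le_pow_left₀ (japSq_pos ζ).le h2 K
    _ = n ^ K * (1 + ζ i ^ 2) ^ K := mul_pow _ _ _
    _ ≤ n ^ K * (2 ^ K * (1 + (ζ i ^ 2) ^ K)) := by gcongr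
    _ = _ := by rw [mul_pow, pow_mul, sq_abs]; ring

theorem quantIntegrand_eq (a : FullPhase n → ℂ) (u : E n → ℂ) (z ζ Z : E n) :
    quantIntegrand a u z ζ Z = osc ζ Z * a ((z, ζ), Z) * u (scatShift z Z) := rfl

section Decay

variable {ι : Type*} {m l k j : ℝ} {a : ι → FullPhase n → ℂ} {u : E n → ℂ}

theorem FullSymbolFamily.contDiffOn (ha : FullSymbolFamily m l k j a) (i : ι) :
    ContDiffOn ℝ ∞ (a i) (fullInteriorSet n) := by
  have hw : ContDiffOn ℝ ∞ (fun q : FullPhase n => weight (-m) (-l) (-k) (-j) q.1)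
      (fullInteriorSet n) := by
    have h1 : ContDiffOn ℝ ∞ (fun p : Phase n => weight (-m) (-l) (-k) (-j) p) (interiorSet n) := by
      unfold weight
      have hx : ContDiffOn ℝ ∞ (fun p : Phase n => p.1 0) (interiorSet n) := by fun_prop
      exact (((contDiff_rho.contDiffOn.rpow_const_of_ne fun p _ => (rho_pos p).ne').mul
        (hx.rpow_const_of_ne fun p hp => ne_of_gt hp)).mul
        (contDiff_dSigma.contDiffOn.rpow_const_of_ne fun p _ => (dSigma_pos p).ne')).mul
        (contDiffOn_dGamma.rpow_const_of_ne fun p hp => (dGamma_pos hp).ne')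
    exact h1.comp (contDiff_fst (E := Phase n) (F := E n)).contDiffOn fun q hq => hq
  refine (hw.smul (ha.smooth i)).congr fun q hq => ?_
  have h := (weight_pos (m := m) (l := l) (k := k) (j := j) (p := q.1) hq).ne'
  have h' : (weight m l k j q.1 : ℂ) ≠ 0 := by exact_mod_cast h
  simp only [Pi.smul_apply', Complex.real_smul]
  rw [weight_neg (p := q.1) hq]
  push_cast
  rw [inv_mul_cancel_left₀ h']

/-- Over compact subsets of the interior of the base, full symbols are polynomially bounded. -/
theorem FullSymbolFamily.norm_le (ha : FullSymbolFamily m l k j a) : ∃ M : ℕ, ∀ r R : ℝ, 0 < r →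
    ∃ C : ℝ, 0 ≤ C ∧ ∀ i, ∀ z ζ Z : E n, r ≤ z 0 → ‖z‖ ≤ R →
      ‖a i ((z, ζ), Z)‖ ≤ C * japSq ζ ^ M := by
  obtain ⟨M, hM⟩ := weight_le (n := n) (-m) (-l) (-k) (-j)
  refine ⟨M, fun r R hr => ?_⟩
  obtain ⟨C, hC0, hC⟩ := hM r R hr
  obtain ⟨D, hD⟩ := ha.bdd 0 R
  refine ⟨C * |D|, by positivity, fun i z ζ Z hz hR => ?_⟩
  have hp : ((z, ζ) : Phase n) ∈ interiorSet n := hr.trans_le hz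
  have h1 := hD i ((z, ζ), Z) hp hR
  have h2 := hC (z, ζ) hz hR
  have h3 := weight_pos (m := m) (l := l) (k := k) (j := j) hp
  rw [weight_neg hp] at h2
  simp only [norm_mul, Complex.norm_real, Real.norm_of_nonneg h3.le] at h1
  have h4 : ‖a i ((z, ζ), Z)‖ ≤ (weight m l k j (z, ζ))⁻¹ * |D| := by
    rw [← div_eq_inv_mul, le_div_iff₀ h3, mul_comm]
    exact h1.trans (le_abs_self D)
  calc _ ≤ _ := h4
    _ ≤ (C * japSq ζ ^ M) * |D| := mul_le_mul_of_nonneg_right h2 (abs_nonneg D)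
    _ = _ := by ring

/-- The inner integral of the quantization decays rapidly in the fibre variable, uniformly over compact
subsets of the interior of the base and over the family. -/
theorem FullSymbolFamily.decay (ha : FullSymbolFamily m l k j a) (hs : ∀ i, NearSupported (a i))
    (hu : ContDiff ℝ ∞ u) (hc : HasCompactSupport u) {r R : ℝ} (hr : 0 < r) (N : ℕ) :
    ∃ C : ℝ, 0 ≤ C ∧ ∀ i, ∀ z ζ : E n, r ≤ z 0 → ‖z‖ ≤ R →
      ‖∫ Z, quantIntegrand (a i) u z ζ Z‖ ≤ C * (japSq ζ ^ N)⁻¹ := by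
  set G : ι → FullPhase n → ℂ := fun i q =>
    (weight m l k j q.1 : ℂ) * a i q * u (scatShift q.1.1 q.2) with hGdef
  have hG : Conormal (nearRegion n) G :=
    (ha.mono isOpen_nearRegion nearRegion_subset).mul (conormal_comp_scatShift ι hu hc)
  have hGs : ∀ i, ContDiffOn ℝ ∞ (G i) (fullInteriorSet n) := fun i =>
    (ha.smooth i).mul (hu.comp contDiff_scatShift).contDiffOn
  have hG0 : ∀ i, NearSupported (G i) := fun i q hq h => by
    simp only [hGdef, hs i q hq h, mul_zero, zero_mul]
  obtain ⟨M, hM⟩ := weight_le (n := n) (-m) (-l) (-k) (-j)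
  obtain ⟨W, hW0, hW⟩ := hM r R hr
  -- bounds for all derivatives, and the resulting bounds of the integral
  have hiter : ∀ (i' : Fin n) (K : ℕ), Conormal (nearRegion n)
      (fun i => (applyField (fullField (Sum.inr i')))^[K] (G i)) := by
    intro i' K
    induction K with
    | zero => exact hG
    | succ K ih =>
      simp only [Function.iterate_succ_apply']
      exact ih.field _
  have hest : ∀ (i' : Fin n) (K : ℕ), ∃ C, 0 ≤ C ∧ ∀ i, ∀ z ζ : E n, r ≤ z 0 → ‖z‖ ≤ R →
      |ζ i'| ^ K * ‖∫ Z, osc ζ Z * G i ((z, ζ), Z)‖ ≤ C := by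
    intro i' K
    obtain ⟨B, hB⟩ := (hiter i' K).bdd 0 R
    refine ⟨|R| ^ K * (|B| * volume.real (Metric.closedBall (0 : E n) (2 / r))), by positivity, ?_⟩
    intro i z ζ hz hR
    have hz0 : 0 < z 0 := hr.trans_le hz
    refine (pow_mul_norm_integral_osc_le (hGs i) (hG0 i) ζ hz0 i' K (B := |B|) fun Z hZ =>
      (hB i ((z, ζ), Z) ⟨hz0, hZ⟩ hR).trans (le_abs_self B)).trans ?_
    have e1 : z 0 ≤ |R| := ((le_abs_self _).trans (PiLp.norm_apply_le z 0)).trans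
      (hR.trans (le_abs_self R))
    have e2 : volume.real (Metric.closedBall (0 : E n) (2 / z 0)) ≤
        volume.real (Metric.closedBall (0 : E n) (2 / r)) :=
      measureReal_mono (Metric.closedBall_subset_closedBall (by gcongr))
        measure_closedBall_lt_top.ne
    gcongr
  choose C hC0 hC using hest
  set D : ℝ := C 0 0 + ∑ i', C i' (2 * (N + M)) with hD
  have hsum : ∀ i', C i' (2 * (N + M)) ≤ ∑ i', C i' (2 * (N + M)) := fun i' =>
    Finset.single_le_sum (f := fun i' => C i' (2 * (N + M))) (fun i' _ => hC0 i' _)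
      (Finset.mem_univ i')
  have hD0 : 0 ≤ D := add_nonneg (hC0 _ _) (Finset.sum_nonneg fun i' _ => hC0 _ _)
  refine ⟨W * ((2 * n) ^ (N + M) * D), by positivity, fun i z ζ hz hR => ?_⟩
  have hp : ((z, ζ) : Phase n) ∈ interiorSet n := hr.trans_le hz
  have hJ := japSq_pos ζ
  have h1 : ∫ Z, quantIntegrand (a i) u z ζ Z =
      ((weight (-m) (-l) (-k) (-j) (z, ζ) : ℝ) : ℂ) * ∫ Z, osc ζ Z * G i ((z, ζ), Z) := by
    rw [← integral_const_mul]
    congr 1 with Z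
    have h' : (weight m l k j (z, ζ) : ℂ) ≠ 0 := by exact_mod_cast (weight_pos hp).ne'
    rw [quantIntegrand_eq, weight_neg hp]
    simp only [hGdef]
    push_cast
    field_simp
  have h2 : japSq ζ ^ (N + M) * ‖∫ Z, osc ζ Z * G i ((z, ζ), Z)‖ ≤ (2 * n) ^ (N + M) * D := by
    obtain ⟨i', hi'⟩ := japSq_pow_le ζ (N + M)
    have e1 := hC 0 0 i z ζ hz hR
    have e2 := hC i' (2 * (N + M)) i z ζ hz hR
    rw [pow_zero, one_mul] at e1
    calc _ ≤ ((2 * n) ^ (N + M) * (1 + |ζ i'| ^ (2 * (N + M)))) *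
          ‖∫ Z, osc ζ Z * G i ((z, ζ), Z)‖ := mul_le_mul_of_nonneg_right hi' (norm_nonneg _)
      _ = (2 * n) ^ (N + M) * (‖∫ Z, osc ζ Z * G i ((z, ζ), Z)‖ + |ζ i'| ^ (2 * (N + M)) *
          ‖∫ Z, osc ζ Z * G i ((z, ζ), Z)‖) := by ring
      _ ≤ _ := by
        refine mul_le_mul_of_nonneg_left ?_ (by positivity)
        linarith [hsum i']
  have h3 := hW (z, ζ) hz hR
  have h4 : 0 < weight (-m) (-l) (-k) (-j) (z, ζ) := weight_pos hp
  rw [h1, norm_mul, Complex.norm_real, Real.norm_of_nonneg h4.le, ← div_eq_mul_inv,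
    le_div_iff₀ (by positivity)]
  calc _ ≤ (W * japSq ζ ^ M) * ‖∫ Z, osc ζ Z * G i ((z, ζ), Z)‖ * japSq ζ ^ N := by gcongr
    _ = W * (japSq ζ ^ (N + M) * ‖∫ Z, osc ζ Z * G i ((z, ζ), Z)‖) := by rw [pow_add]; ring
    _ ≤ _ := by gcongr

end Decay

/-! ### Measurability -/

open Filter Topology

theorem integrable_japSq : Integrable (fun ζ : E n => (japSq ζ ^ n)⁻¹) := by
  have h := integrable_rpow_neg_one_add_norm_sq (E := E n) (μ := volume) (r := 2 * n) (by
    have : 0 < n := NeZero.pos n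
    rw [finrank_euclideanSpace_fin]
    exact_mod_cast (by omega : n < 2 * n))
  refine h.congr (Eventually.of_forall fun ζ => ?_)
  simp only [japSq]
  rw [show (-(2 * (n : ℝ)) / 2) = -(n : ℝ) by ring, Real.rpow_neg (by positivity),
    Real.rpow_natCast]

theorem SupportedNearDiagonal.nearSupported {a : FullPhase n → ℂ} (ha : SupportedNearDiagonal a) :
    NearSupported a := fun q hq h => ha q hq (by linarith)

theorem measurable_indicator_fullInteriorSet {a : FullPhase n → ℂ}
    (ha : ContinuousOn a (fullInteriorSet n)) : Measurable ((fullInteriorSet n).indicator a) := by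
  classical
  rw [← Set.piecewise_eq_indicator]
  exact ha.measurable_piecewise continuousOn_const isOpen_fullInteriorSet.measurableSet

/-- Nothing is known of a symbol at `x ≤ 0`; its extension by zero from `x > 0` is measurable and defines
the same operator. -/
theorem quantIntegrand_indicator (a : FullPhase n → ℂ) (u : E n → ℂ) {z : E n} (hz : 0 < z 0)
    (ζ Z : E n) : quantIntegrand ((fullInteriorSet n).indicator a) u z ζ Z =
      quantIntegrand a u z ζ Z := by
  have : ((z, ζ), Z) ∈ fullInteriorSet n := hz
  rw [quantIntegrand_eq, quantIntegrand_eq, Set.indicator_of_mem this]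

theorem quantize_indicator (a : FullPhase n → ℂ) (u : E n → ℂ) {z : E n} (hz : 0 < z 0) :
    quantize ((fullInteriorSet n).indicator a) u z = quantize a u z := by
  simp only [quantize, quantIntegrand_indicator a u hz]

theorem stronglyMeasurable_quantIntegrand {a : FullPhase n → ℂ} (ha : Measurable a) {u : E n → ℂ}
    (hu : Continuous u) :
    StronglyMeasurable (fun q : FullPhase n => quantIntegrand a u q.1.1 q.1.2 q.2) := by
  have h1 : Continuous fun q : FullPhase n => osc q.1.2 q.2 :=
    continuous_osc.comp ((continuous_snd.comp continuous_fst).prodMk continuous_snd)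
  have h2 : Continuous fun q : FullPhase n => u (scatShift q.1.1 q.2) :=
    hu.comp contDiff_scatShift.continuous
  exact ((h1.measurable.mul ha).mul h2.measurable).stronglyMeasurable

theorem stronglyMeasurable_integral_quantIntegrand {a : FullPhase n → ℂ} (ha : Measurable a)
    {u : E n → ℂ} (hu : Continuous u) :
    StronglyMeasurable (fun p : Phase n => ∫ Z, quantIntegrand a u p.1 p.2 Z) :=
  (stronglyMeasurable_quantIntegrand ha hu).integral_prod_right'

theorem stronglyMeasurable_quantize {a : FullPhase n → ℂ} (ha : Measurable a)
    {u : E n → ℂ} (hu : Continuous u) : StronglyMeasurable (quantize a u) := by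
  have h := (stronglyMeasurable_integral_quantIntegrand ha hu).integral_prod_right'
    (ν := (volume : Measure (E n)))
  exact stronglyMeasurable_const.mul h

theorem stronglyMeasurable_inner {a : FullPhase n → ℂ} (ha : ContinuousOn a (fullInteriorSet n))
    {u : E n → ℂ} (hu : Continuous u) {z : E n} (hz : 0 < z 0) :
    StronglyMeasurable (fun ζ => ∫ Z, quantIntegrand a u z ζ Z) := by
  have h := (stronglyMeasurable_integral_quantIntegrand
    (measurable_indicator_fullInteriorSet ha) hu).comp_measurable (measurable_prodMk_left (x := z))
  simpa only [Function.comp_def, quantIntegrand_indicator a u hz] using h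

theorem continuous_quantIntegrand {a : FullPhase n → ℂ} (ha : ContinuousOn a (fullInteriorSet n))
    {u : E n → ℂ} (hu : Continuous u) {z : E n} (hz : 0 < z 0) (ζ : E n) :
    Continuous (quantIntegrand a u z ζ) := by
  have h1 : Continuous fun Z : E n => osc ζ Z := continuous_osc.comp (Continuous.prodMk_right ζ)
  have h2 : Continuous fun Z : E n => u (scatShift z Z) :=
    hu.comp (contDiff_scatShift.continuous.comp (Continuous.prodMk_right (z, ζ)))
  have h3 : Continuous fun Z : E n => a ((z, ζ), Z) :=
    ha.comp_continuous (Continuous.prodMk_right (z, ζ)) fun Z => hz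
  exact (h1.mul h3).mul h2

/-! ### Test functions and the scattering volume -/

theorem IsTestFunction.exists_bounds {u : E n → ℂ} (hu : IsTestFunction u) :
    ∃ r R : ℝ, 0 < r ∧ ∀ z, u z ≠ 0 → r ≤ z 0 ∧ ‖z‖ ≤ R := by
  have hK : IsCompact (tsupport u) := hu.hasCompactSupport
  obtain ⟨R, hR⟩ := hK.isBounded.exists_norm_le
  rcases (tsupport u).eq_empty_or_nonempty with he | hne
  · refine ⟨1, R, one_pos, fun z hz => ?_⟩
    have := subset_tsupport u hz
    rw [he] at this
    exact this.elim
  · obtain ⟨z₀, hz₀, hmin⟩ := hK.exists_isMinOn hne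
      (f := fun z : E n => z 0) (by fun_prop)
    exact ⟨z₀ 0, R, hu.tsupport_subset hz₀, fun z hz =>
      ⟨hmin (subset_tsupport u hz), hR z (subset_tsupport u hz)⟩⟩

theorem IsTestFunction.pos {u : E n → ℂ} (hu : IsTestFunction u) {z : E n} (hz : u z ≠ 0) :
    0 < z 0 := hu.tsupport_subset (subset_tsupport u hz)

theorem IsTestFunction.conj {u : E n → ℂ} (hu : IsTestFunction u) :
    IsTestFunction (fun z => conj (u z)) := by
  have h : (Function.support fun z => conj (u z)) = Function.support u := by
    ext z; simp
  refine ⟨Complex.conjCLE.contDiff.comp hu.contDiff,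
    hu.hasCompactSupport.comp_left (map_zero _), ?_⟩
  rw [tsupport, h]
  exact hu.tsupport_subset

theorem ae_scatVolume_pos : ∀ᵐ z ∂(scatVolume n), 0 < z 0 := by
  have hm : MeasurableSet {z : E n | 0 < z 0} :=
    (isOpen_lt continuous_const (by fun_prop)).measurableSet
  exact (withDensity_absolutelyContinuous _ _).ae_le (ae_restrict_mem hm)

theorem integral_scatVolume {f : E n → ℂ} (hf : ∀ z, f z ≠ 0 → 0 < z 0) :
    ∫ z, f z ∂(scatVolume n) = ∫ z, ((z 0 ^ (n + 1))⁻¹ : ℝ) • f z := by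
  have hm : MeasurableSet {z : E n | 0 < z 0} :=
    (isOpen_lt continuous_const (by fun_prop)).measurableSet
  have hmeas : Measurable fun z : E n => ENNReal.ofReal ((z 0 ^ (n + 1))⁻¹) := by
    have : Continuous fun z : E n => z 0 := by fun_prop
    exact (this.measurable.pow_const _).inv.ennreal_ofReal
  rw [scatVolume, integral_withDensity_eq_integral_toReal_smul hmeas (by simp),
    setIntegral_eq_integral_of_forall_compl_eq_zero fun z hz => ?_]
  · refine integral_congr_ae (Eventually.of_forall fun z => ?_)
    by_cases hz : f z = 0
    · simp [hz]
    · have := hf z hz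
      simp only [ENNReal.toReal_ofReal (inv_nonneg.2 (pow_nonneg this.le _))]
  · rw [not_not.1 fun h => hz (hf z h), smul_zero]

theorem scatVolume_lt_top {r : ℝ} (hr : 0 < r) (R : ℝ) :
    scatVolume n ({z | r ≤ z 0} ∩ Metric.closedBall 0 R) < ⊤ := by
  have hm : MeasurableSet ({z : E n | r ≤ z 0} ∩ Metric.closedBall 0 R) :=
    (isClosed_le continuous_const (by fun_prop)).measurableSet.inter
      Metric.isClosed_closedBall.measurableSet
  rw [scatVolume, withDensity_apply _ hm]
  refine (setLIntegral_mono (g := fun _ => ENNReal.ofReal ((r ^ (n + 1))⁻¹)) measurable_const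
    fun z hz => ENNReal.ofReal_le_ofReal ?_).trans_lt ?_
  · have : r ≤ z 0 := hz.1
    gcongr
  · rw [setLIntegral_const]
    refine ENNReal.mul_lt_top ENNReal.ofReal_lt_top ?_
    exact ((Measure.restrict_apply_le _ _).trans (measure_mono Set.inter_subset_right)).trans_lt
      measure_closedBall_lt_top

/-! ### Convergence and continuity of pairings -/

section Limits

variable {ι : Type*} {m l k j : ℝ} {a : ι → FullPhase n → ℂ} {u : E n → ℂ}

theorem FullSymbolFamily.norm_quantize_le (ha : FullSymbolFamily m l k j a)
    (hs : ∀ i, NearSupported (a i)) (hu : IsTestFunction u) {r R : ℝ} (hr : 0 < r) :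
    ∃ C : ℝ, ∀ i, ∀ z : E n, r ≤ z 0 → ‖z‖ ≤ R → ‖quantize (a i) u z‖ ≤ C := by
  obtain ⟨C, hC0, hC⟩ := ha.decay hs hu.contDiff hu.hasCompactSupport (R := R) hr n
  refine ⟨((2 * Real.pi) ^ n)⁻¹ * ∫ ζ : E n, C * (japSq ζ ^ n)⁻¹, fun i z hz hR => ?_⟩
  rw [quantize, norm_mul, Complex.norm_real, Real.norm_of_nonneg (by positivity)]
  refine mul_le_mul_of_nonneg_left ?_ (by positivity)
  exact norm_integral_le_of_norm_le (integrable_japSq.const_mul C)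
    (Eventually.of_forall fun ζ => hC i z ζ hz hR)

theorem FullSymbolFamily.quantizationConverges (ha : FullSymbolFamily m l k j a)
    (hs : ∀ i, NearSupported (a i)) (i : ι) : QuantizationConverges (a i) := by
  intro u hu z hz
  have hcont := (ha.contDiffOn i).continuousOn
  refine ⟨fun ζ => ?_, ?_⟩
  · refine (continuous_quantIntegrand hcont hu.contDiff.continuous hz ζ
      ).integrable_of_hasCompactSupport ?_
    refine HasCompactSupport.intro (isCompact_closedBall 0 (2 / z 0)) fun Z hZ => ?_
    rw [quantIntegrand_eq, (hs i).eq_zero hz hZ, mul_zero, zero_mul]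
  · obtain ⟨C, -, hC⟩ := ha.decay hs hu.contDiff hu.hasCompactSupport (R := ‖z‖) hz n
    exact (integrable_japSq.const_mul C).mono'
      (stronglyMeasurable_inner hcont hu.contDiff.continuous hz).aestronglyMeasurable
      (Eventually.of_forall fun ζ => hC i z ζ le_rfl le_rfl)

theorem aestronglyMeasurable_quantize_mul {a : FullPhase n → ℂ}
    (ha : ContinuousOn a (fullInteriorSet n)) {w : E n → ℂ} (hu : IsTestFunction u)
    (hw : IsTestFunction w) :
    AEStronglyMeasurable (fun z => quantize a u z * w z) (scatVolume n) := by
  refine (((stronglyMeasurable_quantize (measurable_indicator_fullInteriorSet ha)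
    hu.contDiff.continuous).mul
    hw.contDiff.continuous.stronglyMeasurable).aestronglyMeasurable).congr ?_
  filter_upwards [ae_scatVolume_pos] with z hz
  simp only [Pi.mul_apply, quantize_indicator a u hz]

/-- The pairings of the operators of a family with test functions have a common integrable bound. -/
theorem FullSymbolFamily.exists_integrable_bound (ha : FullSymbolFamily m l k j a)
    (hs : ∀ i, NearSupported (a i)) {w : E n → ℂ} (hu : IsTestFunction u) (hw : IsTestFunction w) :
    ∃ g : E n → ℝ, Integrable g (scatVolume n) ∧ ∀ i z, ‖quantize (a i) u z * w z‖ ≤ g z := by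
  obtain ⟨r, R, hr, hb⟩ := hw.exists_bounds
  obtain ⟨C, hC⟩ := ha.norm_quantize_le hs hu (R := R) hr
  obtain ⟨D, hD⟩ := hw.contDiff.continuous.bounded_above_of_compact_support hw.hasCompactSupport
  have hm : MeasurableSet ({z : E n | r ≤ z 0} ∩ Metric.closedBall 0 R) :=
    (isClosed_le continuous_const (by fun_prop)).measurableSet.inter
      Metric.isClosed_closedBall.measurableSet
  refine ⟨({z : E n | r ≤ z 0} ∩ Metric.closedBall 0 R).indicator fun _ => |C| * |D|,
    (integrable_indicator_iff hm).2 (integrableOn_const (scatVolume_lt_top hr R).ne), fun i z => ?_⟩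
  by_cases hz : w z = 0
  · rw [hz, mul_zero, norm_zero]
    exact Set.indicator_nonneg (fun _ _ => by positivity) z
  · obtain ⟨h1, h2⟩ := hb z hz
    have hz' : z ∈ {z : E n | r ≤ z 0} ∩ Metric.closedBall 0 R := ⟨h1, mem_closedBall_zero_iff.2 h2⟩
    rw [Set.indicator_of_mem hz', norm_mul]
    exact mul_le_mul ((hC i z h1 h2).trans (le_abs_self C)) ((hD z).trans (le_abs_self D))
      (norm_nonneg _) (abs_nonneg _)

theorem FullSymbolFamily.integrable_quantize_mul (ha : FullSymbolFamily m l k j a)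
    (hs : ∀ i, NearSupported (a i)) {w : E n → ℂ} (hu : IsTestFunction u) (hw : IsTestFunction w)
    (i : ι) : Integrable (fun z => quantize (a i) u z * w z) (scatVolume n) := by
  obtain ⟨g, hg, h⟩ := ha.exists_integrable_bound hs hu hw
  exact hg.mono' (aestronglyMeasurable_quantize_mul (ha.contDiffOn i).continuousOn hu hw)
    (Eventually.of_forall (h i))

/-- Pairings of the quantization with test functions are continuous under pointwise convergence within
a bounded family of full symbols. -/
theorem FullSymbolFamily.tendsto_pairing (ha : FullSymbolFamily m l k j a)
    (hs : ∀ i, NearSupported (a i)) {w : E n → ℂ} (hu : IsTestFunction u) (hw : IsTestFunction w)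
    {e : ℕ → ι} {e₀ : ι}
    (hlim : ∀ q ∈ fullInteriorSet n, Tendsto (fun N => a (e N) q) atTop (𝓝 (a e₀ q))) :
    Tendsto (fun N => ∫ z, quantize (a (e N)) u z * w z ∂(scatVolume n)) atTop
      (𝓝 (∫ z, quantize (a e₀) u z * w z ∂(scatVolume n))) := by
  have hcont := fun i => (ha.contDiffOn i).continuousOn
  obtain ⟨g, hg, hgb⟩ := ha.exists_integrable_bound hs hu hw
  refine tendsto_integral_of_dominated_convergence g
    (fun N => aestronglyMeasurable_quantize_mul (hcont _) hu hw) hg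
    (fun N => Eventually.of_forall (hgb _)) ?_
  filter_upwards [ae_scatVolume_pos] with z hz
  refine Tendsto.mul_const _ (Tendsto.const_mul _ ?_)
  obtain ⟨C, -, hC⟩ := ha.decay hs hu.contDiff hu.hasCompactSupport (R := ‖z‖) hz n
  refine tendsto_integral_of_dominated_convergence (fun ζ => C * (japSq ζ ^ n)⁻¹)
    (fun N => (stronglyMeasurable_inner (hcont _) hu.contDiff.continuous hz).aestronglyMeasurable)
    (integrable_japSq.const_mul C) (fun N => Eventually.of_forall fun ζ => hC _ z ζ le_rfl le_rfl)
    (Eventually.of_forall fun ζ => ?_)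
  obtain ⟨M, hM⟩ := ha.norm_le
  obtain ⟨A, hA0, hA⟩ := hM (z 0) ‖z‖ hz
  obtain ⟨D, hD⟩ := hu.contDiff.continuous.bounded_above_of_compact_support hu.hasCompactSupport
  refine tendsto_integral_of_dominated_convergence
    ((Metric.closedBall 0 (2 / z 0)).indicator fun _ => A * japSq ζ ^ M * D)
    (fun N => (continuous_quantIntegrand (hcont _) hu.contDiff.continuous hz ζ).aestronglyMeasurable)
    ((integrable_indicator_iff Metric.isClosed_closedBall.measurableSet).2
      (integrableOn_const measure_closedBall_lt_top.ne))
    (fun N => Eventually.of_forall fun Z => ?_) (Eventually.of_forall fun Z => ?_)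
  · by_cases hZ : Z ∈ Metric.closedBall (0 : E n) (2 / z 0)
    · rw [Set.indicator_of_mem hZ, quantIntegrand_eq, norm_mul, norm_mul, norm_osc, one_mul]
      exact mul_le_mul (hA _ z ζ Z le_rfl le_rfl) (hD _) (norm_nonneg _)
        (mul_nonneg hA0 (pow_nonneg (japSq_pos ζ).le _))
    · rw [Set.indicator_of_notMem hZ, quantIntegrand_eq, (hs _).eq_zero hz hZ, mul_zero, zero_mul,
        norm_zero]
  · exact ((hlim ((z, ζ), Z) hz).const_mul _).mul_const _

end Limits

/-! ### Affine changes of variables -/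

theorem dilFactor_mul (c d : ℝ) (i : Fin n) : dilFactor (c * d) i = dilFactor c i * dilFactor d i := by
  unfold dilFactor
  split_ifs <;> ring

theorem dilate_dilate (c d : ℝ) (v : E n) : dilate c (dilate d v) = dilate (c * d) v := by
  ext i
  simp only [dilate_apply, dilFactor_mul, mul_assoc]

theorem dilate_one (v : E n) : dilate 1 v = v := by
  ext i
  simp [dilate_apply, dilFactor]

theorem dilate_neg (c : ℝ) (v : E n) : dilate c (-v) = -dilate c v := by
  ext i
  simp [dilate_apply]

theorem scatShift_eq (z Z : E n) : scatShift z Z = z + dilate (z 0) Z := by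
  ext i
  by_cases hi : i = 0
  · simp [scatShift, dilate_apply, dilFactor, hi]
  · simp [scatShift, dilate_apply, dilFactor, hi]

theorem prod_dilFactor (c : ℝ) : ∏ i : Fin n, dilFactor c i = c ^ (n + 1) := by
  have : ∀ i : Fin n, dilFactor c i = (if i = 0 then c else 1) * c := fun i => by
    unfold dilFactor
    split_ifs <;> ring
  simp only [this, Finset.prod_mul_distrib, Finset.prod_ite_eq', Finset.mem_univ, if_true,
    Finset.prod_const, Finset.card_univ, Fintype.card_fin]
  ring

/-- The anisotropic dilation as a linear map. -/
def dilateLinear (c : ℝ) : E n →ₗ[ℝ] E n where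
  toFun := dilate c
  map_add' v w := by ext i; simp [dilate_apply, mul_add]
  map_smul' t v := by ext i; simp [dilate_apply, mul_left_comm]

theorem det_dilateLinear (c : ℝ) : LinearMap.det (dilateLinear (n := n) c) = c ^ (n + 1) := by
  set b := (EuclideanSpace.basisFun (Fin n) ℝ).toBasis
  have h : LinearMap.toMatrix b b (dilateLinear c) = Matrix.diagonal (dilFactor c) := by
    ext i j
    rw [LinearMap.toMatrix_apply]
    by_cases h : i = j
    · simp [b, dilateLinear, dilate_apply, h]
    · simp [b, dilateLinear, dilate_apply, h, Matrix.diagonal]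
  rw [← LinearMap.det_toMatrix b, h, Matrix.det_diagonal, prod_dilFactor]

/-- The anisotropic dilation as a homeomorphism. -/
def dilateHomeomorph {c : ℝ} (hc : c ≠ 0) : E n ≃ₜ E n where
  toFun := dilateLinear c
  invFun := dilateLinear c⁻¹
  left_inv v := by
    change dilate c⁻¹ (dilate c v) = v
    rw [dilate_dilate, inv_mul_cancel₀ hc, dilate_one]
  right_inv v := by
    change dilate c (dilate c⁻¹ v) = v
    rw [dilate_dilate, mul_inv_cancel₀ hc, dilate_one]
  continuous_toFun := LinearMap.continuous_of_finiteDimensional _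
  continuous_invFun := LinearMap.continuous_of_finiteDimensional _

theorem map_dilate {c : ℝ} (hc : 0 < c) : Measure.map (dilateHomeomorph (n := n) hc.ne') volume =
    ENNReal.ofReal (c ^ (n + 1))⁻¹ • (volume : Measure (E n)) := by
  have h := Measure.map_linearMap_addHaar_eq_smul_addHaar (volume : Measure (E n))
    (f := dilateLinear c) (by rw [det_dilateLinear]; positivity)
  rw [det_dilateLinear, abs_of_pos (by positivity)] at h
  exact h

theorem integral_dilate {c : ℝ} (hc : 0 < c) (f : E n → ℂ) :
    ∫ Z, f (dilate c Z) = ((c ^ (n + 1))⁻¹ : ℝ) * ∫ Z, f Z := by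
  have h := (dilateHomeomorph (n := n) hc.ne').measurableEmbedding.integral_map (μ := volume) f
  rw [map_dilate hc, integral_smul_measure, ENNReal.toReal_ofReal (by positivity)] at h
  rw [← Complex.real_smul, h]
  rfl

theorem integral_comp_scatShift {z : E n} (hz : 0 < z 0) (f : E n → ℂ) :
    ∫ Z, f (scatShift z Z) = ((z 0 ^ (n + 1))⁻¹ : ℝ) * ∫ Z, f Z := by
  simp only [scatShift_eq]
  rw [integral_dilate hz fun Z => f (z + Z), integral_add_left_eq_self]

theorem integrable_comp_scatShift {z : E n} (hz : 0 < z 0) {f : E n → ℝ} (hf : Integrable f) :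
    Integrable (fun Z => f (scatShift z Z)) := by
  simp only [scatShift_eq]
  have h1 : Integrable (fun Z => f (z + Z)) := hf.comp_add_left z
  have h := (dilateHomeomorph (n := n) hz.ne').measurableEmbedding.integrable_map_iff
    (μ := volume) (g := fun Z => f (z + Z))
  rw [map_dilate hz] at h
  exact h.1 (h1.smul_measure ENNReal.ofReal_ne_top)

/-! ### The adjoint of an operator with integrable symbol -/

/-- Symbols which are integrable in the fibre variable, locally uniformly in the base, so that
their operators have bounded kernels. -/
structure IntegrableSymbol (a : FullPhase n → ℂ) : Prop where
  /-- the symbol is continuous over `x > 0` -/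
  continuousOn : ContinuousOn a (fullInteriorSet n)
  /-- the symbol is dominated by an integrable function of the fibre variable -/
  bound : ∀ r R : ℝ, 0 < r → ∃ C : ℝ, 0 ≤ C ∧ ∀ z ζ Z : E n, r ≤ z 0 → ‖z‖ ≤ R →
    ‖a ((z, ζ), Z)‖ ≤ C * (japSq ζ ^ n)⁻¹

/-- The partial Fourier transform `∫ e^{i ζ·Z} a(z, ζ, Z) dζ` of a symbol. -/
def fibreIntegral (a : FullPhase n → ℂ) (z Z : E n) : ℂ := ∫ ζ, osc ζ Z * a ((z, ζ), Z)

/-- The kernel of the sesquilinear form `∫ (A u) v̄ dx dy / x^{n+1}` with respect to Lebesgue measure, up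
to a power of `2π`, where `A` is quantized by `a`, `u` is read at `z'` and `v` at `z`. One factor
`x^{-(n+1)}` is the density, the other the Jacobian of the substitution `z' = (x + x² X, y + xY)`. The
value is set to zero for `x ≤ 0`. -/
def pairKernel (a : FullPhase n → ℂ) (z z' : E n) : ℂ :=
  if 0 < z 0 then (((z 0 ^ (n + 1))⁻¹ ^ 2 : ℝ) : ℂ) * fibreIntegral a z (dilate (z 0)⁻¹ (z' - z))
  else 0

theorem dilate_scatShift_sub {z : E n} (hz : 0 < z 0) (Z : E n) :
    dilate (z 0)⁻¹ (scatShift z Z - z) = Z := by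
  rw [scatShift_eq, add_sub_cancel_left, dilate_dilate, inv_mul_cancel₀ hz.ne', dilate_one]

theorem pairKernel_indicator (a : FullPhase n → ℂ) (z z' : E n) :
    pairKernel ((fullInteriorSet n).indicator a) z z' = pairKernel a z z' := by
  unfold pairKernel
  split_ifs with hz
  · have : ∀ ζ Z : E n, ((z, ζ), Z) ∈ fullInteriorSet n := fun _ _ => hz
    simp only [fibreIntegral, Set.indicator_of_mem (this _ _)]
  · rfl

theorem measurable_fibreIntegral {a : FullPhase n → ℂ} (ha : Measurable a) :
    Measurable (fun p : E n × E n => fibreIntegral a p.1 p.2) := by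
  have h1 : Measurable fun q : (E n × E n) × E n => osc q.2 q.1.2 * a ((q.1.1, q.2), q.1.2) := by
    have e1 : Continuous fun q : (E n × E n) × E n => osc q.2 q.1.2 :=
      continuous_osc.comp (continuous_snd.prodMk (continuous_snd.comp continuous_fst))
    refine e1.measurable.mul (ha.comp ?_)
    fun_prop
  exact (h1.stronglyMeasurable.integral_prod_right' (ν := (volume : Measure (E n)))).measurable

theorem measurable_pairKernel {a : FullPhase n → ℂ} (ha : ContinuousOn a (fullInteriorSet n)) :
    Measurable (fun p : E n × E n => pairKernel a p.1 p.2) := by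
  simp only [← pairKernel_indicator a]
  have ha' := measurable_fibreIntegral (measurable_indicator_fullInteriorSet ha)
  generalize (fullInteriorSet n).indicator a = b at ha' ⊢
  have h0 : Measurable fun p : E n × E n => p.1 0 := by
    have : Continuous fun p : E n × E n => p.1 0 := by fun_prop
    exact this.measurable
  have h1 : Measurable fun p : E n × E n => dilate (p.1 0)⁻¹ (p.2 - p.1) := by
    refine (WithLp.measurable_toLp 2 (Fin n → ℝ)).comp (measurable_pi_lambda _ fun i => ?_)
    have hi : Measurable fun p : E n × E n => (p.2 - p.1) i := by
      have : Continuous fun p : E n × E n => (p.2 - p.1) i := by fun_prop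
      exact this.measurable
    refine Measurable.mul ?_ hi
    unfold dilFactor
    split_ifs
    · exact h0.inv.pow_const 2
    · exact h0.inv
  refine Measurable.ite (measurableSet_lt measurable_const h0) (Measurable.mul ?_ ?_)
    measurable_const
  · exact Complex.measurable_ofReal.comp ((h0.pow_const _).inv.pow_const 2)
  · exact ha'.comp (f := fun p : E n × E n => (p.1, dilate (p.1 0)⁻¹ (p.2 - p.1)))
      (measurable_fst.prodMk h1)

namespace IntegrableSymbol

variable {a : FullPhase n → ℂ} {u v : E n → ℂ}

theorem norm_pairKernel_le (ha : IntegrableSymbol a) {r : ℝ} (hr : 0 < r) (R : ℝ) :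
    ∃ C : ℝ, ∀ z z' : E n, r ≤ z 0 → ‖z‖ ≤ R → ‖pairKernel a z z'‖ ≤ C := by
  obtain ⟨C, hC0, hC⟩ := ha.bound r R hr
  have hI : 0 ≤ ∫ ζ : E n, C * (japSq ζ ^ n)⁻¹ := integral_nonneg fun ζ =>
    mul_nonneg hC0 (inv_nonneg.2 (pow_nonneg (japSq_pos ζ).le _))
  refine ⟨(r ^ (n + 1))⁻¹ ^ 2 * ∫ ζ : E n, C * (japSq ζ ^ n)⁻¹, fun z z' hz hR => ?_⟩
  have hz0 : 0 < z 0 := hr.trans_le hz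
  rw [pairKernel, if_pos hz0, norm_mul, Complex.norm_real, Real.norm_of_nonneg (by positivity)]
  refine mul_le_mul (by gcongr) ?_ (norm_nonneg _) (by positivity)
  refine norm_integral_le_of_norm_le (integrable_japSq.const_mul C)
    (Eventually.of_forall fun ζ => ?_)
  rw [norm_mul, norm_osc, one_mul]
  exact hC z ζ _ hz hR

/-- Fubini's theorem in `(ζ, Z)`, and the substitution `z' = (x + x² X, y + xY)`. -/
theorem integral_quantIntegrand (ha : IntegrableSymbol a) (hu : IsTestFunction u) {z : E n}
    (hz : 0 < z 0) : ∫ ζ, ∫ Z, quantIntegrand a u z ζ Z =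
      ((z 0 ^ (n + 1))⁻¹ : ℝ) * ∫ z', fibreIntegral a z (dilate (z 0)⁻¹ (z' - z)) * u z' := by
  obtain ⟨C, hC0, hC⟩ := ha.bound (z 0) ‖z‖ hz
  have hui : Integrable (fun Z => ‖u (scatShift z Z)‖) := integrable_comp_scatShift hz
    (hu.contDiff.continuous.integrable_of_hasCompactSupport hu.hasCompactSupport).norm
  have hint : Integrable (Function.uncurry fun ζ Z => quantIntegrand a u z ζ Z)
      ((volume : Measure (E n)).prod volume) := by
    refine ((integrable_japSq.const_mul C).mul_prod hui).mono' ?_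
      (Eventually.of_forall fun p => ?_)
    · have h := (stronglyMeasurable_quantIntegrand (measurable_indicator_fullInteriorSet
        ha.continuousOn) hu.contDiff.continuous).comp_measurable
        (g := fun p : E n × E n => ((z, p.1), p.2)) (by fun_prop)
      simp only [Function.comp_def, quantIntegrand_indicator a u hz] at h
      exact h.aestronglyMeasurable
    · rw [Function.uncurry_def]
      simp only [quantIntegrand_eq, norm_mul, norm_osc, one_mul]
      exact mul_le_mul_of_nonneg_right (hC z p.1 p.2 le_rfl le_rfl) (norm_nonneg _)
  rw [integral_integral_swap hint, ← integral_comp_scatShift hz]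
  refine integral_congr_ae (Eventually.of_forall fun Z => ?_)
  simp only [dilate_scatShift_sub hz, fibreIntegral, quantIntegrand_eq]
  exact integral_mul_const _ _

/-- The pairing of the operator with test functions, as a double integral over the two base points. -/
theorem pairing_eq (ha : IntegrableSymbol a) (hu : IsTestFunction u) (hv : IsTestFunction v) :
    ∫ z, quantize a u z * conj (v z) ∂(scatVolume n) =
      (((2 * Real.pi) ^ n)⁻¹ : ℝ) * ∫ z, ∫ z', pairKernel a z z' * u z' * conj (v z) := by
  rw [integral_scatVolume fun z hz => hv.pos fun h => hz (by simp [h]), ← integral_const_mul]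
  refine integral_congr_ae (Eventually.of_forall fun z => ?_)
  by_cases hz : v z = 0
  · simp [hz]
  · have hz0 := hv.pos hz
    simp only [integral_mul_const]
    rw [quantize, ha.integral_quantIntegrand hu hz0]
    simp only [pairKernel, if_pos hz0, mul_assoc]
    rw [integral_const_mul, Complex.real_smul]
    push_cast
    ring

theorem integrable_pairKernel (ha : IntegrableSymbol a) (hu : IsTestFunction u)
    (hv : IsTestFunction v) :
    Integrable (Function.uncurry fun z z' => pairKernel a z z' * u z' * conj (v z))
      ((volume : Measure (E n)).prod volume) := by
  obtain ⟨r, R, hr, hb⟩ := hv.exists_bounds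
  obtain ⟨C, hC⟩ := ha.norm_pairKernel_le hr R
  have hi : ∀ {w : E n → ℂ}, IsTestFunction w → Integrable (fun z => ‖w z‖) := fun hw =>
    (hw.contDiff.continuous.integrable_of_hasCompactSupport hw.hasCompactSupport).norm
  refine (((hi hv).const_mul C).mul_prod (hi hu)).mono' ?_ (Eventually.of_forall fun p => ?_)
  · have h1 : Continuous fun p : E n × E n => u p.2 := hu.contDiff.continuous.comp continuous_snd
    have h2 : Continuous fun p : E n × E n => conj (v p.1) :=
      hv.conj.contDiff.continuous.comp continuous_fst
    exact (((measurable_pairKernel ha.continuousOn).mul h1.measurable).mul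
      h2.measurable).aestronglyMeasurable
  · rw [Function.uncurry_def, norm_mul, norm_mul, RCLike.norm_conj]
    by_cases hz : v p.1 = 0
    · simp [hz]
    · obtain ⟨h1, h2⟩ := hb _ hz
      calc _ ≤ C * ‖u p.2‖ * ‖v p.1‖ := by
            gcongr
            exact hC _ _ h1 h2
        _ = _ := by ring

end IntegrableSymbol

theorem osc_dilate (c : ℝ) (hc : c ≠ 0) (ζ Z : E n) :
    osc (dilate c ζ) (-dilate c⁻¹ Z) = conj (osc ζ Z) := by
  have h : ∑ i, dilate c ζ i * (-dilate c⁻¹ Z) i = -∑ i, ζ i * Z i := by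
    rw [← Finset.sum_neg_distrib]
    refine Finset.sum_congr rfl fun i _ => ?_
    have h1 : dilFactor c i * dilFactor c⁻¹ i = 1 := by
      rw [← dilFactor_mul, mul_inv_cancel₀ hc]
      simp [dilFactor]
    calc dilate c ζ i * (-dilate c⁻¹ Z) i
        = dilFactor c i * ζ i * -(dilFactor c⁻¹ i * Z i) := rfl
      _ = -((dilFactor c i * dilFactor c⁻¹ i) * (ζ i * Z i)) := by ring
      _ = _ := by rw [h1, one_mul]
  rw [osc, osc, h, ← Complex.exp_conj]
  simp

/-- The kernel of the adjoint: exchange of the base points and conjugation. -/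
theorem conj_pairKernel_adjSymbol {a : FullPhase n → ℂ} (ha : SupportedNearDiagonal a) {z z' : E n}
    (hz : 0 < z 0) (hz' : 0 < z' 0) : conj (pairKernel (adjSymbol a) z' z) = pairKernel a z z' := by
  set Z' := dilate (z' 0)⁻¹ (z - z') with hZ'
  set s := z 0 / z' 0 with hs
  have hs0 : 0 < s := div_pos hz hz'
  have hst : ∀ ζ, stretch ((z', ζ), Z') = s := fun ζ => by
    simp only [stretch, hZ', dilate_apply, dilFactor, if_true, PiLp.sub_apply, hs]
    field_simp
    ring
  have hshift : scatShift z' Z' = z := by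
    rw [scatShift_eq, hZ', dilate_dilate, mul_inv_cancel₀ hz'.ne', dilate_one, add_sub_cancel]
  have hmap : ∀ ζ, adjMap ((z', ζ), Z') = ((z, dilate s ζ), -dilate s⁻¹ Z') := fun ζ => by
    simp only [adjMap, hst, hshift]
  have hZ : -dilate s⁻¹ Z' = dilate (z 0)⁻¹ (z' - z) := by
    rw [hZ', dilate_dilate, hs, inv_div, ← dilate_neg, neg_sub]
    congr 1
    field_simp
  have hadj : ∀ ζ, adjSymbol a ((z', ζ), Z') =
      ((s ^ (n + 1))⁻¹ : ℝ) * conj (a ((z, dilate s ζ), -dilate s⁻¹ Z')) := fun ζ => by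
    by_cases hq : ((z', ζ), Z') ∈ adjRegion n
    · rw [adjSymbol_of_mem a hq, hst, hmap]
    · rw [adjSymbol_of_notMem a hq, ← hmap, apply_adjMap_eq_zero ha hz' (by rw [hst]; exact hs0) hq,
        map_zero, mul_zero]
  have hJ : conj (fibreIntegral (adjSymbol a) z' Z') =
      (((s ^ (n + 1))⁻¹ ^ 2 : ℝ) : ℂ) * fibreIntegral a z (-dilate s⁻¹ Z') := by
    have h := integral_dilate hs0 fun ζ => osc ζ (-dilate s⁻¹ Z') * a ((z, ζ), -dilate s⁻¹ Z')
    simp only [osc_dilate s hs0.ne'] at h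
    rw [fibreIntegral, fibreIntegral, ← integral_conj, pow_two, Complex.ofReal_mul, mul_assoc, ← h,
      ← integral_const_mul]
    refine integral_congr_ae (Eventually.of_forall fun ζ => ?_)
    simp only [hadj, map_mul, Complex.conj_conj, Complex.conj_ofReal]
    ring
  rw [pairKernel, pairKernel, if_pos hz, if_pos hz', map_mul, Complex.conj_ofReal, ← hZ', hJ, hZ,
    ← mul_assoc, ← Complex.ofReal_mul]
  congr 2
  rw [hs, div_pow]
  field_simp

/-- The adjointness relation for integrable symbols: it is the theorem of Fubini. -/
theorem IntegrableSymbol.pairing_adjSymbol {a : FullPhase n → ℂ} (ha : IntegrableSymbol a)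
    (hb : IntegrableSymbol (adjSymbol a)) (hs : SupportedNearDiagonal a) {u v : E n → ℂ}
    (hu : IsTestFunction u) (hv : IsTestFunction v) :
    ∫ z, quantize a u z * conj (v z) ∂(scatVolume n) =
      ∫ z, u z * conj (quantize (adjSymbol a) v z) ∂(scatVolume n) := by
  have h1 : ∫ z, u z * conj (quantize (adjSymbol a) v z) ∂(scatVolume n) =
      conj (∫ z, quantize (adjSymbol a) v z * conj (u z) ∂(scatVolume n)) := by
    rw [← integral_conj]
    congr 1 with z
    simp [mul_comm]
  rw [h1, hb.pairing_eq hv hu, ha.pairing_eq hu hv, map_mul, Complex.conj_ofReal, ← integral_conj,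
    integral_integral_swap (ha.integrable_pairKernel hu hv)]
  congr 1
  refine integral_congr_ae (Eventually.of_forall fun z' => ?_)
  simp only [← integral_conj]
  refine integral_congr_ae (Eventually.of_forall fun z => ?_)
  simp only [map_mul, Complex.conj_conj]
  by_cases h : u z' = 0
  · simp [h]
  by_cases h' : v z = 0
  · simp [h']
  rw [conj_pairKernel_adjSymbol hs (hv.pos h') (hu.pos h)]
  ring

theorem japSq_le_dilate {s : ℝ} (hs : 1 / 2 < s) (ζ : E n) : japSq ζ ≤ 16 * japSq (dilate s ζ) := by
  have h : ‖ζ‖ ^ 2 ≤ 16 * ‖dilate s ζ‖ ^ 2 := by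
    rw [EuclideanSpace.real_norm_sq_eq, EuclideanSpace.real_norm_sq_eq, Finset.mul_sum]
    refine Finset.sum_le_sum fun i _ => ?_
    have h1 : 1 / 4 ≤ dilFactor s i := by
      unfold dilFactor
      split_ifs <;> nlinarith
    rw [dilate_apply, mul_pow, ← mul_assoc]
    exact le_mul_of_one_le_left (sq_nonneg _) (by nlinarith)
  unfold japSq
  linarith

/-- On `adjRegion` the fibre variable is rescaled by a factor bounded below, which preserves the
domination by an integrable function. -/
theorem IntegrableSymbol.adjSymbol {a : FullPhase n → ℂ} (ha : IntegrableSymbol a)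
    (hc : ContinuousOn (adjSymbol a) (fullInteriorSet n)) : IntegrableSymbol (adjSymbol a) := by
  refine ⟨hc, fun r R hr => ?_⟩
  obtain ⟨C, hC0, hC⟩ := ha.bound (r / 2) (R + (R + 1) * 3) (half_pos hr)
  refine ⟨2 ^ (n + 1) * (C * 16 ^ n), by positivity, fun z ζ Z hz hR => ?_⟩
  have hJ := japSq_pos ζ
  by_cases hq : ((z, ζ), Z) ∈ adjRegion n
  · have hs := hq.2.1
    have hs0 := stretch_pos hq
    set s := stretch ((z, ζ), Z) with hsdef
    have h1 : r / 2 ≤ (adjMap ((z, ζ), Z)).1.1 0 := by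
      rw [adjMap_base_zero]
      change r / 2 ≤ z 0 * s
      nlinarith
    have h2 := hC _ (dilate s ζ) (-dilate s⁻¹ Z) h1 (norm_adjMap_base_le hq hR)
    have h3 : (japSq (dilate s ζ) ^ n)⁻¹ ≤ 16 ^ n * (japSq ζ ^ n)⁻¹ := by
      rw [← div_eq_mul_inv, le_div_iff₀ (by positivity), inv_mul_le_iff₀
        (pow_pos (japSq_pos _) _), ← mul_pow, mul_comm]
      exact pow_le_pow_left₀ hJ.le (japSq_le_dilate hs ζ) n
    rw [adjSymbol_of_mem a hq, norm_mul, RCLike.norm_conj, Complex.norm_real,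
      Real.norm_of_nonneg (by positivity)]
    have h4 : (s ^ (n + 1))⁻¹ ≤ 2 ^ (n + 1) := by
      rw [← inv_pow]
      refine pow_le_pow_left₀ (inv_nonneg.2 hs0.le) ?_ _
      rw [inv_le_comm₀ hs0 two_pos]
      linarith
    calc _ ≤ 2 ^ (n + 1) * (C * (16 ^ n * (japSq ζ ^ n)⁻¹)) := by
          refine mul_le_mul h4 (h2.trans ?_) (norm_nonneg _) (by positivity)
          exact mul_le_mul_of_nonneg_left h3 hC0
      _ = _ := by ring
  · rw [adjSymbol_of_notMem a hq, norm_zero]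
    positivity

/-! ### The adjoint of an operator quantized by a full symbol -/

/-- The regularization of a symbol by a power of the cut-off; for `ε = 0` it is the symbol itself. -/
def regularize (K : ℕ) (a : FullPhase n → ℂ) (ε : ℝ) (q : FullPhase n) : ℂ :=
  ((cutoff ε q.1 ^ K : ℝ) : ℂ) * a q

theorem regularize_zero (K : ℕ) (a : FullPhase n → ℂ) : regularize K a 0 = a := by
  funext q
  simp [regularize, cutoff]

theorem continuous_regularize (K : ℕ) (a : FullPhase n → ℂ) (q : FullPhase n) :
    Continuous fun ε => regularize K a ε q := by
  unfold regularize cutoff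
  refine Continuous.mul (Complex.continuous_ofReal.comp (Continuous.pow ?_ K)) continuous_const
  refine Continuous.inv₀ (by fun_prop) fun ε => ?_
  positivity

theorem continuous_adjSymbol_regularize (K : ℕ) (a : FullPhase n → ℂ) (q : FullPhase n) :
    Continuous fun ε => adjSymbol (regularize K a ε) q := by
  by_cases hq : q ∈ adjRegion n
  · simp only [adjSymbol_of_mem _ hq]
    exact continuous_const.mul (Complex.continuous_conj.comp (continuous_regularize K a _))
  · simp only [adjSymbol_of_notMem _ hq]
    exact continuous_const

theorem SupportedNearDiagonal.regularize {a : FullPhase n → ℂ} (ha : SupportedNearDiagonal a)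
    (K : ℕ) (ε : ℝ) : SupportedNearDiagonal (regularize K a ε) := fun q hq h => by
  rw [BBSymbol.regularize, ha q hq h, mul_zero]

theorem nearSupported_adjSymbol {a : FullPhase n → ℂ} (ha : SupportedNearDiagonal a) :
    NearSupported (adjSymbol a) := fun _ _ h => adjSymbol_eq_zero ha (Or.inr h)

/-- The regularizations of a full symbol form a bounded family of full symbols of the same order. -/
theorem fullSymbolFamily_regularize {m l k j : ℝ} {a : FullPhase n → ℂ}
    (ha : FullSymbolFamily m l k j (fun _ : Set.Icc (0 : ℝ) 1 => a)) (K : ℕ) :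
    FullSymbolFamily m l k j (fun ε : Set.Icc (0 : ℝ) 1 => regularize K a ε) := by
  refine ((conormal_cutoff.pow K).smul ha).congr fun ε q _ => ?_
  simp only [regularize, Complex.real_smul]
  ring

theorem cutoff_le_inv_japSq {ε : ℝ} (h0 : 0 < ε) (h1 : ε ≤ 1) (p : Phase n) :
    cutoff ε p ≤ (ε ^ 2)⁻¹ * (japSq p.2)⁻¹ := by
  rw [cutoff, ← mul_inv]
  have := japSq_pos p.2
  refine inv_anti₀ (by positivity) ?_
  unfold japSq
  nlinarith

/-- A sufficiently high power of the cut-off makes a full symbol integrable in the fibre variable. -/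
theorem integrableSymbol_regularize {m l k j : ℝ} {a : FullPhase n → ℂ}
    (ha : FullSymbolFamily m l k j (fun _ : Set.Icc (0 : ℝ) 1 => a)) :
    ∃ K : ℕ, ∀ ε : Set.Icc (0 : ℝ) 1, 0 < (ε : ℝ) → IntegrableSymbol (regularize K a ε) := by
  obtain ⟨M, hM⟩ := ha.norm_le
  refine ⟨M + n, fun ε hε =>
    ⟨((fullSymbolFamily_regularize ha _).contDiffOn ε).continuousOn, fun r R hr => ?_⟩⟩
  obtain ⟨C, hC0, hC⟩ := hM r R hr
  refine ⟨((ε : ℝ) ^ 2)⁻¹ ^ (M + n) * C, by positivity, fun z ζ Z hz hR => ?_⟩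
  have h1 := cutoff_le_inv_japSq hε ε.2.2 (z, ζ)
  have h2 := (cutoff_pos (n := n) ε (z, ζ)).le
  have hJ := japSq_pos ζ
  rw [regularize, norm_mul, Complex.norm_real, Real.norm_of_nonneg (pow_nonneg h2 _)]
  calc _ ≤ (((ε : ℝ) ^ 2)⁻¹ * (japSq ζ)⁻¹) ^ (M + n) * (C * japSq ζ ^ M) :=
        mul_le_mul (pow_le_pow_left₀ h2 h1 _) (hC ε z ζ Z hz hR) (norm_nonneg _) (by positivity)
    _ = ((ε : ℝ) ^ 2)⁻¹ ^ (M + n) * C * (japSq ζ ^ n)⁻¹ := by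
        rw [mul_pow, pow_add (japSq ζ)⁻¹, inv_pow (japSq ζ), inv_pow (japSq ζ)]
        field_simp

/-- The adjoint of the operator quantized by a full symbol supported near the diagonal: the relation for
the regularized symbols passes to the limit on both sides. -/
theorem isAdjoint_quantize_adjSymbol {m l k j : ℝ} {a : FullPhase n → ℂ}
    (ha : FullSymbolFamily m l k j (fun _ : Set.Icc (0 : ℝ) 1 => a))
    (hs : SupportedNearDiagonal a) : IsAdjoint (quantize a) (quantize (adjSymbol a)) := by
  intro u v hu hv
  obtain ⟨K, hK⟩ := integrableSymbol_regularize ha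
  have hsε := fun ε : Set.Icc (0 : ℝ) 1 => hs.regularize K ε
  have hA := fullSymbolFamily_regularize ha K
  have hB := hA.adjSymbol hsε
  have hAs := fun ε => (hsε ε).nearSupported
  have hBs := fun ε => nearSupported_adjSymbol (hsε ε)
  have hcomm : ∀ b : FullPhase n → ℂ, (fun z => u z * conj (quantize b v z)) =
      fun z => conj (quantize b v z * conj (u z)) := fun b => by
    funext z
    simp [mul_comm]
  set ε₀ : Set.Icc (0 : ℝ) 1 := ⟨0, by simp⟩ with hε₀
  have hzero : regularize K a ε₀ = a := regularize_zero K a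
  -- the regularization is removed along the sequence `1 / (N + 1)`
  set e : ℕ → Set.Icc (0 : ℝ) 1 := fun N => ⟨1 / ((N : ℝ) + 1), by positivity, by
    rw [div_le_one (by positivity)]
    linarith [(Nat.cast_nonneg N : (0 : ℝ) ≤ N)]⟩ with he
  have he0 : ∀ N, 0 < (e N : ℝ) := fun N => by simp only [he]; positivity
  have hlim : Tendsto (fun N => (e N : ℝ)) atTop (𝓝 (ε₀ : ℝ)) :=
    tendsto_one_div_add_atTop_nhds_zero_nat
  have hIA := hA.integrable_quantize_mul hAs hu hv.conj ε₀
  have hIB := hB.integrable_quantize_mul hBs hv hu.conj ε₀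
  have hTA := hA.tendsto_pairing hAs hu hv.conj (e := e) (e₀ := ε₀) fun q _ =>
    ((continuous_regularize K a q).tendsto _).comp hlim
  have hTB := hB.tendsto_pairing hBs hv hu.conj (e := e) (e₀ := ε₀) fun q _ =>
    ((continuous_adjSymbol_regularize K a q).tendsto _).comp hlim
  rw [hzero] at hIA hIB hTA hTB
  refine ⟨hIA, ?_, ?_⟩
  · rw [hcomm]
    exact Complex.conjCLE.toContinuousLinearMap.integrable_comp hIB
  · refine tendsto_nhds_unique hTA ?_
    have hTB' := (Complex.continuous_conj.tendsto _).comp hTB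
    rw [hcomm, integral_conj]
    refine hTB'.congr fun N => ?_
    have hIN := hK (e N) (he0 N)
    rw [hIN.pairing_adjSymbol (hIN.adjSymbol (hB.contDiffOn (e N)).continuousOn) (hsε (e N)) hu hv,
      hcomm, integral_conj]
    rfl

/-! ### Restriction of full symbols and the principal symbol -/

theorem eqOn_applyFields {W G : Type*} [NormedAddCommGroup W] [NormedSpace ℝ W]
    [NormedAddCommGroup G] [NormedSpace ℝ G] {s : Set W} (hs : IsOpen s) {f g : W → G}
    (h : Set.EqOn f g s) (L : List (W → W)) :
    Set.EqOn (applyFields L f) (applyFields L g) s := by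
  induction L with
  | nil => exact h
  | cons V L ih =>
    intro p hp
    rw [applyFields_cons, applyFields_cons, applyField, applyField,
      (ih.eventuallyEq_of_mem (hs.mem_nhds hp)).fderiv_eq]

theorem applyFields_zero {W G : Type*} [NormedAddCommGroup W] [NormedSpace ℝ W]
    [NormedAddCommGroup G] [NormedSpace ℝ G] (L : List (W → W)) :
    applyFields L (fun _ => (0 : G)) = fun _ => 0 := by
  induction L with
  | nil => rfl
  | cons V L ih =>
    rw [applyFields_cons, ih]
    funext p
    simp [applyField]

theorem IsSymbolZero.congr {a b : Phase n → ℂ} (ha : IsSymbolZero a)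
    (h : ∀ p ∈ interiorSet n, b p = a p) : IsSymbolZero b := by
  refine ⟨ha.1.congr h, fun L hL R => ?_⟩
  obtain ⟨C, hC⟩ := ha.2 L hL R
  refine ⟨C, fun p hp hR => ?_⟩
  rw [eqOn_applyFields isOpen_interiorSet h L hp]
  exact hC p hp hR

theorem IsSymbol.congr {m l k j : ℝ} {a b : Phase n → ℂ} (ha : IsSymbol m l k j a)
    (h : ∀ p ∈ interiorSet n, b p = a p) : IsSymbol m l k j b :=
  IsSymbolZero.congr ha fun p hp => by rw [h p hp]

theorem isSymbol_of_eq_zero {m l k j : ℝ} {a : Phase n → ℂ} (h : ∀ p ∈ interiorSet n, a p = 0) :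
    IsSymbol m l k j a := by
  refine IsSymbolZero.congr (a := fun _ => 0) ⟨contDiffOn_const, fun L _ R => ⟨0, fun p _ _ => ?_⟩⟩
    fun p hp => by rw [h p hp, mul_zero]
  rw [applyFields_zero, norm_zero]

/-- The fields of `𝒱₂`, lifted without `(X, Y)` component, are tangent to `(X, Y) = (0, 0)`: they
commute with the restriction. -/
theorem applyFields_restrictZero {f : FullPhase n → ℂ} (hf : ContDiffOn ℝ ∞ f (fullInteriorSet n))
    {L : List (Phase n → Phase n)} (hL : ∀ V ∈ L, IsTangentField V) :
    ContDiffOn ℝ ∞ (applyFields (L.map fun V (q : FullPhase n) => ((V q.1, 0) : FullPhase n)) f)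
      (fullInteriorSet n) ∧
    Set.EqOn (applyFields L (restrictZero f)) (restrictZero (applyFields
      (L.map fun V (q : FullPhase n) => ((V q.1, 0) : FullPhase n)) f)) (interiorSet n) := by
  induction L with
  | nil => exact ⟨hf, fun _ _ => rfl⟩
  | cons V L ih =>
    obtain ⟨h1, h2⟩ := ih fun V hV => hL V (List.mem_cons_of_mem _ hV)
    have hV := (hL V List.mem_cons_self).contDiffOn
    rw [List.map_cons, applyFields_cons, applyFields_cons]
    refine ⟨(h1.fderiv_of_isOpen isOpen_fullInteriorSet (m := ∞) (by simp)).clm_apply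
      ((hV.comp (contDiff_fst (E := Phase n) (F := E n)).contDiffOn fun q hq => hq).prodMk contDiffOn_const), fun p hp => ?_⟩
    have hq : ((p, 0) : FullPhase n) ∈ fullInteriorSet n := hp
    have h3 := ((h1.differentiableOn (by simp)).differentiableAt
      (isOpen_fullInteriorSet.mem_nhds hq)).hasFDerivAt
    have h4 : HasFDerivAt (fun p : Phase n => ((p, 0) : FullPhase n)) _ p :=
      (hasFDerivAt_id (𝕜 := ℝ) p).prodMk (hasFDerivAt_const (0 : E n) p)
    have h5 := h3.comp p h4
    rw [applyField, (h2.eventuallyEq_of_mem (isOpen_interiorSet.mem_nhds hp)).fderiv_eq]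
    refine (congrArg (fun T => T (V p)) h5.fderiv).trans ?_
    simp [restrictZero, applyField]

theorem IsFullSymbolZero.isSymbolZero_restrictZero {f : FullPhase n → ℂ}
    (hf : IsFullSymbolZero f) : IsSymbolZero (restrictZero f) := by
  refine ⟨?_, fun L hL R => ?_⟩
  · have h : ContDiff ℝ ∞ (fun p : Phase n => ((p, 0) : FullPhase n)) :=
      contDiff_id.prodMk contDiff_const
    exact hf.1.comp h.contDiffOn fun p hp => hp
  · obtain ⟨C, hC⟩ := hf.2 (L.map fun V (q : FullPhase n) => ((V q.1, 0) : FullPhase n)) (by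
      simp only [List.mem_map]
      rintro _ ⟨V, hV, rfl⟩
      exact .lift V (hL V hV)) R
    refine ⟨C, fun p hp hR => ?_⟩
    rw [(applyFields_restrictZero hf.1 hL).2 hp]
    exact hC (p, 0) hp hR

theorem IsFullSymbol.isSymbol_restrictZero {m l k j : ℝ} {a : FullPhase n → ℂ}
    (ha : IsFullSymbol m l k j a) : IsSymbol m l k j (restrictZero a) :=
  IsFullSymbolZero.isSymbolZero_restrictZero ha

/-- On `(X, Y) = (0, 0)` the change of variables of the adjoint is the identity. -/
theorem restrictZero_adjSymbol (a : FullPhase n → ℂ) {p : Phase n} (hp : p ∈ interiorSet n) :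
    restrictZero (adjSymbol a) p = conj (restrictZero a p) := by
  have hs : stretch ((p, 0) : FullPhase n) = 1 := by simp [stretch]
  have h0 : ∀ c : ℝ, dilate c (0 : E n) = 0 := fun c => by
    ext i
    simp [dilate_apply]
  have hm : ((p, 0) : FullPhase n) ∈ adjRegion n := by
    refine ⟨hp, ?_, ?_⟩
    · rw [hs]; norm_num
    · simp
  have hΦ : adjMap ((p, 0) : FullPhase n) = (p, 0) := by
    simp only [adjMap, hs, dilate_one, scatShift_eq, h0, add_zero, neg_zero, inv_one]
  rw [restrictZero, adjSymbol_of_mem a hm, hΦ, hs]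
  simp [restrictZero]

end BBSymbol

end

open BBSymbol in
theorem mainTheorem8 {n : ℕ} [NeZero n] (hn : 3 ≤ n) (m l k j : ℝ)
    (a : FullPhase n → ℂ) (ha : IsFullSymbol m l k j a) (hsupp : SupportedNearDiagonal a) :
    QuantizationConverges a ∧
    ∃ b : FullPhase n → ℂ,
      IsFullSymbol m l k j b ∧
      QuantizationConverges b ∧
      IsAdjoint (quantize a) (quantize b) ∧
      SamePrincipalSymbol m l k j (restrictZero b) (fun p => conj (restrictZero a p)) ∧
      ∀ p ∈ interiorSet n, restrictZero b p = conj (restrictZero a p) := by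
  have hA := (isFullSymbol_iff Unit).1 ha
  have hB := hA.adjSymbol fun _ => hsupp
  have hb := (isFullSymbol_iff Unit).2 hB
  refine ⟨hA.quantizationConverges (fun _ => hsupp.nearSupported) (), adjSymbol a, hb,
    hB.quantizationConverges (fun _ => nearSupported_adjSymbol hsupp) (),
    isAdjoint_quantize_adjSymbol ((isFullSymbol_iff _).1 ha) hsupp,
    ⟨hb.isSymbol_restrictZero,
      hb.isSymbol_restrictZero.congr fun p hp => (restrictZero_adjSymbol a hp).symm,
      isSymbol_of_eq_zero fun p hp => ?_⟩, fun p hp => restrictZero_adjSymbol a hp⟩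
  rw [restrictZero_adjSymbol a hp, sub_self]
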